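/- Let $M$ be a smooth (Hausdorff, second countable, finite-dimensional) manifold with a Poisson tensor $\Psi$, and let $S\subset M$ be an embedded symplectic leaf of $\Psi$. For a bivector field $P$ we write $\langle\beta,P^\sharp\alpha\rangle=P(\alpha,\beta)$. For a Poisson tensor $P$ on a manifold $N$, $\operatorname{Poiss}(N,P)$ is the space of vector fields $Z$ with $L_ZP=0$, $\operatorname{Ham}(N,P)=\{P^\sharp dK : K\in C^\infty(N)\}$, $\operatorname{Casim}(N,P)=\{k\in C^\infty(N) : P^\sharp dk=0\}$, and $H^1_P(N)=\operatorname{Poiss}(N,P)/\operatorname{Ham}(N,P)$ is the first Poisson cohomology. Then there is a tubular neighborhood $N$ of $S$ in $M$, that is, an open neighborhood of $S$ identified by an exponential map with an open neighborhood of the zero section of the normal bundle of $S$, with projection $\pi:N\to S$ and vertical subbundle $\mathbb V=\ker d\pi$, such that $$\Psi|_N=\Psi_H+\Psi_V ,$$ where $\Psi_H$ is a bivector field on $N$ of constant rank $\dim S$, and $\Psi_V$ is a Poisson bivector field on $N$ that vanishes at the points of $S$. More precisely, $TN=\mathbb H\oplus\mathbb V$ with $\mathbb H=\Psi^\sharp(\mathbb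 V^0)=\Psi_H^\sharp(T^*N)$, where $\mathbb V^0\subset T^*N$ is the annihilator of $\mathbb V$, and $\Psi_V^\sharp(T^*N)\subset\mathbb V$. For $u\in\mathfrak X(S)$ let $\operatorname{hor}(u)$ be the section of $\mathbb H$ that is $\pi$-related to $u$, and let $\sigma\in\Omega^2(S)\otimes_{C^\infty(S)}C^\infty(N)$ be the coupling form, determined by $\Psi_H^\sharp\big(\sigma(u,d\pi\,\cdot)\big)=-\operatorname{hor}(u)$. On $\Omega^p(S)\otimes_{C^\infty(S)}C^\infty(N)$ let $$(\partial\eta)(u_0,\dots,u_p)=\sum_i(-1)^iL_{\operatorname{hor}(u_i)}\eta(u_0,\dots,\hat u_i,\dots,u_p)+\sum_{i<j}(-1)^{i+j}\eta([u_i,u_j],u_0,\dots,\hat u_i,\dots,\hat u_j,\dots,u_p).$$ Let $\mathcal C^p=\Omega^p(S)\otimes_{C^\infty(S)}\operatorname{Casim}(N,\Psi_V)$, let $\bar\partial$ be the restriction of $\partial$ to $\mathcal C^*$, and $H^p_{\bar\partial}$ its cohomology (in particular, exact forms in $\mathcal C^1$ and $\mathcal C^2$ are closed). Let $$\mathcal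 A=\{Y\in\operatorname{Poiss}(N,\Psi_V)\cap\Gamma(\mathbb V) : [\operatorname{hor}(u),Y]\in\operatorname{Ham}(N,\Psi_V)\ \text{for all } u\in\mathfrak X(S)\}.$$ For every $Y\in\mathcal A$ there is $\beta_Y\in\Omega^1(S)\otimes_{C^\infty(S)}C^\infty(N)$ with $[\operatorname{hor}(u),Y]=-\Psi_V^\sharp d(\beta_Y(u))$ for all $u$. For each such $\beta_Y$ the 2-form $\partial\beta_Y+L_Y\sigma$ lies in $\mathcal C^2$ and is $\bar\partial$-closed, and there is a linear map $\rho:\mathcal A\to H^2_{\bar\partial}$ with $\rho(Y)=[\partial\beta_Y+L_Y\sigma]$ for every choice of $\beta_Y$. Moreover $\operatorname{Ham}(N,\Psi_V)\subset\ker\rho$, and there is an isomorphism of vector spaces $$H^1_\Psi(N)\;\cong\;H^1_{\bar\partial}\oplus\frac{\ker(\rho:\mathcal A\to H^2_{\bar\partial})}{\operatorname{Ham}(N,\Psi_V)} .$$ -/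

import Mathlib

open scoped Manifold ContDiff Topology Bundle

noncomputable section

set_option linter.unusedSectionVars false

namespace SemilocalPoisson

universe u

/-! ### Vector fields and bivector fields on a manifold -/

section Poisson

variable {E : Type*} [NormedAddCommGroup E] [NormedSpace ℝ E]
  {H : Type*} [TopologicalSpace H] (I : ModelWithCorners ℝ E H)
  (M : Type*) [TopologicalSpace M] [ChartedSpace H M]

/-- Smooth vector fields on `M`. -/
abbrev SmoothVF [IsManifold I ∞ M] : Type _ :=
  Cₛ^∞⟮I; E, (TangentSpace I : M → Type _)⟯

/-- A smooth bivector field `Ψ`, given by its skew-symmetric morphism `Ψ♯ : T*M → TM`,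
that is `⟨β, Ψ♯ α⟩ = Ψ(α, β)`. It is smooth when it sends differentials of smooth functions to
smooth vector fields. -/
structure BivectorField [IsManifold I ∞ M] where
  sharp : ∀ x : M, (TangentSpace I x →L[ℝ] ℝ) →ₗ[ℝ] TangentSpace I x
  skew : ∀ (x : M) (α β : TangentSpace I x →L[ℝ] ℝ), β (sharp x α) = - α (sharp x β)
  smooth : ∀ F : M → ℝ, ContMDiff I 𝓘(ℝ, ℝ) ∞ F →
    ContMDiff I I.tangent ∞
      (fun x => (⟨x, sharp x (mvfderiv I F x)⟩ : TangentBundle I M))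

variable {I M}

lemma contMDiff_const_smul' (c : ℝ) {F : M → ℝ} (hF : ContMDiff I 𝓘(ℝ, ℝ) ∞ F) :
    ContMDiff I 𝓘(ℝ, ℝ) ∞ (c • F) :=
  (contDiff_const.mul contDiff_id : ContDiff ℝ ∞ (fun t : ℝ => c * t)).contMDiff.comp hF

lemma mvfderiv_const_smul' (c : ℝ) {F : M → ℝ} (hF : ContMDiff I 𝓘(ℝ, ℝ) ∞ F) (x : M) :
    mvfderiv I (c • F) x = c • mvfderiv I F x := by
  have := mvfderiv_smul (I := I) (x := x) (a := fun _ : M => c) (g := F)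
    mdifferentiableAt_const ((hF x).mdifferentiableAt (by simp))
  rw [mvfderiv_const] at this
  ext v
  have h2 := congrArg (fun L => L v) this
  simp only [add_apply, smul_apply] at h2 ⊢
  rw [show (c • F) = ((fun _ : M => c) • F) from rfl, h2]
  simp

lemma mvfderiv_add' {F G : M → ℝ} (hF : ContMDiff I 𝓘(ℝ, ℝ) ∞ F)
    (hG : ContMDiff I 𝓘(ℝ, ℝ) ∞ G) (x : M) :
    mvfderiv I (F + G) x = mvfderiv I F x + mvfderiv I G x :=
  mvfderiv_add ((hF x).mdifferentiableAt (by simp)) ((hG x).mdifferentiableAt (by simp))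

variable [IsManifold I ∞ M]

/-- The derivative `Z F = dF(Z)` of a function along a vector field. -/
def lieD (Z : ∀ x : M, TangentSpace I x) (F : M → ℝ) (x : M) : ℝ :=
  mvfderiv I F x (Z x)

lemma contMDiff_lieD {Z : ∀ x : M, TangentSpace I x}
    (hZ : ContMDiff I I.tangent ∞ (fun x => (⟨x, Z x⟩ : TangentBundle I M)))
    {F : M → ℝ} (hF : ContMDiff I 𝓘(ℝ, ℝ) ∞ F) :
    ContMDiff I 𝓘(ℝ, ℝ) ∞ (lieD Z F) := by
  have h1 : ContMDiff I.tangent 𝓘(ℝ, ℝ).tangent ∞ (tangentMap I 𝓘(ℝ, ℝ) F) :=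
    hF.contMDiff_tangentMap (by simp)
  exact (contMDiff_snd_tangentBundle_modelSpace ℝ 𝓘(ℝ, ℝ)).comp (h1.comp hZ)

lemma lieD_add_right (Z : ∀ x : M, TangentSpace I x) {F G : M → ℝ}
    (hF : ContMDiff I 𝓘(ℝ, ℝ) ∞ F) (hG : ContMDiff I 𝓘(ℝ, ℝ) ∞ G) :
    lieD Z (F + G) = lieD Z F + lieD Z G := by
  funext x
  simp [lieD, mvfderiv_add ((hF x).mdifferentiableAt (by simp))
    ((hG x).mdifferentiableAt (by simp))]

namespace BivectorField

variable (Ψ : BivectorField I M)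

/-- The Hamiltonian vector field `X_F = Ψ♯ dF`. -/
def hamVF (F : M → ℝ) (x : M) : TangentSpace I x := Ψ.sharp x (mvfderiv I F x)

/-- The bracket `{F, G} = Ψ(dF, dG)`. -/
def bracket (F G : M → ℝ) : M → ℝ := lieD (Ψ.hamVF F) G

/-- `Ψ` is a Poisson tensor: `[Ψ, Ψ] = 0`, i.e. the bracket satisfies the Jacobi identity. -/
def IsPoisson : Prop :=
  ∀ F G K : M → ℝ, ContMDiff I 𝓘(ℝ, ℝ) ∞ F → ContMDiff I 𝓘(ℝ, ℝ) ∞ G →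
    ContMDiff I 𝓘(ℝ, ℝ) ∞ K → ∀ x : M,
      Ψ.bracket F (Ψ.bracket G K) x + Ψ.bracket G (Ψ.bracket K F) x
        + Ψ.bracket K (Ψ.bracket F G) x = 0

/-- The rank of `Ψ` at a point. -/
def rank (x : M) : ℕ := Module.finrank ℝ (LinearMap.range (Ψ.sharp x))

/-- Casimir functions: smooth functions with zero Hamiltonian vector field. -/
def IsCasimir (k : M → ℝ) : Prop :=
  ContMDiff I 𝓘(ℝ, ℝ) ∞ k ∧ ∀ x, Ψ.hamVF k x = 0

/-- Poisson vector fields: the vector fields `Z` with `L_Z Ψ = 0`, that is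
`(L_Z Ψ)(dF, dG) = Z{F, G} - {Z F, G} - {F, Z G} = 0`. -/
def poiss : Submodule ℝ (SmoothVF I M) where
  carrier := {Z | ∀ F G : M → ℝ, ContMDiff I 𝓘(ℝ, ℝ) ∞ F → ContMDiff I 𝓘(ℝ, ℝ) ∞ G → ∀ x,
    lieD (fun y => Z y) (Ψ.bracket F G) x =
      Ψ.bracket (lieD (fun y => Z y) F) G x + Ψ.bracket F (lieD (fun y => Z y) G) x}
  zero_mem' := by
    intro F G hF hG x
    have h (K : M → ℝ) : lieD (fun y => (0 : SmoothVF I M) y) K = 0 := by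
      funext y; simp [lieD]
    rw [h, h, h]
    simp [bracket, hamVF, lieD, mvfderiv_zero]
  add_mem' := by
    intro Z W hZ hW F G hF hG x
    have h (K : M → ℝ) : lieD (fun y => (Z + W) y) K =
        lieD (fun y => Z y) K + lieD (fun y => W y) K := by
      funext y; simp [lieD]
    have hs (Z : SmoothVF I M) {K : M → ℝ} (hK : ContMDiff I 𝓘(ℝ, ℝ) ∞ K) :
        ContMDiff I 𝓘(ℝ, ℝ) ∞ (lieD (fun y => Z y) K) := contMDiff_lieD Z.contMDiff hK
    have h1 := hZ F G hF hG x
    have h2 := hW F G hF hG x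
    rw [h, h, h]
    simp only [Pi.add_apply, h1, h2]
    simp only [bracket, lieD_add_right _ (hs Z hG) (hs W hG), Pi.add_apply]
    simp only [lieD, hamVF]
    rw [mvfderiv_add' (hs Z hF) (hs W hF) x]
    simp only [map_add]
    ring
  smul_mem' := by
    intro c Z hZ F G hF hG x
    have h (K : M → ℝ) : lieD (fun y => (c • Z) y) K = c • lieD (fun y => Z y) K := by
      funext y; simp [lieD]
    have hs {K : M → ℝ} (hK : ContMDiff I 𝓘(ℝ, ℝ) ∞ K) :
        ContMDiff I 𝓘(ℝ, ℝ) ∞ (lieD (fun y => Z y) K) := contMDiff_lieD Z.contMDiff hK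
    have h1 := hZ F G hF hG x
    rw [h, h, h]
    simp only [Pi.smul_apply, h1]
    simp only [bracket]
    simp only [lieD, hamVF]
    rw [mvfderiv_const_smul' c (hs hF) x, mvfderiv_const_smul' c (hs hG) x]
    simp only [map_smul, smul_apply, smul_eq_mul]
    ring

/-- Hamiltonian vector fields. -/
def ham : Submodule ℝ (SmoothVF I M) where
  carrier := {Z | ∃ F : M → ℝ, ContMDiff I 𝓘(ℝ, ℝ) ∞ F ∧ ∀ x, Z x = Ψ.hamVF F x}
  zero_mem' := ⟨0, contMDiff_const, fun x => by simp [hamVF, mvfderiv_zero]⟩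
  add_mem' := by
    rintro Z W ⟨F, hF, hZ⟩ ⟨G, hG, hW⟩
    exact ⟨F + G, hF.add hG, fun x => by simp [hZ, hW, hamVF, mvfderiv_add' hF hG]⟩
  smul_mem' := by
    rintro c Z ⟨F, hF, hZ⟩
    exact ⟨c • F, contMDiff_const_smul' c hF, fun x => by simp [hZ, hamVF, mvfderiv_const_smul' c hF]⟩

/-- The first Poisson cohomology `H¹_Ψ(M) = Poiss(M, Ψ) / Ham(M, Ψ)`. -/
abbrev H1 : Type _ := ↥Ψ.poiss ⧸ Ψ.ham.submoduleOf Ψ.poiss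

/-- `y` is reached from `x` along an integral curve of a Hamiltonian vector field. -/
def HamStep (x y : M) : Prop :=
  ∃ (F : M → ℝ) (c : ℝ → M) (T : ℝ), ContMDiff I 𝓘(ℝ, ℝ) ∞ F ∧ 0 ≤ T ∧
    IsMIntegralCurveOn c (Ψ.hamVF F) (Set.Icc 0 T) ∧ c 0 = x ∧ c T = y

/-- The symplectic leaf through `x`: the points that are joined to `x` by finitely many successive
integral curves of Hamiltonian vector fields. -/
def leaf (x : M) : Set M := {y | Relation.ReflTransGen Ψ.HamStep x y}

end BivectorField

end Poisson

section Leaf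

variable {E : Type*} [NormedAddCommGroup E] [NormedSpace ℝ E]
  {H : Type*} [TopologicalSpace H] {I : ModelWithCorners ℝ E H}
  {M : Type*} [TopologicalSpace M] [ChartedSpace H M] [IsManifold I ∞ M]
  {F : Type*} [NormedAddCommGroup F] [NormedSpace ℝ F]
  {H' : Type*} [TopologicalSpace H'] {J : ModelWithCorners ℝ F H'}
  {S : Type*} [TopologicalSpace S] [ChartedSpace H' S] [IsManifold J ∞ S]

/-- The map `φ` is a Poisson map: `dφ ∘ Π♯ ∘ dφ* = Ψ♯ ∘ φ`. When `φ` is the inclusion of an open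
subset, this says that `Π` is the restriction of `Ψ`. -/
def BivectorField.Related (φ : S → M) (P : BivectorField J S) (Ψ : BivectorField I M) : Prop :=
  ∀ (x : S) (α : TangentSpace I (φ x) →L[ℝ] ℝ),
    mfderiv J I φ x (P.sharp x (α ∘L mfderiv J I φ x)) = Ψ.sharp (φ x) α

/-- The manifold `S`, embedded in `M` by `ι`, is a symplectic leaf of `Ψ`: it is an integral
submanifold of the characteristic distribution `Ψ♯(T*M)`, and as a set it is one of the leaves. -/
structure IsEmbeddedSymplecticLeaf (Ψ : BivectorField I M) (ι : S → M) : Prop where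
  embedding : Manifold.IsSmoothEmbedding J I ∞ ι
  isLeaf : ∃ x : M, Set.range ι = Ψ.leaf x
  tangent : ∀ s : S,
    (mfderiv J I ι s).range = LinearMap.range (Ψ.sharp (ι s))

end Leaf

/-! ### Tubular neighborhoods -/

section Tubular

variable {E : Type u} [NormedAddCommGroup E] [NormedSpace ℝ E]
  {M : Type*} [TopologicalSpace M] [ChartedSpace E M] [IsManifold 𝓘(ℝ, E) ∞ M]
  {F : Type*} [NormedAddCommGroup F] [NormedSpace ℝ F]
  {S : Type*} [TopologicalSpace S] [ChartedSpace F S] [IsManifold 𝓘(ℝ, F) ∞ S]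

/-- The fibre `T_{ι s} M / T_s S` of the normal bundle of `ι : S → M`. -/
abbrev NormalSpace (E : Type*) [NormedAddCommGroup E] [NormedSpace ℝ E]
    {M : Type*} [TopologicalSpace M] [ChartedSpace E M]
    (F : Type*) [NormedAddCommGroup F] [NormedSpace ℝ F]
    {S : Type*} [TopologicalSpace S] [ChartedSpace F S] (ι : S → M) (s : S) : Type _ :=
  TangentSpace 𝓘(ℝ, E) (ι s) ⧸ (mfderiv 𝓘(ℝ, F) 𝓘(ℝ, E) ι s).range

/-- A tubular neighborhood of the submanifold `ι : S → M`. The smooth vector bundle `V` over `S`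
with the isomorphisms `normal` is a model of the normal bundle, and `f` (the exponential map)
is a diffeomorphism from an open neighborhood of the zero section of `V` onto an open neighborhood
of `S`. It is the identity on `S`, and its differential along `S`, restricted to the vertical
vectors and projected to the normal bundle, is the identity (that is, `normal`). -/
structure TubularNeighborhood (E : Type u) [NormedAddCommGroup E] [NormedSpace ℝ E]
    {M : Type*} [TopologicalSpace M] [ChartedSpace E M]
    (F : Type*) [NormedAddCommGroup F] [NormedSpace ℝ F]
    {S : Type*} [TopologicalSpace S] [ChartedSpace F S] (ι : S → M) where
  /-- model fibre of the normal bundle -/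
  G : Type u
  [normedAddCommGroupG : NormedAddCommGroup G]
  [normedSpaceG : NormedSpace ℝ G]
  /-- fibres of the normal bundle -/
  V : S → Type u
  [addCommGroupV : ∀ s, AddCommGroup (V s)]
  [moduleV : ∀ s, Module ℝ (V s)]
  [topologicalSpaceV : ∀ s, TopologicalSpace (V s)]
  [topologicalSpaceTotal : TopologicalSpace (Bundle.TotalSpace G V)]
  [fiberBundle : FiberBundle G V]
  [vectorBundle : VectorBundle ℝ G V]
  [smoothBundle : ContMDiffVectorBundle ∞ G V 𝓘(ℝ, F)]
  f : OpenPartialHomeomorph (Bundle.TotalSpace G V) M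
  contMDiffOn_f : ContMDiffOn (𝓘(ℝ, F).prod 𝓘(ℝ, G)) 𝓘(ℝ, E) ∞ f f.source
  contMDiffOn_symm : ContMDiffOn 𝓘(ℝ, E) (𝓘(ℝ, F).prod 𝓘(ℝ, G)) ∞ f.symm f.target
  zero_mem : ∀ s : S, (⟨s, 0⟩ : Bundle.TotalSpace G V) ∈ f.source
  f_zero : ∀ s : S, f ⟨s, 0⟩ = ι s
  normal : ∀ s : S, V s ≃ₗ[ℝ] NormalSpace E F ι s
  normal_eq : ∀ (s : S) (v : V s),
    Submodule.Quotient.mk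
      (mfderiv 𝓘(ℝ, ℝ) 𝓘(ℝ, E) (fun t : ℝ => f ⟨s, t • v⟩) 0 (1 : ℝ) :
        TangentSpace 𝓘(ℝ, E) (ι s)) = normal s v

attribute [instance] TubularNeighborhood.normedAddCommGroupG TubularNeighborhood.normedSpaceG
  TubularNeighborhood.addCommGroupV TubularNeighborhood.moduleV
  TubularNeighborhood.topologicalSpaceV TubularNeighborhood.topologicalSpaceTotal
  TubularNeighborhood.fiberBundle TubularNeighborhood.vectorBundle
  TubularNeighborhood.smoothBundle

namespace TubularNeighborhood

variable {ι : S → M} (T : TubularNeighborhood E F ι)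

/-- The underlying open neighborhood `N` of `S` in `M`. -/
def nbhd : TopologicalSpace.Opens M := ⟨T.f.target, T.f.open_target⟩

/-- The projection `N → S`. -/
def proj (x : T.nbhd) : S := (T.f.symm x).proj

end TubularNeighborhood

end Tubular

/-! ### Forms on the base with values in functions on the total space -/

section Fibered

variable {E : Type*} [NormedAddCommGroup E] [NormedSpace ℝ E]
  {H : Type*} [TopologicalSpace H] {I : ModelWithCorners ℝ E H}
  {N : Type*} [TopologicalSpace N] [ChartedSpace H N] [IsManifold I ∞ N]
  {F : Type*} [NormedAddCommGroup F] [NormedSpace ℝ F]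
  {H' : Type*} [TopologicalSpace H'] {J : ModelWithCorners ℝ F H'}
  {B : Type*} [TopologicalSpace B] [ChartedSpace H' B] [IsManifold J ∞ B]

/-- Families, indexed by `e : N`, of alternating `p`-forms on `T_{pr e} B`. -/
def RawForm (J : ModelWithCorners ℝ F H') (pr : N → B) (p : ℕ) : Type _ :=
  ∀ e : N, TangentSpace J (pr e) [⋀^Fin p]→ₗ[ℝ] ℝ

instance (J : ModelWithCorners ℝ F H') (pr : N → B) (p : ℕ) : AddCommGroup (RawForm J pr p) :=
  inferInstanceAs (AddCommGroup (∀ e : N, TangentSpace J (pr e) [⋀^Fin p]→ₗ[ℝ] ℝ))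

instance (J : ModelWithCorners ℝ F H') (pr : N → B) (p : ℕ) : Module ℝ (RawForm J pr p) :=
  inferInstanceAs (Module ℝ (∀ e : N, TangentSpace J (pr e) [⋀^Fin p]→ₗ[ℝ] ℝ))

/-- The function `η(u₁, …, u_p)` on `N`, for vector fields `u_i` on `B`. -/
def evalForm {pr : N → B} {p : ℕ} (η : RawForm J pr p) (u : Fin p → SmoothVF J B) (e : N) : ℝ :=
  η e (fun i => u i (pr e))

lemma evalForm_add {pr : N → B} {p : ℕ} (η θ : RawForm J pr p) (u : Fin p → SmoothVF J B) :
    evalForm (η + θ) u = evalForm η u + evalForm θ u := rfl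

lemma evalForm_smul {pr : N → B} {p : ℕ} (c : ℝ) (η : RawForm J pr p)
    (u : Fin p → SmoothVF J B) : evalForm (c • η) u = c • evalForm η u := rfl

lemma RawForm.add_apply {pr : N → B} {p : ℕ} (η θ : RawForm J pr p) (e : N)
    (v : Fin p → TangentSpace J (pr e)) : (η + θ) e v = η e v + θ e v := rfl

lemma RawForm.smul_apply {pr : N → B} {p : ℕ} (c : ℝ) (η : RawForm J pr p) (e : N)
    (v : Fin p → TangentSpace J (pr e)) : (c • η) e v = c * η e v := rfl

/-- `Ω^p(B) ⊗ C^∞(N)`, the smooth `p`-forms on `B` with values in functions on `N`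
(equivalently, the horizontal `p`-forms on `N`). -/
def horForm (I : ModelWithCorners ℝ E H) (J : ModelWithCorners ℝ F H') [IsManifold J ∞ B]
    (pr : N → B) (p : ℕ) : Submodule ℝ (RawForm J pr p) where
  carrier := {η | ∀ u : Fin p → SmoothVF J B, ContMDiff I 𝓘(ℝ, ℝ) ∞ (evalForm η u)}
  zero_mem' := fun _ => contMDiff_const
  add_mem' := fun hη hθ u => (hη u).add (hθ u)
  smul_mem' := fun c _ hη u => contMDiff_const_smul' c (hη u)

/-- `C^p = Ω^p(B) ⊗ Casim(N, P)`, the `p`-forms on `B` with values in Casimir functions of `P`. -/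
def casForm (J : ModelWithCorners ℝ F H') [IsManifold J ∞ B] (P : BivectorField I N) (pr : N → B)
    (p : ℕ) : Submodule ℝ (RawForm J pr p) where
  carrier := {η | ∀ u : Fin p → SmoothVF J B, P.IsCasimir (evalForm η u)}
  zero_mem' := fun u => ⟨contMDiff_const, fun x => by
    rw [show evalForm (0 : RawForm J pr p) u = 0 from rfl]
    simp [BivectorField.hamVF, mvfderiv_zero]⟩
  add_mem' := fun {η θ} hη hθ u => ⟨(hη u).1.add (hθ u).1, fun x => by
    have h1 := (hη u).2 x
    have h2 := (hθ u).2 x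
    rw [BivectorField.hamVF] at h1 h2 ⊢
    rw [evalForm_add, mvfderiv_add' (hη u).1 (hθ u).1, map_add, h1, h2, add_zero]⟩
  smul_mem' := fun c η hη u => ⟨contMDiff_const_smul' c (hη u).1, fun x => by
    have h1 := (hη u).2 x
    rw [BivectorField.hamVF] at h1 ⊢
    rw [evalForm_smul, mvfderiv_const_smul' c (hη u).1, map_smul, h1, smul_zero]⟩

variable (I J) in
/-- An Ehresmann connection on `pr : N → B`, given by its horizontal lift
`pr^* TB → TN`; its horizontal subbundle is the image of the lift, and the projection to the
vertical subbundle is `id - lift ∘ d(pr)`. -/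
structure EhresmannConnection (pr : N → B) where
  lift : ∀ e : N, TangentSpace J (pr e) →ₗ[ℝ] TangentSpace I e
  mfderiv_lift : ∀ (e : N) (v : TangentSpace J (pr e)), mfderiv I J pr e (lift e v) = v
  smooth : ∀ u : SmoothVF J B, ContMDiff I I.tangent ∞
    (fun e => (⟨e, lift e (u (pr e))⟩ : TangentBundle I N))

namespace EhresmannConnection

variable {pr : N → B} (γ : EhresmannConnection I J pr)

/-- The horizontal lift `hor(u)` of a vector field `u` on the base. -/
def hor (u : SmoothVF J B) (e : N) : TangentSpace I e := γ.lift e (u (pr e))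

/-- The covariant exterior derivative, evaluated on vector fields `u₀, …, u_p` on `B`:
`Σᵢ (-1)ⁱ L_{hor(uᵢ)} η(u₀, …, ûᵢ, …, u_p)
  + Σ_{i < j} (-1)^{i+j} η([uᵢ, uⱼ], u₀, …, ûᵢ, …, ûⱼ, …, u_p)`.
In the last sum the pair `i < j` is written `(i.castSucc, j.succ)` with `i ≤ j`, whence the sign. -/
def covD : {p : ℕ} → RawForm J pr p → (Fin (p + 1) → SmoothVF J B) → N → ℝ
  | 0, η, u => lieD (γ.hor (u 0)) (evalForm η Fin.elim0)
  | p + 1, η, u => fun e =>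
      (∑ i : Fin (p + 2), (-1 : ℝ) ^ (i : ℕ) *
        lieD (γ.hor (u i)) (evalForm η (i.removeNth u)) e)
      - ∑ i : Fin (p + 1), ∑ j ∈ Finset.Ici i, (-1 : ℝ) ^ ((i : ℕ) + (j : ℕ)) *
          η e (Matrix.vecCons
            (VectorField.mlieBracket J (fun b => u i.castSucc b) (fun b => u j.succ b) (pr e))
            (fun k => (j.removeNth (i.castSucc.removeNth u) : Fin p → SmoothVF J B) k (pr e)))

lemma covD_add {p : ℕ} {η θ : RawForm J pr p} (hη : η ∈ horForm I J pr p)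
    (hθ : θ ∈ horForm I J pr p) (u : Fin (p + 1) → SmoothVF J B) :
    γ.covD (η + θ) u = γ.covD η u + γ.covD θ u := by
  cases p with
  | zero => exact lieD_add_right _ (hη _) (hθ _)
  | succ p =>
    funext e
    simp only [covD, evalForm_add, lieD_add_right _ (hη _) (hθ _), Pi.add_apply,
      RawForm.add_apply, mul_add, Finset.sum_add_distrib]
    ring

lemma covD_smul {p : ℕ} (c : ℝ) {η : RawForm J pr p} (hη : η ∈ horForm I J pr p)
    (u : Fin (p + 1) → SmoothVF J B) :
    γ.covD (c • η) u = c • γ.covD η u := by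
  have key (Z : ∀ x : N, TangentSpace I x) (v : Fin p → SmoothVF J B) :
      lieD Z (c • evalForm η v) = c • lieD Z (evalForm η v) := by
    funext e
    simp [lieD, mvfderiv_const_smul' c (hη v)]
  cases p with
  | zero => exact key _ _
  | succ p =>
    funext e
    simp only [covD, evalForm_smul, key, Pi.smul_apply, RawForm.smul_apply, smul_eq_mul,
      mul_sub, Finset.mul_sum, mul_left_comm c]

variable (P : BivectorField I N)

lemma casForm_le_horForm (p : ℕ) : casForm J P pr p ≤ horForm I J pr p := fun _ hη u => (hη u).1

/-- The cocycles `Z^p` of the covariant exterior derivative on `C^p`. -/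
def cocycles (p : ℕ) : Submodule ℝ (RawForm J pr p) where
  carrier := {η | η ∈ casForm J P pr p ∧ ∀ u, γ.covD η u = 0}
  zero_mem' := ⟨zero_mem _, fun u => by
    have := γ.covD_smul 0 (zero_mem (horForm I J pr p)) u
    simpa using this⟩
  add_mem' := fun {η θ} hη hθ => ⟨add_mem hη.1 hθ.1, fun u => by
    rw [γ.covD_add (casForm_le_horForm P p hη.1) (casForm_le_horForm P p hθ.1), hη.2, hθ.2,
      add_zero]⟩
  smul_mem' := fun c η hη => ⟨Submodule.smul_mem _ c hη.1, fun u => by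
    rw [γ.covD_smul c (casForm_le_horForm P p hη.1), hη.2, smul_zero]⟩

/-- The coboundaries `B^p`: the elements of `C^p` that are the covariant exterior derivative of an
element of `C^{p-1}` (for `p = 0`, only zero). -/
def coboundaries : (p : ℕ) → Submodule ℝ (RawForm J pr p)
  | 0 => ⊥
  | p + 1 =>
    { carrier := {θ | θ ∈ casForm J P pr (p + 1) ∧
        ∃ η ∈ casForm J P pr p, ∀ u, evalForm θ u = γ.covD η u}
      zero_mem' := ⟨zero_mem _, 0, zero_mem _, fun u => by
        have := γ.covD_smul 0 (zero_mem (horForm I J pr p)) u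
        simp only [zero_smul] at this
        rw [this]
        rfl⟩
      add_mem' := by
        rintro θ θ' ⟨h, η, hη, e⟩ ⟨h', η', hη', e'⟩
        refine ⟨add_mem h h', η + η', add_mem hη hη', fun u => ?_⟩
        rw [γ.covD_add (casForm_le_horForm P p hη) (casForm_le_horForm P p hη'), evalForm_add,
          e, e']
      smul_mem' := by
        rintro c θ ⟨h, η, hη, e⟩
        refine ⟨Submodule.smul_mem _ c h, c • η, Submodule.smul_mem _ c hη, fun u => ?_⟩
        rw [γ.covD_smul c (casForm_le_horForm P p hη), evalForm_smul, e] }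

/-- The cohomology `H^p = Z^p / B^p` of the complex of `p`-forms on `B` with values in
Casimir functions of `P`. -/
abbrev cohomology (p : ℕ) : Type _ :=
  ↥(γ.cocycles P p) ⧸ (γ.coboundaries P p).submoduleOf (γ.cocycles P p)

variable [CompleteSpace E]

/-- The space `A` of the vertical Poisson vector fields `Y` of `P` such that `[hor(u), Y]` is
Hamiltonian with respect to `P` for every vector field `u` on `B`. -/
def algA : Submodule ℝ (SmoothVF I N) where
  carrier := {Y | Y ∈ P.poiss ∧ (∀ e, mfderiv I J pr e (Y e) = 0) ∧
    ∀ u : SmoothVF J B, ∃ K : N → ℝ, ContMDiff I 𝓘(ℝ, ℝ) ∞ K ∧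
      ∀ e, VectorField.mlieBracket I (γ.hor u) (fun x => Y x) e = P.hamVF K e}
  zero_mem' := ⟨zero_mem _, fun e => by simp, fun u => ⟨0, contMDiff_const, fun e => by
    have h : (fun x => (0 : SmoothVF I N) x) = (0 : ∀ x : N, TangentSpace I x) := rfl
    rw [h, VectorField.mlieBracket_zero_right]
    simp [BivectorField.hamVF, mvfderiv_zero]⟩⟩
  add_mem' := by
    rintro Y W ⟨h1, h2, h3⟩ ⟨h1', h2', h3'⟩
    refine ⟨add_mem h1 h1', fun e => by simp [h2, h2'], fun u => ?_⟩
    obtain ⟨K, hK, h⟩ := h3 u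
    obtain ⟨K', hK', h'⟩ := h3' u
    refine ⟨K + K', hK.add hK', fun e => ?_⟩
    have hs : (fun x => (Y + W) x) = (fun x => Y x) + (fun x => W x) := rfl
    rw [hs, VectorField.mlieBracket_add_right (Y.mdifferentiable e) (W.mdifferentiable e),
      h, h']
    simp [BivectorField.hamVF, mvfderiv_add' hK hK']
  smul_mem' := by
    rintro c Y ⟨h1, h2, h3⟩
    refine ⟨Submodule.smul_mem _ c h1, fun e => by simp [h2], fun u => ?_⟩
    obtain ⟨K, hK, h⟩ := h3 u
    refine ⟨c • K, contMDiff_const_smul' c hK, fun e => ?_⟩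
    have hs : (fun x => (c • Y) x) = c • (fun x => Y x) := rfl
    rw [hs, VectorField.mlieBracket_const_smul_right (Y.mdifferentiable e), h]
    simp [BivectorField.hamVF, mvfderiv_const_smul' c hK]

/-- `β` is a potential of `Y`: `[hor(u), Y] = -P♯ d(β(u))` for every vector field `u` on `B`. -/
def IsPotential (Y : SmoothVF I N) (β : RawForm J pr 1) : Prop :=
  β ∈ horForm I J pr 1 ∧ ∀ (u : SmoothVF J B) (e : N),
    VectorField.mlieBracket I (γ.hor u) (fun x => Y x) e = - P.hamVF (evalForm β ![u]) e

/-- `τ` is the 2-form `∂β + L_Y σ`. -/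
def IsTau (σ : RawForm J pr 2) (Y : SmoothVF I N) (β : RawForm J pr 1)
    (τ : RawForm J pr 2) : Prop :=
  ∀ u : Fin 2 → SmoothVF J B,
    evalForm τ u = γ.covD β u + lieD (fun x => Y x) (evalForm σ u)

/-- `ρ : A → H²` is the map `Y ↦ [∂β_Y + L_Y σ]`, where `β_Y` is any potential of `Y`. Potentials
exist, and the class depends on `Y` only. -/
def IsRho (σ : RawForm J pr 2) (ρ : γ.algA P →ₗ[ℝ] γ.cohomology P 2) : Prop :=
  ∀ Y : γ.algA P, (∃ β, γ.IsPotential P Y β) ∧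
    ∀ β, γ.IsPotential P Y β → ∃ τ : γ.cocycles P 2, γ.IsTau σ Y β τ ∧
      ρ Y = Submodule.Quotient.mk τ

end EhresmannConnection

/-- The annihilator `V⁰` of the vertical subbundle `V = ker d(pr)`, at a point. -/
def vertAnn (I : ModelWithCorners ℝ E H) (J : ModelWithCorners ℝ F H') (pr : N → B) (e : N) :
    Submodule ℝ (TangentSpace I e →L[ℝ] ℝ) where
  carrier := {α | ∀ w, mfderiv I J pr e w = 0 → α w = 0}
  zero_mem' := fun w _ => rfl
  add_mem' := fun {α β} hα hβ w hw => by simp [hα w hw, hβ w hw]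
  smul_mem' := fun c α hα w hw => by simp [hα w hw]

/-- `Ψ` is a coupling bivector field on `pr : N → B`, that is `TN = ℍ ⊕ V` with `V = ker d(pr)` and
`ℍ = Ψ♯(V⁰)`, and `γ`, `σ`, `ΨV` are its geometric data: `γ` is the connection
with horizontal subbundle `ℍ`, `Ψ = ΨH + ΨV` with `ΨH` horizontal and `ΨV` vertical, and
`σ` is the coupling form, `(pr^*σ)^♭ = -(ΨH♯ restricted to V⁰)⁻¹` on `ℍ`. -/
structure IsCoupling {pr : N → B} (Ψ ΨH ΨV : BivectorField I N) (γ : EhresmannConnection I J pr)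
    (σ : RawForm J pr 2) : Prop where
  decomp : ∀ e, Ψ.sharp e = ΨH.sharp e + ΨV.sharp e
  horizontal : ∀ e, LinearMap.range (ΨH.sharp e) = LinearMap.range (γ.lift e)
  vertical : ∀ e α, mfderiv I J pr e (ΨV.sharp e α) = 0
  coupling : ∀ e, (vertAnn I J pr e).map (Ψ.sharp e) = LinearMap.range (γ.lift e)
  sigma_mem : σ ∈ horForm I J pr 2
  sigma_eq : ∀ (e : N) (v : TangentSpace J (pr e)) (α : TangentSpace I e →L[ℝ] ℝ),
    (∀ w, α w = σ e ![v, mfderiv I J pr e w]) → ΨH.sharp e α = - γ.lift e v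

end Fibered

end SemilocalPoisson

end

noncomputable section

set_option linter.unusedSectionVars false

namespace SemilocalPoisson

/-! ### Smooth functions and vector fields as algebraic objects -/

section Calculus

variable {E : Type*} [NormedAddCommGroup E] [NormedSpace ℝ E]
  {N : Type*} [TopologicalSpace N] [ChartedSpace E N]

/-! Along a leaf the range of `Ψ♯` is `TS`. Hence, for the projection `π` of any tubular
neighborhood, the map `T*S → TS`, `a ↦ dπ(Ψ♯(π^*a))`, is invertible at the points of `S`
(`bijective_baseMap_ι`), and after shrinking it is invertible on the whole neighborhood
(`isOpen_bijective_baseMap`). A Poisson manifold with such a projection is a `TransverseFibration`.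
The inverse of this map yields the horizontal lift and, up to sign, the coupling form; what is left
of `Ψ` after removing its horizontal part is `ΨV`.

Every identity is checked at one point `e`. A differential at `e` is the sum of one pulled back from
`S` and one that kills the horizontal space (`eq_zero_of_pull_of_horFlat`). A lift `hor u` can be
replaced at `e` by the Hamiltonian field of a pulled back function (`Represents`). The errors are
products of two factors vanishing at `e`, so they do not matter to first order
(`dAt_pairing_eq_zero`). In this way the Jacobi identity of `Ψ` splits by type into four statements:
`ΨV` is Poisson, lifts are Poisson fields of `ΨV`, the curvature is Hamiltonian with Hamiltonians
given by `σ`, and `∂σ = 0`.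

A vector field is uniquely `Z = Y - Ψ♯(π^*θ)` with `Y` vertical. The equation `L_Z Ψ = 0` splits in
the same manner: `Y` is Poisson for `ΨV`, `θ` is a potential of `Y`, and `∂θ + L_Y σ = 0`
(`SmoothCov.sub_field_mem_poiss_iff`). The field of a Hamiltonian `K` corresponds to `Y = ΨV♯ dK`,
`θ = -∂K`. Changing a potential by a Casimir-valued form changes `∂θ + L_Y σ` by a coboundary, so
the last equation can be solved exactly when `ρ(Y) = 0`. Thus `Z ↦ Y` induces an exact sequence `0 →
H¹_∂̄ → H¹_Ψ → ker ρ / Ham → 0`, which splits because these are vector spaces (`nonempty_H1_equiv`).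

The tubular neighborhood is built without a metric connection. Displacements from `s ∈ S` in slice
charts are averaged by a partition of unity, with values in `T_s S` times the normal space; the
fibre over `s` consists of the nearby `x` whose averaged displacement has no tangential part. The
implicit function theorem gives local tubes, and local uniqueness of the foot point lets them be
glued. -/

/-- Smooth real functions on a manifold without boundary. -/
abbrev SmoothFn (E : Type*) [NormedAddCommGroup E] [NormedSpace ℝ E]
    (N : Type*) [TopologicalSpace N] [ChartedSpace E N] : Type _ :=
  C^∞⟮𝓘(ℝ, E), N; 𝓘(ℝ, ℝ), ℝ⟯

lemma SmoothFn.mdifferentiableAt (F : SmoothFn E N) (x : N) :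
    MDifferentiableAt 𝓘(ℝ, E) 𝓘(ℝ, ℝ) F x :=
  (F.contMDiff x).mdifferentiableAt (by simp)

/-- The differential at `x` of a smooth function. -/
def dAt (x : N) : SmoothFn E N →ₗ[ℝ] (TangentSpace 𝓘(ℝ, E) x →L[ℝ] ℝ) where
  toFun F := mvfderiv 𝓘(ℝ, E) F x
  map_add' F G := mvfderiv_add' F.contMDiff G.contMDiff x
  map_smul' c F := mvfderiv_const_smul' c F.contMDiff x

lemma dAt_mul (x : N) (F G : SmoothFn E N) : dAt x (F * G) = F x • dAt x G + G x • dAt x F := by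
  have := mvfderiv_mul (F.mdifferentiableAt x) (G.mdifferentiableAt x)
  exact this

lemma dAt_congr {x : N} {F G : SmoothFn E N} (h : ∀ᶠ y in 𝓝 x, F y = G y) :
    dAt x F = dAt x G := by
  have h' : (F : N → ℝ) =ᶠ[𝓝 x] G := h
  exact h'.mfderiv_eq

variable [IsManifold 𝓘(ℝ, E) ∞ N]

/-- The derivation of smooth functions given by a vector field. -/
def derivVF (Z : SmoothVF 𝓘(ℝ, E) N) : SmoothFn E N →ₗ[ℝ] SmoothFn E N where
  toFun F := ⟨lieD (fun y => Z y) F, contMDiff_lieD Z.contMDiff F.contMDiff⟩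
  map_add' F G := by
    ext x
    exact congrFun (lieD_add_right (fun y => Z y) F.contMDiff G.contMDiff) x
  map_smul' c F := by
    ext x
    change dAt x (c • F) (Z x) = c * dAt x F (Z x)
    simp

lemma derivVF_apply (Z : SmoothVF 𝓘(ℝ, E) N) (F : SmoothFn E N) (x : N) :
    derivVF Z F x = dAt x F (Z x) := rfl

lemma derivVF_mul (Z : SmoothVF 𝓘(ℝ, E) N) (F G : SmoothFn E N) :
    derivVF Z (F * G) = F * derivVF Z G + G * derivVF Z F := by
  ext x
  simp [derivVF_apply, dAt_mul]

lemma derivVF_add (Z W : SmoothVF 𝓘(ℝ, E) N) (F : SmoothFn E N) :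
    derivVF (Z + W) F = derivVF Z F + derivVF W F := by
  ext x
  simp [derivVF_apply]

lemma derivVF_sub (Z W : SmoothVF 𝓘(ℝ, E) N) (F : SmoothFn E N) :
    derivVF (Z - W) F = derivVF Z F - derivVF W F := by
  ext x
  simp [derivVF_apply]

lemma derivVF_neg (Z : SmoothVF 𝓘(ℝ, E) N) (F : SmoothFn E N) :
    derivVF (-Z) F = -derivVF Z F := by
  ext x
  simp [derivVF_apply]

lemma derivVF_smul (c : ℝ) (Z : SmoothVF 𝓘(ℝ, E) N) (F : SmoothFn E N) :
    derivVF (c • Z) F = c • derivVF Z F := by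
  ext x
  simp [derivVF_apply]

namespace BivectorField

variable (P : BivectorField 𝓘(ℝ, E) N)

/-- The Hamiltonian vector field of a smooth function. -/
def hamField (F : SmoothFn E N) : SmoothVF 𝓘(ℝ, E) N := ⟨P.hamVF F, P.smooth F F.contMDiff⟩

lemma hamField_apply (F : SmoothFn E N) (x : N) : P.hamField F x = P.sharp x (dAt x F) := rfl

/-- The bracket of smooth functions as a bilinear map. -/
def br : SmoothFn E N →ₗ[ℝ] SmoothFn E N →ₗ[ℝ] SmoothFn E N where
  toFun F := derivVF (P.hamField F)
  map_add' F G := by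
    ext K x
    simp [derivVF_apply, hamField_apply]
  map_smul' c F := by
    ext K x
    simp [derivVF_apply, hamField_apply]

lemma br_apply (F G : SmoothFn E N) (x : N) : P.br F G x = dAt x G (P.sharp x (dAt x F)) := rfl

lemma br_eq (F G : SmoothFn E N) : P.br F G = derivVF (P.hamField F) G := rfl

lemma br_skew (F G : SmoothFn E N) : P.br F G = -P.br G F := by
  ext x
  simpa [br_apply] using P.skew x (dAt x F) (dAt x G)

lemma br_skew_apply (F G : SmoothFn E N) (x : N) : P.br F G x = -P.br G F x := by
  rw [P.br_skew]; rfl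

lemma isPoisson_iff : P.IsPoisson ↔
    ∀ F G K : SmoothFn E N, P.br F (P.br G K) + P.br G (P.br K F) + P.br K (P.br F G) = 0 := by
  constructor
  · intro h F G K
    ext x
    exact h F G K F.contMDiff G.contMDiff K.contMDiff x
  · intro h F G K hF hG hK x
    exact DFunLike.congr_fun (h ⟨F, hF⟩ ⟨G, hG⟩ ⟨K, hK⟩) x

/-- The defect `Z{F, G} - {ZF, G} - {F, ZG}`, that is `(L_Z P)(dF, dG)`. -/
def defect (Z : SmoothVF 𝓘(ℝ, E) N) (F G : SmoothFn E N) : SmoothFn E N :=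
  derivVF Z (P.br F G) - P.br (derivVF Z F) G - P.br F (derivVF Z G)

lemma mem_poiss_iff (Z : SmoothVF 𝓘(ℝ, E) N) :
    Z ∈ P.poiss ↔ ∀ F G : SmoothFn E N, P.defect Z F G = 0 := by
  constructor
  · intro h F G
    ext x
    have := h F G F.contMDiff G.contMDiff x
    change lieD (fun y => Z y) (P.bracket F G) x -
      P.bracket (lieD (fun y => Z y) F) G x - P.bracket F (lieD (fun y => Z y) G) x = 0
    rw [this]
    ring
  · intro h F G hF hG x
    have : lieD (fun y => Z y) (P.bracket F G) x -
      P.bracket (lieD (fun y => Z y) F) G x - P.bracket F (lieD (fun y => Z y) G) x = 0 :=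
      DFunLike.congr_fun (h ⟨F, hF⟩ ⟨G, hG⟩) x
    linarith

lemma mem_ham_iff (Z : SmoothVF 𝓘(ℝ, E) N) : Z ∈ P.ham ↔ ∃ F : SmoothFn E N, Z = P.hamField F := by
  constructor
  · rintro ⟨F, hF, h⟩
    refine ⟨⟨F, hF⟩, ?_⟩
    ext x
    exact h x
  · rintro ⟨F, rfl⟩
    exact ⟨F, F.contMDiff, fun _ => rfl⟩

lemma defect_add_left (Z : SmoothVF 𝓘(ℝ, E) N) (F F' G : SmoothFn E N) :
    P.defect Z (F + F') G = P.defect Z F G + P.defect Z F' G := by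
  simp only [defect, map_add, LinearMap.add_apply]; abel

lemma defect_skew (Z : SmoothVF 𝓘(ℝ, E) N) (F G : SmoothFn E N) :
    P.defect Z F G = -P.defect Z G F := by
  simp only [defect]
  rw [P.br_skew F G, P.br_skew (derivVF Z F), P.br_skew F]
  simp only [map_neg]; abel

lemma defect_add_right (Z : SmoothVF 𝓘(ℝ, E) N) (F G G' : SmoothFn E N) :
    P.defect Z F (G + G') = P.defect Z F G + P.defect Z F G' := by
  simp only [defect, map_add]; abel

lemma defect_sub_vf (Z W : SmoothVF 𝓘(ℝ, E) N) (F G : SmoothFn E N) :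
    P.defect (Z - W) F G = P.defect Z F G - P.defect W F G := by
  simp only [defect, derivVF_sub, map_sub, LinearMap.sub_apply]; abel

lemma hamField_mem_poiss (hP : P.IsPoisson) (F : SmoothFn E N) : P.hamField F ∈ P.poiss := by
  rw [mem_poiss_iff]
  intro G K
  have h := P.isPoisson_iff.1 hP F G K
  simp only [defect, ← br_eq]
  rw [P.br_skew (P.br F G), P.br_skew F K, map_neg] at *
  rw [← h]
  abel_nf

lemma br_mul_right (F G K : SmoothFn E N) : P.br F (G * K) = G * P.br F K + K * P.br F G :=
  derivVF_mul _ _ _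

end BivectorField

end Calculus

end SemilocalPoisson

namespace SemilocalPoisson

/-! ### The Lie bracket of vector fields as a commutator of derivations. -/

section LieBracket

variable {E : Type*} [NormedAddCommGroup E] [NormedSpace ℝ E] [CompleteSpace E]
  {N : Type*} [TopologicalSpace N] [ChartedSpace E N] [IsManifold 𝓘(ℝ, E) ∞ N]

lemma lieD_chart (Z : ∀ x : N, TangentSpace 𝓘(ℝ, E) x) (F : SmoothFn E N) (x : N) {y : E}
    (hy : y ∈ (extChartAt 𝓘(ℝ, E) x).target) (w : E)
    (hw : mfderivWithin 𝓘(ℝ, E) 𝓘(ℝ, E) (extChartAt 𝓘(ℝ, E) x).symm (Set.range 𝓘(ℝ, E)) y w =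
      Z ((extChartAt 𝓘(ℝ, E) x).symm y)) :
    lieD Z F ((extChartAt 𝓘(ℝ, E) x).symm y) =
      fderiv ℝ (F ∘ (extChartAt 𝓘(ℝ, E) x).symm) y w := by
  have h1 : MDifferentiableAt 𝓘(ℝ, E) 𝓘(ℝ, E) (extChartAt 𝓘(ℝ, E) x).symm y := by
    have := mdifferentiableWithinAt_extChartAt_symm (I := 𝓘(ℝ, E)) hy
    simpa [mdifferentiableWithinAt_univ] using this
  have h2 := mfderiv_comp y (F.mdifferentiableAt _) h1
  rw [lieD, ← hw, ← mfderiv_eq_fderiv, h2]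
  simp only [modelWithCornersSelf_coe, Set.range_id, mfderivWithin_univ]
  rfl

/-- In the chart at `x`, each iterated derivative is a second derivative of `F` plus the first
derivative of `F` along the derivative of a field. The symmetric second derivatives cancel in the
difference, and the rest is the coordinate formula of the bracket. -/
lemma lieD_mlieBracket (X Y : SmoothVF 𝓘(ℝ, E) N) (F : SmoothFn E N) (x : N) :
    lieD (VectorField.mlieBracket 𝓘(ℝ, E) (fun y => X y) (fun y => Y y)) F x =
      lieD (fun y => X y) (lieD (fun y => Y y) F) x
        - lieD (fun y => Y y) (lieD (fun y => X y) F) x := by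
  set φ := extChartAt 𝓘(ℝ, E) x with hφ
  set f : E → ℝ := F ∘ φ.symm with hf
  have hT : φ.target ∈ 𝓝 (φ x) := extChartAt_target_mem_nhds x
  have hx : φ.symm (φ x) = x := extChartAt_to_inv x
  let pb : SmoothVF 𝓘(ℝ, E) N → E → E := fun Z =>
    VectorField.mpullbackWithin 𝓘(ℝ, E) 𝓘(ℝ, E) φ.symm (fun y => Z y) (Set.range 𝓘(ℝ, E))
  have hpb (Z : SmoothVF 𝓘(ℝ, E) N) {y : E} (hy : y ∈ φ.target) :
      mfderivWithin 𝓘(ℝ, E) 𝓘(ℝ, E) φ.symm (Set.range 𝓘(ℝ, E)) y (pb Z y) = Z (φ.symm y) :=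
    (isInvertible_mfderivWithin_extChartAt_symm hy).self_apply_inverse _
  have hd (Z : SmoothVF 𝓘(ℝ, E) N) (G : SmoothFn E N) {y : E} (hy : y ∈ φ.target) :
      derivVF Z G (φ.symm y) = fderiv ℝ (G ∘ φ.symm) y (pb Z y) :=
    lieD_chart (fun y => Z y) G x hy _ (hpb Z hy)
  have hfs : ContDiffAt ℝ ∞ f (φ x) := by
    have h1 : ContMDiffAt 𝓘(ℝ, E) 𝓘(ℝ, E) ∞ φ.symm (φ x) :=
      (contMDiffOn_extChartAt_symm x).contMDiffAt hT
    exact (F.contMDiff.contMDiffAt.comp _ h1).contDiffAt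
  have hpbd (Z : SmoothVF 𝓘(ℝ, E) N) : DifferentiableAt ℝ (pb Z) (φ x) := by
    have := MDifferentiableWithinAt.differentiableWithinAt_mpullbackWithin_vectorField
      (s := Set.univ) (Z.contMDiff.mdifferentiable (by simp) x).mdifferentiableWithinAt
    simp only [Set.preimage_univ, Set.univ_inter, modelWithCornersSelf_coe, Set.range_id] at this
    simp only [pb, modelWithCornersSelf_coe, Set.range_id]
    exact differentiableWithinAt_univ.1 this
  have hsnd (Z W : SmoothVF 𝓘(ℝ, E) N) : derivVF Z (derivVF W F) x =
      fderiv ℝ (fderiv ℝ f) (φ x) (pb Z (φ x)) (pb W (φ x)) +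
        fderiv ℝ f (φ x) (fderiv ℝ (pb W) (φ x) (pb Z (φ x))) := by
    have h1 := hd Z (derivVF W F) (mem_extChartAt_target x)
    rw [hx] at h1
    rw [h1]
    have h2 : (derivVF W F ∘ φ.symm) =ᶠ[𝓝 (φ x)] fun y => fderiv ℝ f y (pb W y) := by
      filter_upwards [hT] with y hy using hd W F hy
    rw [h2.fderiv_eq, fderiv_clm_apply _ (hpbd W)]
    · exact add_comm _ _
    · exact (hfs.fderiv_right (m := 1) (by norm_cast)).differentiableAt (by simp)
  have hsym := hfs.isSymmSndFDerivAt (by simpa using ENat.LEInfty.out)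
  have hb : lieD (VectorField.mlieBracket 𝓘(ℝ, E) (fun y => X y) (fun y => Y y)) F x =
      fderiv ℝ f (φ x) (VectorField.lieBracket ℝ (pb X) (pb Y) (φ x)) := by
    have := lieD_chart (VectorField.mlieBracket 𝓘(ℝ, E) (fun y => X y) (fun y => Y y)) F x
      (mem_extChartAt_target x) (VectorField.lieBracket ℝ (pb X) (pb Y) (φ x)) ?_
    · rwa [hx] at this
    · rw [← VectorField.mlieBracketWithin_univ, hx, VectorField.mlieBracketWithin_apply]
      -- The bracket is defined through the inverse of the differential of the chart, which is the
      -- differential of the inverse chart.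
      have h3 := mfderivWithin_extChartAt_symm_comp_mfderiv_extChartAt' (I := 𝓘(ℝ, E))
        (mem_extChartAt_source (I := 𝓘(ℝ, E)) x)
      have h4 := mfderiv_extChartAt_comp_mfderivWithin_extChartAt_symm' (I := 𝓘(ℝ, E))
        (mem_extChartAt_source (I := 𝓘(ℝ, E)) x)
      have h5 : (mfderiv 𝓘(ℝ, E) 𝓘(ℝ, E) φ x).inverse =
        mfderivWithin 𝓘(ℝ, E) 𝓘(ℝ, E) φ.symm (Set.range 𝓘(ℝ, E)) (φ x) :=
        ContinuousLinearMap.inverse_eq h4 h3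
      rw [← hφ, h5]
      simp only [Set.preimage_univ, modelWithCornersSelf_coe, Set.range_id, Set.inter_univ]
      rw [← VectorField.lieBracketWithin_univ]
      simp only [pb, modelWithCornersSelf_coe, Set.range_id]
  rw [hb]
  have hX := hsnd X Y
  have hY := hsnd Y X
  change _ = derivVF X (derivVF Y F) x - derivVF Y (derivVF X F) x
  rw [hX, hY, VectorField.lieBracket, map_sub, hsym.eq]
  ring

/-- The Lie bracket of smooth vector fields. -/
def lieVF (X Y : SmoothVF 𝓘(ℝ, E) N) : SmoothVF 𝓘(ℝ, E) N :=
  ⟨VectorField.mlieBracket 𝓘(ℝ, E) (fun y => X y) (fun y => Y y), fun x => by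
    have : IsManifold 𝓘(ℝ, E) (((⊤ : ℕ∞) : ℕ∞ω) + 1) N := by simpa
    have : IsManifold 𝓘(ℝ, E) (minSmoothness ℝ 2) N := by
      rw [minSmoothness_of_isRCLikeNormedField]; infer_instance
    exact ContMDiffAt.mlieBracket_vectorField (n := ⊤) (m := ⊤) (X.contMDiff x) (Y.contMDiff x)
      (by simp)⟩

lemma derivVF_lieVF (X Y : SmoothVF 𝓘(ℝ, E) N) (F : SmoothFn E N) :
    derivVF (lieVF X Y) F = derivVF X (derivVF Y F) - derivVF Y (derivVF X F) := by
  ext x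
  exact lieD_mlieBracket X Y F x

end LieBracket

/-! ### Global functions and vector fields that form dual frames near a point. -/

section Frame

variable {E : Type*} [NormedAddCommGroup E] [NormedSpace ℝ E] [FiniteDimensional ℝ E]
  {N : Type*} [TopologicalSpace N] [ChartedSpace E N] [IsManifold 𝓘(ℝ, E) ∞ N] [T2Space N]

/-- Near any point there are global smooth functions and global vector fields that are dual
frames. -/
lemma exists_dual_frames (x₀ : N) : ∃ (y : Fin (Module.finrank ℝ E) → SmoothFn E N)
    (u : Fin (Module.finrank ℝ E) → SmoothVF 𝓘(ℝ, E) N), ∀ᶠ x in 𝓝 x₀,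
      (∀ i j, dAt x (y i) (u j x) = if i = j then 1 else 0) ∧
      ∀ v : TangentSpace 𝓘(ℝ, E) x, v = ∑ i, dAt x (y i) v • u i x := by
  classical
  let b := Module.finBasis ℝ E
  let φ := extChartAt 𝓘(ℝ, E) x₀
  let e := trivializationAt E (TangentSpace 𝓘(ℝ, E) : N → Type _) x₀
  have : Nonempty (SmoothBumpFunction 𝓘(ℝ, E) x₀) := inferInstance
  obtain ⟨ρ⟩ := this
  let L (i) : E →L[ℝ] ℝ := LinearMap.toContinuousLinearMap (b.coord i)
  -- A bump function makes the coordinates and the coordinate frame global. They are compared only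
  -- where the bump function is one in a whole neighborhood, so that its differential does not
  -- contribute.
  have hy (i) : ContMDiff 𝓘(ℝ, E) 𝓘(ℝ, ℝ) ∞ (fun x => ρ x • L i (φ x)) := by
    refine ρ.contMDiff_smul ?_
    exact (L i).contDiff.contMDiff.comp_contMDiffOn (contMDiffOn_extChartAt (x := x₀))
  have hu (j) : ContMDiff 𝓘(ℝ, E) 𝓘(ℝ, E).tangent ∞
      (fun x => (⟨x, ρ x • e.localFrame b j x⟩ : TangentBundle 𝓘(ℝ, E) N)) := by
    refine ContMDiffOn.smul_section_of_tsupport (u := e.baseSet) ρ.contMDiff.contMDiffOn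
      e.open_baseSet ?_ (e.contMDiffOn_localFrame_baseSet ∞ b j)
    exact ρ.tsupport_subset_chartAt_source
  refine ⟨fun i => ⟨_, hy i⟩, fun j => ⟨_, hu j⟩, ?_⟩
  have hsrc : ∀ᶠ x in 𝓝 x₀, x ∈ (chartAt E x₀).source := chart_source_mem_nhds E x₀
  filter_upwards [hsrc, ρ.eventuallyEq_one, ρ.eventuallyEq_one.eventually_nhds] with x hx h1 h1'
  have hd (i) : dAt x (⟨_, hy i⟩ : SmoothFn E N) =
      (L i).comp (mfderiv 𝓘(ℝ, E) 𝓘(ℝ, E) φ x) := by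
    have h2 : (fun x => ρ x • L i (φ x)) =ᶠ[𝓝 x] (L i) ∘ φ := by
      filter_upwards [h1'] with z hz
      simp [hz]
    have h3 : mfderiv 𝓘(ℝ, E) 𝓘(ℝ, ℝ) (fun x => ρ x • L i (φ x)) x = _ := h2.mfderiv_eq
    have h4 : mfderiv 𝓘(ℝ, E) 𝓘(ℝ, ℝ) (L i ∘ φ) x = (L i).comp (mfderiv 𝓘(ℝ, E) 𝓘(ℝ, E) φ x) := by
      rw [mfderiv_comp x ((L i).mdifferentiableAt) (mdifferentiableAt_extChartAt hx),
        ContinuousLinearMap.mfderiv_eq]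
      rfl
    exact h3.trans h4
  have hfr (j) : ρ x • e.localFrame b j x = e.symmL ℝ x (b j) := by
    have hb : x ∈ e.baseSet := hx
    rw [h1, e.localFrame_apply_of_mem_baseSet b hb]
    simp [Bundle.Trivialization.basisAt]
    exact (e.symmL_apply hb _).symm
  have hm : mfderiv 𝓘(ℝ, E) 𝓘(ℝ, E) φ x = e.continuousLinearMapAt ℝ x :=
    (TangentBundle.continuousLinearMapAt_trivializationAt hx).symm
  constructor
  · intro i j
    rw [hd]
    change L i (mfderiv 𝓘(ℝ, E) 𝓘(ℝ, E) φ x (ρ x • e.localFrame b j x)) = _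
    rw [hfr, hm]
    refine (congrArg (L i) (e.continuousLinearMapAt_symmL hx (b j))).trans ?_
    simp [L, Finsupp.single_apply, eq_comm]
  · intro v
    have h5 (i) : dAt x (⟨_, hy i⟩ : SmoothFn E N) v = b.coord i (e.continuousLinearMapAt ℝ x v) := by
      rw [hd, ← hm]; rfl
    simp only [h5]
    change v = ∑ i, b.coord i (e.continuousLinearMapAt ℝ x v) • (ρ x • e.localFrame b i x)
    simp only [hfr]
    simp only [← map_smul, ← map_sum]
    rw [show ∑ i, (b.coord i) (e.continuousLinearMapAt ℝ x v) • b i =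
      e.continuousLinearMapAt ℝ x v from b.sum_repr _, e.symmL_continuousLinearMapAt hx]

end Frame

end SemilocalPoisson

namespace SemilocalPoisson

/-! ### Alternating forms in low degree -/

section Alternating

variable {V : Type*} [AddCommGroup V] [Module ℝ V]

/-- The alternating form of a bilinear map that vanishes on the diagonal. -/
def alternatingTwo (B : V →ₗ[ℝ] V →ₗ[ℝ] ℝ) (h : ∀ v, B v v = 0) : V [⋀^Fin 2]→ₗ[ℝ] ℝ where
  toFun m := B (m 0) (m 1)
  map_update_add' m i x y := by
    fin_cases i <;> simp
  map_update_smul' m i c x := by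
    fin_cases i <;> simp
  map_eq_zero_of_eq' v i j hv hij := by
    fin_cases i <;> fin_cases j <;> simp_all

lemma alternatingOne_add (θ : V [⋀^Fin 1]→ₗ[ℝ] ℝ) (v w : V) :
    θ ![v + w] = θ ![v] + θ ![w] := by
  have := θ.map_vecCons_add (m := ![]) v w
  exact this

lemma alternatingOne_smul (θ : V [⋀^Fin 1]→ₗ[ℝ] ℝ) (c : ℝ) (v : V) :
    θ ![c • v] = c * θ ![v] := by
  have := θ.map_vecCons_smul (m := ![]) c v
  exact this

/-- The linear functional underlying an alternating 1-form. -/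
def functionalOf (θ : V [⋀^Fin 1]→ₗ[ℝ] ℝ) : V →ₗ[ℝ] ℝ where
  toFun v := θ ![v]
  map_add' := alternatingOne_add θ
  map_smul' := alternatingOne_smul θ

/-- The alternating 1-form of a linear functional. -/
def alternatingOne (a : V →ₗ[ℝ] ℝ) : V [⋀^Fin 1]→ₗ[ℝ] ℝ :=
  AlternatingMap.ofSubsingleton ℝ V ℝ (0 : Fin 1) a

end Alternating

/-! ### Bivector fields that are nondegenerate along a projection -/

section Transverse

variable {E : Type*} [NormedAddCommGroup E] [NormedSpace ℝ E]
  {N : Type*} [TopologicalSpace N] [ChartedSpace E N] [IsManifold 𝓘(ℝ, E) ∞ N]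
  {F : Type*} [NormedAddCommGroup F] [NormedSpace ℝ F]
  {S : Type*} [TopologicalSpace S] [ChartedSpace F S] [IsManifold 𝓘(ℝ, F) ∞ S]

/-- The map `T*S → TS` at `pr x` induced by a bivector at `x`. -/
def baseMap (Ψ : BivectorField 𝓘(ℝ, E) N) (pr : N → S) (x : N) :
    (TangentSpace 𝓘(ℝ, F) (pr x) →L[ℝ] ℝ) →ₗ[ℝ] TangentSpace 𝓘(ℝ, F) (pr x) where
  toFun a := mfderiv 𝓘(ℝ, E) 𝓘(ℝ, F) pr x (Ψ.sharp x (a ∘L mfderiv 𝓘(ℝ, E) 𝓘(ℝ, F) pr x))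
  map_add' a b := by
    rw [ContinuousLinearMap.add_comp, map_add, map_add]
  map_smul' c a := by
    rw [ContinuousLinearMap.smul_comp, map_smul, map_smul]; rfl

/-- A smooth map `pr : N → S` whose fibres are transverse to the Poisson tensor `Ψ`, in the sense
that the induced maps `T*S → TS` are isomorphisms. -/
structure TransverseFibration (E : Type*) [NormedAddCommGroup E] [NormedSpace ℝ E]
    (N : Type*) [TopologicalSpace N] [ChartedSpace E N] [IsManifold 𝓘(ℝ, E) ∞ N]
    (F : Type*) [NormedAddCommGroup F] [NormedSpace ℝ F]
    (S : Type*) [TopologicalSpace S] [ChartedSpace F S] [IsManifold 𝓘(ℝ, F) ∞ S] where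
  /-- the Poisson tensor -/
  Ψ : BivectorField 𝓘(ℝ, E) N
  poisson : Ψ.IsPoisson
  /-- the projection -/
  pr : N → S
  contMDiff_pr : ContMDiff 𝓘(ℝ, E) 𝓘(ℝ, F) ∞ pr
  bijective : ∀ x, Function.Bijective (baseMap (F := F) Ψ pr x)

instance [FiniteDimensional ℝ E] (x : N) : FiniteDimensional ℝ (TangentSpace 𝓘(ℝ, E) x) :=
  inferInstanceAs (FiniteDimensional ℝ E)

instance (x : N) : T2Space (TangentSpace 𝓘(ℝ, E) x) :=
  inferInstanceAs (T2Space E)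

lemma eq_of_forall_covector [FiniteDimensional ℝ E] {x : N} {v w : TangentSpace 𝓘(ℝ, E) x}
    (h : ∀ a : TangentSpace 𝓘(ℝ, E) x →L[ℝ] ℝ, a v = a w) : v = w := by
  rw [← sub_eq_zero, ← Module.forall_dual_apply_eq_zero_iff ℝ]
  intro a
  rw [map_sub, sub_eq_zero]
  exact h (LinearMap.toContinuousLinearMap a)

namespace TransverseFibration

variable (C : TransverseFibration E N F S)

/-- The differential of the projection. -/
def dpr (x : N) : TangentSpace 𝓘(ℝ, E) x →L[ℝ] TangentSpace 𝓘(ℝ, F) (C.pr x) :=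
  mfderiv 𝓘(ℝ, E) 𝓘(ℝ, F) C.pr x

/-- The isomorphism `T*S → TS` at `pr x`. -/
def baseEquiv (x : N) :
    (TangentSpace 𝓘(ℝ, F) (C.pr x) →L[ℝ] ℝ) ≃ₗ[ℝ] TangentSpace 𝓘(ℝ, F) (C.pr x) :=
  LinearEquiv.ofBijective (baseMap C.Ψ C.pr x) (C.bijective x)

/-- Pull back covectors along the projection. -/
def pullCov (x : N) :
    (TangentSpace 𝓘(ℝ, F) (C.pr x) →L[ℝ] ℝ) →ₗ[ℝ] (TangentSpace 𝓘(ℝ, E) x →L[ℝ] ℝ) where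
  toFun a := a ∘L C.dpr x
  map_add' a b := by rw [ContinuousLinearMap.add_comp]
  map_smul' c a := by rw [ContinuousLinearMap.smul_comp]; rfl

lemma pullCov_apply (x : N) (a : TangentSpace 𝓘(ℝ, F) (C.pr x) →L[ℝ] ℝ)
    (w : TangentSpace 𝓘(ℝ, E) x) : C.pullCov x a w = a (C.dpr x w) := rfl

lemma baseEquiv_apply (x : N) (a : TangentSpace 𝓘(ℝ, F) (C.pr x) →L[ℝ] ℝ) :
    C.baseEquiv x a = C.dpr x (C.Ψ.sharp x (C.pullCov x a)) := rfl

/-- The horizontal lift of tangent vectors. -/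
def lift (x : N) : TangentSpace 𝓘(ℝ, F) (C.pr x) →ₗ[ℝ] TangentSpace 𝓘(ℝ, E) x :=
  C.Ψ.sharp x ∘ₗ C.pullCov x ∘ₗ (C.baseEquiv x).symm.toLinearMap

lemma lift_apply (x : N) (v : TangentSpace 𝓘(ℝ, F) (C.pr x)) :
    C.lift x v = C.Ψ.sharp x (C.pullCov x ((C.baseEquiv x).symm v)) := rfl

lemma dpr_lift (x : N) (v : TangentSpace 𝓘(ℝ, F) (C.pr x)) : C.dpr x (C.lift x v) = v :=
  (C.baseEquiv x).apply_symm_apply v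

lemma sharp_pullCov (x : N) (a : TangentSpace 𝓘(ℝ, F) (C.pr x) →L[ℝ] ℝ) :
    C.Ψ.sharp x (C.pullCov x a) = C.lift x (C.baseEquiv x a) := by
  rw [lift_apply, LinearEquiv.symm_apply_apply]

lemma baseEquiv_skew (x : N) (a b : TangentSpace 𝓘(ℝ, F) (C.pr x) →L[ℝ] ℝ) :
    b (C.baseEquiv x a) = -a (C.baseEquiv x b) :=
  C.Ψ.skew x (C.pullCov x a) (C.pullCov x b)

lemma baseEquiv_symm_skew (x : N) (v w : TangentSpace 𝓘(ℝ, F) (C.pr x)) :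
    (C.baseEquiv x).symm v w = -(C.baseEquiv x).symm w v := by
  have := C.baseEquiv_skew x ((C.baseEquiv x).symm w) ((C.baseEquiv x).symm v)
  simpa using this

/-- By skew-symmetry the base component of `Ψ♯ α` depends only on the restriction of `α` to the
horizontal space. This is why `sharpH` has the same projection as `Ψ♯`, and why the remainder is
vertical. -/
lemma dpr_sharp (x : N) (α : TangentSpace 𝓘(ℝ, E) x →L[ℝ] ℝ)
    (a : TangentSpace 𝓘(ℝ, F) (C.pr x) →L[ℝ] ℝ) :
    a (C.dpr x (C.Ψ.sharp x α)) = -α (C.lift x (C.baseEquiv x a)) := by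
  rw [← sharp_pullCov]
  exact C.Ψ.skew x α (C.pullCov x a)

variable [FiniteDimensional ℝ F]

/-- The restriction of a covector to the horizontal space. -/
def horCov (x : N) : (TangentSpace 𝓘(ℝ, E) x →L[ℝ] ℝ) →ₗ[ℝ]
    (TangentSpace 𝓘(ℝ, F) (C.pr x) →L[ℝ] ℝ) where
  toFun α := LinearMap.toContinuousLinearMap (α.toLinearMap ∘ₗ C.lift x)
  map_add' α β := by ext; rfl
  map_smul' c α := by ext; rfl

lemma horCov_apply (x : N) (α : TangentSpace 𝓘(ℝ, E) x →L[ℝ] ℝ)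
    (v : TangentSpace 𝓘(ℝ, F) (C.pr x)) : C.horCov x α v = α (C.lift x v) := rfl

lemma horCov_pullCov (x : N) (a : TangentSpace 𝓘(ℝ, F) (C.pr x) →L[ℝ] ℝ) :
    C.horCov x (C.pullCov x a) = a := by
  ext v
  rw [horCov_apply, pullCov_apply, dpr_lift]

/-- The horizontal part of the bivector. -/
def sharpH (x : N) : (TangentSpace 𝓘(ℝ, E) x →L[ℝ] ℝ) →ₗ[ℝ] TangentSpace 𝓘(ℝ, E) x :=
  C.Ψ.sharp x ∘ₗ C.pullCov x ∘ₗ C.horCov x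

lemma sharpH_apply (x : N) (α : TangentSpace 𝓘(ℝ, E) x →L[ℝ] ℝ) :
    C.sharpH x α = C.lift x (C.baseEquiv x (C.horCov x α)) :=
  C.sharp_pullCov x _

lemma sharpH_pullCov (x : N) (a : TangentSpace 𝓘(ℝ, F) (C.pr x) →L[ℝ] ℝ) :
    C.sharpH x (C.pullCov x a) = C.Ψ.sharp x (C.pullCov x a) := by
  rw [sharpH_apply, horCov_pullCov, sharp_pullCov]

lemma sharpH_skew (x : N) (α β : TangentSpace 𝓘(ℝ, E) x →L[ℝ] ℝ) :
    β (C.sharpH x α) = -α (C.sharpH x β) := by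
  rw [sharpH_apply, sharpH_apply, ← horCov_apply, ← horCov_apply, baseEquiv_skew]

lemma dpr_sharpH (x : N) (α : TangentSpace 𝓘(ℝ, E) x →L[ℝ] ℝ) :
    C.dpr x (C.sharpH x α) = C.dpr x (C.Ψ.sharp x α) := by
  refine eq_of_forall_covector fun a => ?_
  rw [dpr_sharp, sharpH_apply, dpr_lift, baseEquiv_skew, horCov_apply]

lemma range_sharpH (x : N) : LinearMap.range (C.sharpH x) = LinearMap.range (C.lift x) := by
  apply le_antisymm
  · rintro _ ⟨α, rfl⟩
    exact ⟨_, (C.sharpH_apply x α).symm⟩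
  · rintro _ ⟨v, rfl⟩
    refine ⟨C.pullCov x ((C.baseEquiv x).symm v), ?_⟩
    rw [sharpH_pullCov, lift_apply]

lemma lift_injective (x : N) : Function.Injective (C.lift x) :=
  Function.LeftInverse.injective (C.dpr_lift x)

/-- The vertical part of the bivector. -/
def sharpV (x : N) : (TangentSpace 𝓘(ℝ, E) x →L[ℝ] ℝ) →ₗ[ℝ] TangentSpace 𝓘(ℝ, E) x :=
  C.Ψ.sharp x - C.sharpH x

lemma dpr_sharpV (x : N) (α : TangentSpace 𝓘(ℝ, E) x →L[ℝ] ℝ) :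
    C.dpr x (C.sharpV x α) = 0 := by
  rw [sharpV, LinearMap.sub_apply, map_sub, dpr_sharpH, sub_self]

lemma sharpV_pullCov (x : N) (a : TangentSpace 𝓘(ℝ, F) (C.pr x) →L[ℝ] ℝ) :
    C.sharpV x (C.pullCov x a) = 0 := by
  rw [sharpV, LinearMap.sub_apply, sharpH_pullCov, sub_self]

lemma sharpV_of_horCov_eq_zero {x : N} {α : TangentSpace 𝓘(ℝ, E) x →L[ℝ] ℝ}
    (h : C.horCov x α = 0) : C.sharpV x α = C.Ψ.sharp x α := by
  rw [sharpV, LinearMap.sub_apply, sharpH_apply, h]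
  simp

lemma dpr_sharp_of_horCov_eq_zero {x : N} {α : TangentSpace 𝓘(ℝ, E) x →L[ℝ] ℝ}
    (h : C.horCov x α = 0) : C.dpr x (C.Ψ.sharp x α) = 0 := by
  rw [← sharpV_of_horCov_eq_zero C h, dpr_sharpV]

/-! #### Pulling back functions -/

/-- Pull back smooth functions along the projection. -/
def pull : SmoothFn F S →ₗ[ℝ] SmoothFn E N where
  toFun f := ⟨f ∘ C.pr, f.contMDiff.comp C.contMDiff_pr⟩
  map_add' _ _ := rfl
  map_smul' _ _ := rfl

lemma pull_apply (f : SmoothFn F S) (x : N) : C.pull f x = f (C.pr x) := rfl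

lemma dAt_pull (f : SmoothFn F S) (x : N) : dAt x (C.pull f) = C.pullCov x (dAt (C.pr x) f) :=
  mvfderiv_comp x (f.mdifferentiableAt _) ((C.contMDiff_pr x).mdifferentiableAt (by simp))

lemma br_pull_pull (f g : SmoothFn F S) (x : N) :
    C.Ψ.br (C.pull f) (C.pull g) x = dAt (C.pr x) g (C.baseEquiv x (dAt (C.pr x) f)) := by
  rw [BivectorField.br_apply, dAt_pull, dAt_pull]; rfl

end TransverseFibration

end Transverse

end SemilocalPoisson

namespace SemilocalPoisson

/-! ### Smoothness of the horizontal lift and of the coupling data. -/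

section Transverse

variable {E : Type*} [NormedAddCommGroup E] [NormedSpace ℝ E]
  {N : Type*} [TopologicalSpace N] [ChartedSpace E N] [IsManifold 𝓘(ℝ, E) ∞ N]
  {F : Type*} [NormedAddCommGroup F] [NormedSpace ℝ F] [FiniteDimensional ℝ F]
  {S : Type*} [TopologicalSpace S] [ChartedSpace F S] [IsManifold 𝓘(ℝ, F) ∞ S] [T2Space S]

lemma contMDiffAt_matrix_det {n : ℕ} {a : N → Matrix (Fin n) (Fin n) ℝ} {x : N}
    (ha : ∀ i j, ContMDiffAt 𝓘(ℝ, E) 𝓘(ℝ, ℝ) ∞ (fun z => a z i j) x) :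
    ContMDiffAt 𝓘(ℝ, E) 𝓘(ℝ, ℝ) ∞ (fun z => (a z).det) x := by
  simp only [Matrix.det_apply']
  refine ContMDiffAt.sum fun σ _ => ?_
  refine contMDiffAt_const.mul (ContMDiffAt.prod fun i _ => ha _ _)

/-- Cramer's rule. -/
lemma contMDiffAt_matrix_inv {n : ℕ} {a : N → Matrix (Fin n) (Fin n) ℝ} {x : N}
    (ha : ∀ i j, ContMDiffAt 𝓘(ℝ, E) 𝓘(ℝ, ℝ) ∞ (fun z => a z i j) x) (hx : (a x).det ≠ 0)
    (i j : Fin n) : ContMDiffAt 𝓘(ℝ, E) 𝓘(ℝ, ℝ) ∞ (fun z => (a z)⁻¹ i j) x := by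
  have h : (fun z => (a z)⁻¹ i j) = fun z => (a z).det⁻¹ * (a z).adjugate i j := by
    funext z
    simp [Matrix.inv_def, Ring.inverse_eq_inv']
  rw [h]
  refine (contMDiffAt_matrix_det ha |>.inv₀ hx).mul ?_
  simp only [Matrix.adjugate_apply]
  refine contMDiffAt_matrix_det fun k l => ?_
  simp only [Matrix.updateRow_apply]
  split_ifs
  · exact contMDiffAt_const
  · exact ha k l

namespace TransverseFibration

variable (C : TransverseFibration E N F S)

/-- The function `-σ(u, v)` for vector fields on the base. -/
def invForm (u v : SmoothVF 𝓘(ℝ, F) S) (x : N) : ℝ :=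
  (C.baseEquiv x).symm (u (C.pr x)) (v (C.pr x))

/-- In a dual frame `y`, `w` of the base, the matrix of this form on the `w i` is the inverse of the
matrix of brackets of the pulled back functions `y i`, which is smooth. -/
lemma contMDiff_invForm (u v : SmoothVF 𝓘(ℝ, F) S) :
    ContMDiff 𝓘(ℝ, E) 𝓘(ℝ, ℝ) ∞ (C.invForm u v) := by
  intro x₀
  obtain ⟨y, w, hyw⟩ := exists_dual_frames (E := F) (C.pr x₀)
  have hyw' := C.contMDiff_pr.continuous.continuousAt.eventually hyw
  let a : N → Matrix (Fin (Module.finrank ℝ F)) (Fin (Module.finrank ℝ F)) ℝ :=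
    fun x i j => C.Ψ.br (C.pull (y i)) (C.pull (y j)) x
  have hinv : ∀ᶠ x in 𝓝 x₀, Matrix.of (fun i j => C.invForm (w i) (w j) x) * a x = 1 := by
    filter_upwards [hyw'] with x hx
    ext i k
    have h1 : ∀ b : TangentSpace 𝓘(ℝ, F) (C.pr x) →L[ℝ] ℝ,
        ∑ j, b (w j (C.pr x)) • dAt (C.pr x) (y j) = b := by
      intro b
      ext v
      conv_rhs => rw [hx.2 v]
      simp [mul_comm]
    have h2 : ∑ j, C.invForm (w i) (w j) x * a x j k =
        dAt (C.pr x) (y k) (C.baseEquiv x ((C.baseEquiv x).symm (w i (C.pr x)))) := by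
      conv_rhs => rw [← h1 ((C.baseEquiv x).symm (w i (C.pr x)))]
      simp only [map_sum, map_smul, smul_eq_mul]
      exact Finset.sum_congr rfl fun j _ => by rw [← br_pull_pull]; rfl
    rw [LinearEquiv.apply_symm_apply, hx.1] at h2
    rw [Matrix.mul_apply, Matrix.one_apply]
    exact h2.trans (by simp [eq_comm])
  have ha (i j) : ContMDiffAt 𝓘(ℝ, E) 𝓘(ℝ, ℝ) ∞ (fun z => a z i j) x₀ :=
    (C.Ψ.br (C.pull (y i)) (C.pull (y j))).contMDiff x₀
  have hdet : (a x₀).det ≠ 0 := by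
    have := congrArg Matrix.det hinv.self_of_nhds
    rw [Matrix.det_mul, Matrix.det_one] at this
    exact right_ne_zero_of_mul_eq_one this
  have hexp : C.invForm u v =ᶠ[𝓝 x₀] fun x => ∑ i, ∑ j,
      C.pull (derivVF u (y i)) x * (C.pull (derivVF v (y j)) x * (a x)⁻¹ i j) := by
    filter_upwards [hyw', hinv] with x hx hb
    rw [Matrix.inv_eq_left_inv hb]
    change (C.baseEquiv x).symm (u (C.pr x)) (v (C.pr x)) = _
    conv_lhs => rw [hx.2 (u (C.pr x)), hx.2 (v (C.pr x))]
    simp only [map_sum, map_smul, smul_eq_mul, sum_apply, smul_apply]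
    rw [Finset.sum_comm]
    simp only [Finset.mul_sum]
    refine Finset.sum_congr rfl fun i _ => Finset.sum_congr rfl fun j _ => ?_
    simp only [invForm, pull_apply, derivVF_apply, Matrix.of_apply]
    ring
  refine ContMDiffAt.congr_of_eventuallyEq ?_ hexp
  refine ContMDiffAt.sum fun i _ => ContMDiffAt.sum fun j _ => ?_
  exact ((C.pull _).contMDiff x₀).mul (((C.pull _).contMDiff x₀).mul
    (contMDiffAt_matrix_inv ha hdet i j))

/-- Near `x₀`, the horizontal lifts are combinations of Hamiltonian vector fields. -/
lemma eventually_lift_eq {x₀ : N} {n : ℕ} {y : Fin n → SmoothFn F S}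
    {w : Fin n → SmoothVF 𝓘(ℝ, F) S}
    (h : ∀ᶠ s in 𝓝 (C.pr x₀), ∀ v : TangentSpace 𝓘(ℝ, F) s, v = ∑ i, dAt s (y i) v • w i s) :
    ∀ᶠ x in 𝓝 x₀, ∀ b : TangentSpace 𝓘(ℝ, F) (C.pr x) →L[ℝ] ℝ,
      C.Ψ.sharp x (C.pullCov x b) =
        ∑ i, b (w i (C.pr x)) • C.Ψ.hamField (C.pull (y i)) x := by
  filter_upwards [C.contMDiff_pr.continuous.continuousAt.eventually h] with x hx b
  have h1 : ∑ j, b (w j (C.pr x)) • dAt (C.pr x) (y j) = b := by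
    ext v
    conv_rhs => rw [hx v]
    simp [mul_comm]
  conv_lhs => rw [← h1]
  simp only [map_sum, map_smul]
  refine Finset.sum_congr rfl fun i _ => ?_
  rw [BivectorField.hamField_apply, dAt_pull]

/-- A horizontal vector field is smooth if the corresponding 1-form is. -/
lemma contMDiff_sharp_pullCov
    (θ : ∀ x, TangentSpace 𝓘(ℝ, F) (C.pr x) →L[ℝ] ℝ)
    (hθ : ∀ v : SmoothVF 𝓘(ℝ, F) S, ContMDiff 𝓘(ℝ, E) 𝓘(ℝ, ℝ) ∞ fun x => θ x (v (C.pr x))) :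
    ContMDiff 𝓘(ℝ, E) 𝓘(ℝ, E).tangent ∞
      (fun x => (⟨x, C.Ψ.sharp x (C.pullCov x (θ x))⟩ : TangentBundle 𝓘(ℝ, E) N)) := by
  intro x₀
  obtain ⟨y, w, hyw⟩ := exists_dual_frames (E := F) (C.pr x₀)
  have h := C.eventually_lift_eq (hyw.mono fun _ h => h.2)
  have h2 : ContMDiffAt 𝓘(ℝ, E) 𝓘(ℝ, E).tangent ∞
      (fun x => (⟨x, ∑ i, θ x (w i (C.pr x)) • C.Ψ.hamField (C.pull (y i)) x⟩ :
        TangentBundle 𝓘(ℝ, E) N)) x₀ := by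
    refine ContMDiffAt.sum_section fun i _ => ?_
    exact ContMDiffAt.smul_section (hθ _ _) ((C.Ψ.hamField (C.pull (y i))).contMDiff x₀)
  refine h2.congr_of_eventuallyEq ?_
  filter_upwards [h] with x hx
  rw [hx]

lemma contMDiff_lift (u : SmoothVF 𝓘(ℝ, F) S) : ContMDiff 𝓘(ℝ, E) 𝓘(ℝ, E).tangent ∞
    (fun x => (⟨x, C.lift x (u (C.pr x))⟩ : TangentBundle 𝓘(ℝ, E) N)) :=
  C.contMDiff_sharp_pullCov (fun x => (C.baseEquiv x).symm (u (C.pr x)))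
    (C.contMDiff_invForm u)

/-- The Ehresmann connection whose horizontal space is `Ψ♯(V⁰)`. -/
def conn : EhresmannConnection 𝓘(ℝ, E) 𝓘(ℝ, F) C.pr where
  lift := C.lift
  mfderiv_lift := C.dpr_lift
  smooth := C.contMDiff_lift

/-- The horizontal lift of a vector field. -/
def hor (u : SmoothVF 𝓘(ℝ, F) S) : SmoothVF 𝓘(ℝ, E) N :=
  ⟨fun x => C.lift x (u (C.pr x)), C.contMDiff_lift u⟩

lemma hor_apply (u : SmoothVF 𝓘(ℝ, F) S) (x : N) : C.hor u x = C.lift x (u (C.pr x)) := rfl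

lemma derivVF_hor_apply (u : SmoothVF 𝓘(ℝ, F) S) (G : SmoothFn E N) (x : N) :
    derivVF (C.hor u) G x = C.horCov x (dAt x G) (u (C.pr x)) := rfl

/-- The horizontal bivector field. -/
def ΨH : BivectorField 𝓘(ℝ, E) N where
  sharp := C.sharpH
  skew := C.sharpH_skew
  smooth G hG := C.contMDiff_sharp_pullCov
    (fun x => C.horCov x (dAt x (⟨G, hG⟩ : SmoothFn E N)))
    (fun v => (derivVF (C.hor v) ⟨G, hG⟩).contMDiff)

/-- The vertical bivector field. -/
def ΨV : BivectorField 𝓘(ℝ, E) N where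
  sharp := C.sharpV
  skew x α β := by
    simp only [sharpV, LinearMap.sub_apply, map_sub]
    rw [C.Ψ.skew x α β, C.sharpH_skew x α β]
    ring
  smooth G hG := by
    have := (C.Ψ.hamField ⟨G, hG⟩ - C.ΨH.hamField ⟨G, hG⟩).contMDiff
    exact this

/-- The coupling form. -/
def sigma : RawForm 𝓘(ℝ, F) C.pr 2 := fun x => alternatingTwo
  (-(ContinuousLinearMap.coeLM ℝ ∘ₗ (C.baseEquiv x).symm.toLinearMap)) (fun v => by
    have := C.baseEquiv_symm_skew x v v
    change -((C.baseEquiv x).symm v v) = 0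
    linarith)

lemma sigma_mem : C.sigma ∈ horForm 𝓘(ℝ, E) 𝓘(ℝ, F) C.pr 2 := fun u =>
  (C.contMDiff_invForm (u 0) (u 1)).neg

lemma mem_vertAnn_iff (x : N) (α : TangentSpace 𝓘(ℝ, E) x →L[ℝ] ℝ) :
    α ∈ vertAnn 𝓘(ℝ, E) 𝓘(ℝ, F) C.pr x ↔ ∃ a, α = C.pullCov x a := by
  constructor
  · intro h
    refine ⟨C.horCov x α, ?_⟩
    ext w
    have := h (w - C.lift x (C.dpr x w)) (by
      rw [map_sub, sub_eq_zero]
      exact (C.dpr_lift x _).symm)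
    rw [map_sub, sub_eq_zero] at this
    exact this
  · rintro ⟨a, rfl⟩ w hw
    rw [pullCov_apply]
    exact (congrArg a hw).trans (map_zero a)

lemma isCoupling : IsCoupling C.Ψ C.ΨH C.ΨV C.conn C.sigma where
  decomp x := (add_sub_cancel (C.sharpH x) (C.Ψ.sharp x)).symm
  horizontal := C.range_sharpH
  vertical := C.dpr_sharpV
  coupling x := by
    apply le_antisymm
    · rintro _ ⟨α, hα, rfl⟩
      obtain ⟨a, rfl⟩ := (C.mem_vertAnn_iff x α).1 hα
      exact ⟨_, (C.sharp_pullCov x a).symm⟩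
    · rintro _ ⟨v, rfl⟩
      exact ⟨_, (C.mem_vertAnn_iff x _).2 ⟨_, rfl⟩, (C.lift_apply x v).symm⟩
  sigma_mem := C.sigma_mem
  sigma_eq x v α hα := by
    -- The minus sign in `sigma` turns the covector whose image is the lift of `v` into its
    -- negative.
    have : α = C.pullCov x (-((C.baseEquiv x).symm v)) := by
      ext w
      rw [hα w]
      rfl
    change C.sharpH x α = -C.lift x v
    rw [this, sharpH_pullCov, map_neg, map_neg, lift_apply]

lemma rank_ΨH (x : N) : C.ΨH.rank x = Module.finrank ℝ F := by
  change Module.finrank ℝ (LinearMap.range (C.sharpH x)) = _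
  rw [range_sharpH, LinearMap.finrank_range_of_inj (C.lift_injective x)]
  rfl

end TransverseFibration

end Transverse

end SemilocalPoisson

namespace SemilocalPoisson

/-! ### First order calculus at a point. -/

section Transverse

variable {E : Type*} [NormedAddCommGroup E] [NormedSpace ℝ E]
  {N : Type*} [TopologicalSpace N] [ChartedSpace E N] [IsManifold 𝓘(ℝ, E) ∞ N]
  {F : Type*} [NormedAddCommGroup F] [NormedSpace ℝ F] [FiniteDimensional ℝ F]
  {S : Type*} [TopologicalSpace S] [ChartedSpace F S] [IsManifold 𝓘(ℝ, F) ∞ S] [T2Space S]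

lemma SmoothFn.sum_apply {ι : Type*} (s : Finset ι) (G : ι → SmoothFn E N) (x : N) :
    (∑ i ∈ s, G i) x = ∑ i ∈ s, G i x :=
  map_sum (⟨⟨fun G : SmoothFn E N => G x, rfl⟩, fun _ _ => rfl⟩ : SmoothFn E N →+ ℝ) _ _

/-- With this, identities between tangent vectors and covectors at a point can be tested on global
functions. -/
lemma exists_dAt_eq {s : S} (a : TangentSpace 𝓘(ℝ, F) s →L[ℝ] ℝ) :
    ∃ f : SmoothFn F S, dAt s f = a := by
  obtain ⟨y, w, hyw⟩ := exists_dual_frames (E := F) s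
  refine ⟨∑ i, a (w i s) • y i, ?_⟩
  ext v
  conv_rhs => rw [hyw.self_of_nhds.2 v]
  simp [mul_comm]

lemma exists_vectorField_eq {s : S} (v : TangentSpace 𝓘(ℝ, F) s) :
    ∃ u : SmoothVF 𝓘(ℝ, F) S, u s = v := by
  obtain ⟨y, w, hyw⟩ := exists_dual_frames (E := F) s
  refine ⟨∑ i, dAt s (y i) v • w i, ?_⟩
  conv_rhs => rw [hyw.self_of_nhds.2 v]
  exact map_sum (⟨⟨fun u : SmoothVF 𝓘(ℝ, F) S => u s, rfl⟩, fun _ _ => rfl⟩ :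
    SmoothVF 𝓘(ℝ, F) S →+ TangentSpace 𝓘(ℝ, F) s) _ _

namespace TransverseFibration

variable (C : TransverseFibration E N F S)

/-- The product of a 1-form and a vector vanishing at a point has zero differential there. -/
lemma dAt_pairing_eq_zero {e : N} (θ : ∀ x, TangentSpace 𝓘(ℝ, F) (C.pr x) →L[ℝ] ℝ)
    (hθ : ∀ v : SmoothVF 𝓘(ℝ, F) S, ContMDiff 𝓘(ℝ, E) 𝓘(ℝ, ℝ) ∞ fun x => θ x (v (C.pr x)))
    (v : ∀ x, TangentSpace 𝓘(ℝ, F) (C.pr x))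
    (hv : ∀ y : SmoothFn F S, ContMDiff 𝓘(ℝ, E) 𝓘(ℝ, ℝ) ∞ fun x => dAt (C.pr x) y (v x))
    (hθe : θ e = 0) (hve : v e = 0) (G : SmoothFn E N) (hG : ∀ x, G x = θ x (v x)) :
    dAt e G = 0 := by
  obtain ⟨y, w, hyw⟩ := exists_dual_frames (E := F) (C.pr e)
  let Θ (i) : SmoothFn E N := ⟨_, hθ (w i)⟩
  let V (i) : SmoothFn E N := ⟨_, hv (y i)⟩
  -- In a dual frame `G` is locally a finite sum of products whose two factors both vanish at `e`;
  -- then the Leibniz rule applies.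
  have h : dAt e G = dAt e (∑ i, Θ i * V i) := by
    refine dAt_congr ?_
    filter_upwards [C.contMDiff_pr.continuous.continuousAt.eventually hyw] with x hx
    rw [hG, hx.2 (v x), map_sum, SmoothFn.sum_apply]
    refine Finset.sum_congr rfl fun i _ => ?_
    rw [map_smul, smul_eq_mul, mul_comm]
    rfl
  rw [h, map_sum]
  refine Finset.sum_eq_zero fun i _ => ?_
  rw [dAt_mul]
  have h1 : Θ i e = 0 := by
    change θ e _ = 0
    rw [hθe]; rfl
  have h2 : V i e = 0 := by
    change dAt _ _ (v e) = 0
    rw [hve, map_zero]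
  rw [h1, h2, zero_smul, zero_smul, add_zero]

/-- The differential of `G` at `x` vanishes on horizontal vectors. -/
def HorFlat (x : N) (G : SmoothFn E N) : Prop := C.horCov x (dAt x G) = 0

/-- `f` represents the vector field `u` at `e`: `Ψ♯ d(f ∘ pr) = hor u` at `e`. -/
def Represents (e : N) (f : SmoothFn F S) (u : SmoothVF 𝓘(ℝ, F) S) : Prop :=
  C.baseEquiv e (dAt (C.pr e) f) = u (C.pr e)

lemma exists_represents (e : N) (u : SmoothVF 𝓘(ℝ, F) S) : ∃ f, C.Represents e f u := by
  obtain ⟨f, hf⟩ := exists_dAt_eq ((C.baseEquiv e).symm (u (C.pr e)))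
  exact ⟨f, by rw [Represents, hf, LinearEquiv.apply_symm_apply]⟩

lemma exists_represents' (e : N) (f : SmoothFn F S) : ∃ u, C.Represents e f u := by
  obtain ⟨u, hu⟩ := exists_vectorField_eq (C.baseEquiv e (dAt (C.pr e) f))
  exact ⟨u, hu.symm⟩

variable {C}

lemma Represents.symm_eq {e : N} {f : SmoothFn F S} {u : SmoothVF 𝓘(ℝ, F) S}
    (h : C.Represents e f u) : (C.baseEquiv e).symm (u (C.pr e)) = dAt (C.pr e) f := by
  rw [← h, LinearEquiv.symm_apply_apply]

lemma Represents.hamField_eq {e : N} {f : SmoothFn F S} {u : SmoothVF 𝓘(ℝ, F) S}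
    (h : C.Represents e f u) : C.Ψ.hamField (C.pull f) e = C.hor u e := by
  rw [BivectorField.hamField_apply, dAt_pull, sharp_pullCov, h, hor_apply]

lemma Represents.br_eq {e : N} {f : SmoothFn F S} {u : SmoothVF 𝓘(ℝ, F) S}
    (h : C.Represents e f u) (G : SmoothFn E N) :
    C.Ψ.br (C.pull f) G e = derivVF (C.hor u) G e := by
  rw [BivectorField.br_eq, derivVF_apply, h.hamField_eq, derivVF_apply]

variable (C)

/-- Additive functionals that vanish on pulled back functions and on horizontally flat functions
vanish. -/
lemma eq_zero_of_pull_of_horFlat (e : N) (T : SmoothFn E N → ℝ)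
    (hadd : ∀ G K, T (G + K) = T G + T K) (hb : ∀ f, T (C.pull f) = 0)
    (hk : ∀ G, C.HorFlat e G → T G = 0) (G : SmoothFn E N) : T G = 0 := by
  -- Subtracting a pullback whose differential agrees with that of `G` on the horizontal space
  -- leaves a horizontally flat function.
  obtain ⟨f, hf⟩ := exists_dAt_eq (C.horCov e (dAt e G))
  have h := hadd (G - C.pull f) (C.pull f)
  rw [sub_add_cancel, hb, add_zero] at h
  rw [h]
  refine hk _ ?_
  rw [HorFlat, map_sub, map_sub, dAt_pull, horCov_pullCov, hf, sub_self]

/-! #### Evaluation of brackets -/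

lemma derivVF_hor_pull (u : SmoothVF 𝓘(ℝ, F) S) (f : SmoothFn F S) :
    derivVF (C.hor u) (C.pull f) = C.pull (derivVF u f) := by
  ext x
  rw [derivVF_hor_apply, dAt_pull, horCov_pullCov]
  rfl

lemma brV_pull_left (f : SmoothFn F S) (G : SmoothFn E N) : C.ΨV.br (C.pull f) G = 0 := by
  ext x
  rw [BivectorField.br_apply, dAt_pull]
  change dAt x G (C.sharpV x _) = 0
  rw [sharpV_pullCov, map_zero]

lemma brV_pull_right (G : SmoothFn E N) (f : SmoothFn F S) : C.ΨV.br G (C.pull f) = 0 := by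
  rw [BivectorField.br_skew, brV_pull_left, neg_zero]

lemma br_eq_add (G K : SmoothFn E N) : C.Ψ.br G K = C.ΨH.br G K + C.ΨV.br G K := by
  ext x
  change dAt x K (C.Ψ.sharp x _) = dAt x K (C.sharpH x _) + dAt x K (C.sharpV x _)
  rw [← map_add, sharpV, LinearMap.sub_apply, add_sub_cancel]

variable {C}

lemma HorFlat.brV_left {e : N} {G : SmoothFn E N} (h : C.HorFlat e G) (K : SmoothFn E N) :
    C.ΨV.br G K e = C.Ψ.br G K e := by
  exact congrArg (dAt e K) (C.sharpV_of_horCov_eq_zero h)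

lemma HorFlat.brV_right {e : N} {G : SmoothFn E N} (h : C.HorFlat e G) (K : SmoothFn E N) :
    C.ΨV.br K G e = C.Ψ.br K G e := by
  rw [BivectorField.br_skew_apply, h.brV_left, BivectorField.br_skew_apply, neg_neg]

lemma HorFlat.derivVF_hor {e : N} {G : SmoothFn E N} (h : C.HorFlat e G)
    (u : SmoothVF 𝓘(ℝ, F) S) : derivVF (C.hor u) G e = 0 := by
  rw [derivVF_hor_apply, h]; rfl

lemma HorFlat.br_pull_left {e : N} {G : SmoothFn E N} (h : C.HorFlat e G) (f : SmoothFn F S) :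
    C.Ψ.br (C.pull f) G e = 0 := by
  rw [← h.brV_right, brV_pull_left]; rfl

lemma HorFlat.br_pull_right {e : N} {G : SmoothFn E N} (h : C.HorFlat e G) (f : SmoothFn F S) :
    C.Ψ.br G (C.pull f) e = 0 := by
  rw [BivectorField.br_skew_apply, h.br_pull_left, neg_zero]

/-! #### First order identities at a point -/

/-- The horizontal part of the bracket pairs the horizontal restrictions of the two differentials,
and both vanish at `e`. So the two brackets agree at `e` to first order, which is what permits
replacing one by the other inside an iterated bracket. -/
lemma HorFlat.dAt_brV {e : N} {G K : SmoothFn E N} (hG : C.HorFlat e G) (hK : C.HorFlat e K) :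
    dAt e (C.ΨV.br G K) = dAt e (C.Ψ.br G K) := by
  have h : dAt e (C.ΨH.br G K) = 0 := by
    have hdpr (x : N) : C.baseEquiv x (C.horCov x (dAt x G)) = C.dpr x (C.Ψ.sharp x (dAt x G)) := by
      rw [← dpr_sharpH, sharpH_apply, dpr_lift]
    refine C.dAt_pairing_eq_zero (fun x => C.horCov x (dAt x K))
      (fun v => (derivVF (C.hor v) K).contMDiff) (fun x => C.baseEquiv x (C.horCov x (dAt x G)))
      (fun y => ?_) hK ?_ _ fun x => ?_
    -- The components of the vector factor are brackets of `G` with pulled back functions, hence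
    -- smooth.
    · refine (C.Ψ.br G (C.pull y)).contMDiff.congr fun x => ?_
      rw [hdpr, BivectorField.br_apply, dAt_pull, pullCov_apply]
    · rw [hG, map_zero]
    · rw [BivectorField.br_apply]
      change dAt x K (C.sharpH x _) = _
      rw [sharpH_apply, horCov_apply]
  rw [C.br_eq_add, map_add, h, zero_add]

variable (C) in
/-- Smooth families of covectors on the base, indexed by `N`. -/
def SmoothCov (θ : ∀ x, TangentSpace 𝓘(ℝ, F) (C.pr x) →L[ℝ] ℝ) : Prop :=
  ∀ v : SmoothVF 𝓘(ℝ, F) S, ContMDiff 𝓘(ℝ, E) 𝓘(ℝ, ℝ) ∞ fun x => θ x (v (C.pr x))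

/-- The function `θ(v)`. -/
def SmoothCov.eval {θ : ∀ x, TangentSpace 𝓘(ℝ, F) (C.pr x) →L[ℝ] ℝ} (hθ : C.SmoothCov θ)
    (v : SmoothVF 𝓘(ℝ, F) S) : SmoothFn E N := ⟨_, hθ v⟩

/-- The horizontal vector field `Ψ♯(pr^* θ)`. -/
def SmoothCov.field {θ : ∀ x, TangentSpace 𝓘(ℝ, F) (C.pr x) →L[ℝ] ℝ} (hθ : C.SmoothCov θ) :
    SmoothVF 𝓘(ℝ, E) N := ⟨_, C.contMDiff_sharp_pullCov θ hθ⟩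

lemma SmoothCov.sub {θ η : ∀ x, TangentSpace 𝓘(ℝ, F) (C.pr x) →L[ℝ] ℝ} (hθ : C.SmoothCov θ)
    (hη : C.SmoothCov η) : C.SmoothCov (fun x => θ x - η x) := fun v => (hθ v).sub (hη v)

variable (C) in
lemma smoothCov_symm (u : SmoothVF 𝓘(ℝ, F) S) :
    C.SmoothCov (fun x => (C.baseEquiv x).symm (u (C.pr x))) := C.contMDiff_invForm u

variable (C) in
lemma smoothCov_dAt (f : SmoothFn F S) : C.SmoothCov (fun x => dAt (C.pr x) f) :=
  fun v => (C.pull (derivVF v f)).contMDiff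

lemma SmoothCov.field_apply {θ : ∀ x, TangentSpace 𝓘(ℝ, F) (C.pr x) →L[ℝ] ℝ}
    (hθ : C.SmoothCov θ) (x : N) : hθ.field x = C.Ψ.sharp x (C.pullCov x (θ x)) := rfl

lemma SmoothCov.derivVF_field_apply {θ : ∀ x, TangentSpace 𝓘(ℝ, F) (C.pr x) →L[ℝ] ℝ}
    (hθ : C.SmoothCov θ) (G : SmoothFn E N) (x : N) :
    derivVF hθ.field G x = -θ x (C.dpr x (C.Ψ.sharp x (dAt x G))) := by
  rw [derivVF_apply, field_apply, C.Ψ.skew, pullCov_apply]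

lemma SmoothCov.field_eq_zero {θ : ∀ x, TangentSpace 𝓘(ℝ, F) (C.pr x) →L[ℝ] ℝ}
    (hθ : C.SmoothCov θ) {e : N} (he : θ e = 0) : hθ.field e = 0 := by
  rw [field_apply, he, map_zero, map_zero]

/-- Up to sign the derivative is the pairing of `θ` with the base component of the Hamiltonian field
of `G`; the first factor vanishes at `e` by assumption and the second by flatness. -/
lemma SmoothCov.dAt_derivVF_horFlat {θ : ∀ x, TangentSpace 𝓘(ℝ, F) (C.pr x) →L[ℝ] ℝ}
    (hθ : C.SmoothCov θ) {e : N} (he : θ e = 0) {G : SmoothFn E N} (hG : C.HorFlat e G) :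
    dAt e (derivVF hθ.field G) = 0 := by
  rw [← neg_eq_zero, ← map_neg]
  refine C.dAt_pairing_eq_zero θ hθ (fun x => C.dpr x (C.Ψ.sharp x (dAt x G)))
    (fun y => ?_) he (C.dpr_sharp_of_horCov_eq_zero hG) _ fun x => ?_
  · refine (C.Ψ.br G (C.pull y)).contMDiff.congr fun x => ?_
    rw [BivectorField.br_apply, dAt_pull, pullCov_apply]
  · change -(derivVF hθ.field G x) = _
    rw [hθ.derivVF_field_apply, neg_neg]

lemma contMDiff_dAt_sub_baseEquiv (v : SmoothVF 𝓘(ℝ, F) S) (g y : SmoothFn F S) :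
    ContMDiff 𝓘(ℝ, E) 𝓘(ℝ, ℝ) ∞
      fun x => dAt (C.pr x) y (v (C.pr x) - C.baseEquiv x (dAt (C.pr x) g)) := by
  refine (C.pull (derivVF v y) - C.Ψ.br (C.pull g) (C.pull y)).contMDiff.congr fun x => ?_
  rw [map_sub, ContMDiffMap.coe_sub, Pi.sub_apply, br_pull_pull, pull_apply, derivVF_apply]

/-- The derivative is `-θ` applied to the base component of the Hamiltonian field of `C.pull g`. At
`e` this component is `v`, and since `θ` vanishes there too, replacing it by `v` changes nothing to
first order. -/
lemma SmoothCov.dAt_derivVF_pull {θ : ∀ x, TangentSpace 𝓘(ℝ, F) (C.pr x) →L[ℝ] ℝ}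
    (hθ : C.SmoothCov θ) {e : N} (he : θ e = 0) {g : SmoothFn F S} {v : SmoothVF 𝓘(ℝ, F) S}
    (hg : C.Represents e g v) :
    dAt e (derivVF hθ.field (C.pull g)) = -dAt e (hθ.eval v) := by
  rw [← add_eq_zero_iff_eq_neg, ← map_add]
  refine C.dAt_pairing_eq_zero θ hθ (fun x => v (C.pr x) - C.baseEquiv x (dAt (C.pr x) g))
    (contMDiff_dAt_sub_baseEquiv v g) he (sub_eq_zero.2 hg.symm) _ fun x => ?_
  change derivVF hθ.field (C.pull g) x + θ x (v (C.pr x)) = _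
  rw [hθ.derivVF_field_apply, dAt_pull, map_sub, ← baseEquiv_apply]
  ring

/-- The lift of `u` and the Hamiltonian field of `C.pull f` differ by the horizontal field of a
family of covectors that vanishes at `e`. -/
lemma Represents.dAt_derivVF_hor {e : N} {f : SmoothFn F S} {u : SmoothVF 𝓘(ℝ, F) S}
    (hf : C.Represents e f u) {G : SmoothFn E N} (hG : C.HorFlat e G) :
    dAt e (derivVF (C.hor u) G) = dAt e (C.Ψ.br (C.pull f) G) := by
  have hθ := (C.smoothCov_symm u).sub (C.smoothCov_dAt f)
  have h := hθ.dAt_derivVF_horFlat (e := e) (by rw [hf.symm_eq, sub_self]) hG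
  rw [← sub_eq_zero, ← map_sub, ← h]
  have h1 : C.hor u - C.Ψ.hamField (C.pull f) = hθ.field := by
    ext x
    rw [hθ.field_apply, map_sub, map_sub, ← dAt_pull]
    rfl
  rw [BivectorField.br_eq, ← derivVF_sub, h1]

variable (C) in
/-- The function `σ(u, v)`. -/
def sig (u v : SmoothVF 𝓘(ℝ, F) S) : SmoothFn E N := ⟨_, C.sigma_mem ![u, v]⟩

lemma sig_apply (u v : SmoothVF 𝓘(ℝ, F) S) (x : N) :
    C.sig u v x = -(C.baseEquiv x).symm (u (C.pr x)) (v (C.pr x)) := rfl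

lemma sig_skew (u v : SmoothVF 𝓘(ℝ, F) S) : C.sig u v = -C.sig v u := by
  ext x
  change C.sig u v x = -C.sig v u x
  rw [sig_apply, sig_apply, baseEquiv_symm_skew]

/-- Write `B` for `baseEquiv`. The two sides differ, up to sign, by the product of `B⁻¹v - dg` and
`w - B dh`, both zero at `e`. Expanding this product gives `-σ(v, w) + v h - w g - {g, h}`. -/
lemma Represents.dAt_sig {e : N} {g h : SmoothFn F S} {v w : SmoothVF 𝓘(ℝ, F) S}
    (hg : C.Represents e g v) (hh : C.Represents e h w) :
    dAt e (C.sig v w) =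
      dAt e (C.pull (derivVF v h - derivVF w g) - C.Ψ.br (C.pull g) (C.pull h)) := by
  rw [← sub_eq_zero, ← neg_eq_zero, ← map_sub, ← map_neg]
  refine C.dAt_pairing_eq_zero _ ((C.smoothCov_symm v).sub (C.smoothCov_dAt g))
    (fun x => w (C.pr x) - C.baseEquiv x (dAt (C.pr x) h))
    (contMDiff_dAt_sub_baseEquiv w h) (by rw [hg.symm_eq, sub_self]) (sub_eq_zero.2 hh.symm) _
    fun x => ?_
  have h1 : (C.baseEquiv x).symm (v (C.pr x)) (C.baseEquiv x (dAt (C.pr x) h)) =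
      -dAt (C.pr x) h (v (C.pr x)) := by
    rw [baseEquiv_skew, LinearEquiv.apply_symm_apply]
  have h2 := C.br_pull_pull g h x
  have h3 := C.baseEquiv_skew x (dAt (C.pr x) g) (dAt (C.pr x) h)
  change -(C.sig v w x - ((dAt (C.pr x) h (v (C.pr x)) - dAt (C.pr x) g (w (C.pr x)))
    - C.Ψ.br (C.pull g) (C.pull h) x)) = _
  rw [sig_apply, h2, map_sub, sub_apply, sub_apply, h1]
  linarith

/-- Vertical derivatives of `σ`. -/
lemma Represents.dAt_sig_vertical {e : N} {g h : SmoothFn F S} {v w : SmoothVF 𝓘(ℝ, F) S}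
    (hg : C.Represents e g v) (hh : C.Represents e h w) {Y : TangentSpace 𝓘(ℝ, E) e}
    (hY : C.dpr e Y = 0) :
    dAt e (C.sig v w) Y = -dAt e (C.Ψ.br (C.pull g) (C.pull h)) Y := by
  rw [hg.dAt_sig hh, map_sub, sub_apply, dAt_pull, pullCov_apply, hY, map_zero,
    zero_sub]

end TransverseFibration

end Transverse

end SemilocalPoisson

namespace SemilocalPoisson

/-! ### The Jacobi identity of `Ψ` split by type. -/

section Transverse

variable {E : Type*} [NormedAddCommGroup E] [NormedSpace ℝ E]
  {N : Type*} [TopologicalSpace N] [ChartedSpace E N] [IsManifold 𝓘(ℝ, E) ∞ N]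
  {F : Type*} [NormedAddCommGroup F] [NormedSpace ℝ F] [FiniteDimensional ℝ F]
  {S : Type*} [TopologicalSpace S] [ChartedSpace F S] [IsManifold 𝓘(ℝ, F) ∞ S] [T2Space S]

namespace TransverseFibration

variable (C : TransverseFibration E N F S)

lemma HorFlat.brV_brV {C : TransverseFibration E N F S} {e : N} {G K L : SmoothFn E N}
    (hG : C.HorFlat e G) (hK : C.HorFlat e K) (hL : C.HorFlat e L) :
    C.ΨV.br G (C.ΨV.br K L) e = C.Ψ.br G (C.Ψ.br K L) e := by
  rw [hG.brV_left, BivectorField.br_apply, hK.dAt_brV hL, BivectorField.br_apply]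

lemma jacobi (G K L : SmoothFn E N) (x : N) :
    C.Ψ.br G (C.Ψ.br K L) x + C.Ψ.br K (C.Ψ.br L G) x + C.Ψ.br L (C.Ψ.br G K) x = 0 :=
  DFunLike.congr_fun (C.Ψ.isPoisson_iff.1 C.poisson G K L) x

/-- The vertical part of a Poisson tensor is a Poisson tensor. -/
theorem isPoisson_ΨV : C.ΨV.IsPoisson := by
  rw [BivectorField.isPoisson_iff]
  intro G K L
  ext e
  let J (G K L : SmoothFn E N) : ℝ :=
    (C.ΨV.br G (C.ΨV.br K L) + C.ΨV.br K (C.ΨV.br L G) + C.ΨV.br L (C.ΨV.br G K)) e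
  change J G K L = 0
  have hflat (G K L : SmoothFn E N) (hG : C.HorFlat e G) (hK : C.HorFlat e K)
      (hL : C.HorFlat e L) : J G K L = 0 := by
    change C.ΨV.br G (C.ΨV.br K L) e + C.ΨV.br K (C.ΨV.br L G) e + C.ΨV.br L (C.ΨV.br G K) e = 0
    rw [hG.brV_brV hK hL, hK.brV_brV hL hG, hL.brV_brV hG hK, C.jacobi]
  have hadd {A B : SmoothFn E N} : (A + B) e = A e + B e := rfl
  -- Pullbacks are Casimirs of `C.ΨV`, so a pulled back argument kills every term. Treating the
  -- arguments one by one leaves three flat functions, for which the Jacobi identity of `Ψ` can be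
  -- used.
  refine C.eq_zero_of_pull_of_horFlat e (fun G => J G K L) (fun G G' => ?_) (fun f => ?_)
    (fun G hG => ?_) G
  · simp only [J, map_add, LinearMap.add_apply, hadd]; ring
  · simp [J, brV_pull_left, brV_pull_right]
  refine C.eq_zero_of_pull_of_horFlat e (fun K => J G K L) (fun G G' => ?_) (fun f => ?_)
    (fun K hK => ?_) K
  · simp only [J, map_add, LinearMap.add_apply, hadd]; ring
  · simp [J, brV_pull_left, brV_pull_right]
  refine C.eq_zero_of_pull_of_horFlat e (fun L => J G K L) (fun G G' => ?_) (fun f => ?_)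
    (fun L hL => hflat G K L hG hK hL) L
  · simp only [J, map_add, LinearMap.add_apply, hadd]; ring
  · simp [J, brV_pull_left, brV_pull_right]

/-- The defect is additive and skew, so once pullbacks contribute nothing only pairs of flat
functions remain to be tested. -/
lemma defectV_eq_zero_of_horFlat {Z : SmoothVF 𝓘(ℝ, E) N}
    (hZ : ∀ (f : SmoothFn F S) (G : SmoothFn E N), C.ΨV.defect Z (C.pull f) G = 0) (e : N)
    (h : ∀ G K, C.HorFlat e G → C.HorFlat e K → C.ΨV.defect Z G K e = 0) (G K : SmoothFn E N) :
    C.ΨV.defect Z G K e = 0 := by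
  refine C.eq_zero_of_pull_of_horFlat e (fun G => C.ΨV.defect Z G K e)
    (fun G G' => by rw [BivectorField.defect_add_left]; rfl) (fun f => by rw [hZ]; rfl)
    (fun G hG => ?_) G
  refine C.eq_zero_of_pull_of_horFlat e (fun K => C.ΨV.defect Z G K e)
    (fun K K' => by rw [BivectorField.defect_add_right]; rfl)
    (fun f => by rw [BivectorField.defect_skew, hZ]; simp) (fun K hK => h G K hG hK) K

/-- Horizontal lifts are Poisson vector fields of the vertical part. -/
theorem hor_mem_poiss (u : SmoothVF 𝓘(ℝ, F) S) : C.hor u ∈ C.ΨV.poiss := by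
  rw [BivectorField.mem_poiss_iff]
  intro G K
  ext e
  refine C.defectV_eq_zero_of_horFlat (fun f G => ?_) e (fun G K hG hK => ?_) G K
  · simp [BivectorField.defect, brV_pull_left, derivVF_hor_pull]
  · obtain ⟨f, hf⟩ := C.exists_represents e u
    change derivVF (C.hor u) (C.ΨV.br G K) e - C.ΨV.br (derivVF (C.hor u) G) K e
      - C.ΨV.br G (derivVF (C.hor u) K) e = 0
    -- At `e` the lift acts as the bracket with `C.pull f`, also inside a further bracket, and the
    -- three terms become those of the Jacobi identity for `C.pull f`, `G`, `K`.
    have h1 : derivVF (C.hor u) (C.ΨV.br G K) e = C.Ψ.br (C.pull f) (C.Ψ.br G K) e := by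
      rw [← hf.br_eq, BivectorField.br_apply, hG.dAt_brV hK, BivectorField.br_apply]
    have h2 : C.ΨV.br (derivVF (C.hor u) G) K e = -C.Ψ.br K (C.Ψ.br (C.pull f) G) e := by
      rw [hK.brV_right, BivectorField.br_skew_apply, BivectorField.br_apply,
        hf.dAt_derivVF_hor hG, BivectorField.br_apply]
    have h3 : C.ΨV.br G (derivVF (C.hor u) K) e = -C.Ψ.br G (C.Ψ.br K (C.pull f)) e := by
      rw [hG.brV_left, BivectorField.br_apply, hf.dAt_derivVF_hor hK, C.Ψ.br_skew K,
        map_neg]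
      exact (neg_neg _).symm
    have := C.jacobi (C.pull f) G K e
    rw [h1, h2, h3]
    linarith

lemma derivVF_hor_brV (u : SmoothVF 𝓘(ℝ, F) S) (G K : SmoothFn E N) :
    derivVF (C.hor u) (C.ΨV.br G K) =
      C.ΨV.br (derivVF (C.hor u) G) K + C.ΨV.br G (derivVF (C.hor u) K) := by
  have := (C.ΨV.mem_poiss_iff _).1 (C.hor_mem_poiss u) G K
  rw [BivectorField.defect, sub_sub, sub_eq_zero] at this
  exact this

variable [FiniteDimensional ℝ E]

/-- The curvature identity `[hor u, hor v] = hor [u, v] - ΨV♯ dσ(u, v)`. -/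
theorem derivVF_hor_comm (u v : SmoothVF 𝓘(ℝ, F) S) (G : SmoothFn E N) :
    derivVF (C.hor u) (derivVF (C.hor v) G) - derivVF (C.hor v) (derivVF (C.hor u) G) =
      derivVF (C.hor (lieVF u v)) G - C.ΨV.br (C.sig u v) G := by
  rw [← sub_eq_zero]
  ext e
  refine C.eq_zero_of_pull_of_horFlat e (fun G =>
    (derivVF (C.hor u) (derivVF (C.hor v) G) - derivVF (C.hor v) (derivVF (C.hor u) G) -
      (derivVF (C.hor (lieVF u v)) G - C.ΨV.br (C.sig u v) G)) e) (fun G G' => ?_) (fun f => ?_)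
    (fun G hG => ?_) G
  · simp only [map_add, ContMDiffMap.coe_add, ContMDiffMap.coe_sub, Pi.add_apply, Pi.sub_apply]
    ring
  -- On pullbacks the lifts act as the fields on the base, and the bracket with `σ(u, v)` vanishes.
  · simp only [derivVF_hor_pull, brV_pull_right, derivVF_lieVF, map_sub]
    simp
  · obtain ⟨f, hf⟩ := C.exists_represents e u
    obtain ⟨g, hg⟩ := C.exists_represents e v
    change derivVF (C.hor u) (derivVF (C.hor v) G) e - derivVF (C.hor v) (derivVF (C.hor u) G) e -
      (derivVF (C.hor (lieVF u v)) G e - C.ΨV.br (C.sig u v) G e) = 0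
    -- On flat functions the identity is the Jacobi identity for `C.pull f`, `C.pull g`, `G`: the
    -- lift of `[u, v]` contributes zero, and the Hamiltonian field of `G` is vertical at `e`, so
    -- `dσ` can be read off along it.
    have h1 : derivVF (C.hor u) (derivVF (C.hor v) G) e = C.Ψ.br (C.pull f) (C.Ψ.br (C.pull g) G) e := by
      rw [← hf.br_eq, BivectorField.br_apply, hg.dAt_derivVF_hor hG, BivectorField.br_apply]
    have h2 : derivVF (C.hor v) (derivVF (C.hor u) G) e = C.Ψ.br (C.pull g) (C.Ψ.br (C.pull f) G) e := by
      rw [← hg.br_eq, BivectorField.br_apply, hf.dAt_derivVF_hor hG, BivectorField.br_apply]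
    have h3 : C.ΨV.br (C.sig u v) G e = C.Ψ.br G (C.Ψ.br (C.pull f) (C.pull g)) e := by
      rw [hG.brV_right, BivectorField.br_skew_apply, BivectorField.br_apply,
        hf.dAt_sig_vertical hg (C.dpr_sharp_of_horCov_eq_zero hG), neg_neg, BivectorField.br_apply]
    have h4 := C.jacobi (C.pull f) (C.pull g) G e
    rw [C.Ψ.br_skew G (C.pull f), map_neg] at h4
    change _ + -C.Ψ.br (C.pull g) (C.Ψ.br (C.pull f) G) e + _ = 0 at h4
    rw [h1, h2, h3, hG.derivVF_hor]
    linarith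

lemma Represents.sig_lie {C : TransverseFibration E N F S} {e : N} {h : SmoothFn F S}
    {w : SmoothVF 𝓘(ℝ, F) S} (hh : C.Represents e h w) (z : SmoothVF 𝓘(ℝ, F) S) :
    C.sig z w e = derivVF z h (C.pr e) := by
  rw [sig_apply, C.baseEquiv_symm_skew, neg_neg, hh.symm_eq, derivVF_apply]

/-- The coupling form is covariantly closed. -/
theorem sig_closed (u v w : SmoothVF 𝓘(ℝ, F) S) :
    derivVF (C.hor u) (C.sig v w) + derivVF (C.hor v) (C.sig w u) + derivVF (C.hor w) (C.sig u v)
      - C.sig (lieVF u v) w - C.sig (lieVF v w) u - C.sig (lieVF w u) v = 0 := by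
  ext e
  obtain ⟨f, hf⟩ := C.exists_represents e u
  obtain ⟨g, hg⟩ := C.exists_represents e v
  obtain ⟨h, hh⟩ := C.exists_represents e w
  change derivVF (C.hor u) (C.sig v w) e + derivVF (C.hor v) (C.sig w u) e
    + derivVF (C.hor w) (C.sig u v) e
      - C.sig (lieVF u v) w e - C.sig (lieVF v w) u e - C.sig (lieVF w u) v e = 0
  -- Each derivative of `σ` is an iterated bracket plus second derivatives on the base. The cyclic
  -- sum of the former is zero by the Jacobi identity; the latter are matched by the terms with Lie
  -- brackets.
  have key {u v w : SmoothVF 𝓘(ℝ, F) S} {f g h : SmoothFn F S} (hf : C.Represents e f u)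
      (hg : C.Represents e g v) (hh : C.Represents e h w) :
      derivVF (C.hor u) (C.sig v w) e = derivVF u (derivVF v h) (C.pr e)
        - derivVF u (derivVF w g) (C.pr e) - C.Ψ.br (C.pull f) (C.Ψ.br (C.pull g) (C.pull h)) e := by
    rw [← hf.br_eq, BivectorField.br_apply, hg.dAt_sig hh, ← BivectorField.br_apply, map_sub]
    change C.Ψ.br (C.pull f) _ e - _ = _
    rw [hf.br_eq, derivVF_hor_pull, pull_apply, map_sub]
    rfl
  rw [key hf hg hh, key hg hh hf, key hh hf hg, hh.sig_lie, hf.sig_lie, hg.sig_lie,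
    derivVF_lieVF, derivVF_lieVF, derivVF_lieVF]
  have := C.jacobi (C.pull f) (C.pull g) (C.pull h) e
  simp only [ContMDiffMap.coe_sub, Pi.sub_apply]
  linarith

end TransverseFibration

end Transverse

end SemilocalPoisson

namespace SemilocalPoisson

section Transverse

variable {E : Type*} [NormedAddCommGroup E] [NormedSpace ℝ E] [FiniteDimensional ℝ E]
  {N : Type*} [TopologicalSpace N] [ChartedSpace E N] [IsManifold 𝓘(ℝ, E) ∞ N]
  {F : Type*} [NormedAddCommGroup F] [NormedSpace ℝ F] [FiniteDimensional ℝ F]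
  {S : Type*} [TopologicalSpace S] [ChartedSpace F S] [IsManifold 𝓘(ℝ, F) ∞ S] [T2Space S]

namespace TransverseFibration

variable {C : TransverseFibration E N F S}

/-! #### Decomposition of the condition to be a Poisson vector field -/

/-- The covariant exterior derivative of a 1-form, as a smooth function. -/
def SmoothCov.ext {θ : ∀ x, TangentSpace 𝓘(ℝ, F) (C.pr x) →L[ℝ] ℝ} (hθ : C.SmoothCov θ)
    (u v : SmoothVF 𝓘(ℝ, F) S) : SmoothFn E N :=
  derivVF (C.hor u) (hθ.eval v) - derivVF (C.hor v) (hθ.eval u) - hθ.eval (lieVF u v)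

variable (C) in
/-- Vertical vector fields. -/
def IsVertical (Y : SmoothVF 𝓘(ℝ, E) N) : Prop := ∀ x, C.dpr x (Y x) = 0

lemma IsVertical.derivVF_pull {Y : SmoothVF 𝓘(ℝ, E) N} (hY : C.IsVertical Y) (f : SmoothFn F S) :
    derivVF Y (C.pull f) = 0 := by
  ext x
  rw [derivVF_apply, dAt_pull, pullCov_apply, hY, map_zero]
  rfl

section Formulas

variable {θ : ∀ x, TangentSpace 𝓘(ℝ, F) (C.pr x) →L[ℝ] ℝ} (hθ : C.SmoothCov θ)
  {Y : SmoothVF 𝓘(ℝ, E) N} (hY : C.IsVertical Y)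

-- For `b` with `db = θ` at a point, this splits off a Hamiltonian field, which has no defect, and
-- leaves a horizontal field vanishing at that point.
include hθ in
lemma SmoothCov.field_eq_add (b : SmoothFn F S) :
    hθ.field = C.Ψ.hamField (C.pull b) + (hθ.sub (C.smoothCov_dAt b)).field := by
  ext x
  change _ = C.Ψ.hamField (C.pull b) x + (hθ.sub (C.smoothCov_dAt b)).field x
  rw [field_apply, field_apply, BivectorField.hamField_apply, dAt_pull, map_sub, map_sub,
    add_sub_cancel]

/-- The remaining field `W` vanishes at `e`, so the term `W{G, K}` drops out and only the brackets
with `W G` and `W K` survive. -/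
lemma SmoothCov.defect_sub_field {e : N} {b : SmoothFn F S} (hb : dAt (C.pr e) b = θ e)
    (G K : SmoothFn E N) :
    C.Ψ.defect (Y - hθ.field) G K e = C.Ψ.defect Y G K e
      - dAt e (derivVF (hθ.sub (C.smoothCov_dAt b)).field G) (C.Ψ.hamField K e)
      + dAt e (derivVF (hθ.sub (C.smoothCov_dAt b)).field K) (C.Ψ.hamField G e) := by
  have h0 : (hθ.sub (C.smoothCov_dAt b)).field e = 0 :=
    field_eq_zero _ (by rw [hb, sub_self])
  have h1 := (C.Ψ.mem_poiss_iff _).1 (C.Ψ.hamField_mem_poiss C.poisson (C.pull b)) G K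
  rw [hθ.field_eq_add b, ← sub_sub, BivectorField.defect_sub_vf, BivectorField.defect_sub_vf, h1,
    sub_zero]
  set W := (hθ.sub (C.smoothCov_dAt b)).field
  change C.Ψ.defect Y G K e - (derivVF W (C.Ψ.br G K) e - C.Ψ.br (derivVF W G) K e
    - C.Ψ.br G (derivVF W K) e) = _
  rw [derivVF_apply, h0, map_zero, BivectorField.br_skew_apply, BivectorField.br_eq,
    BivectorField.br_eq, derivVF_apply, derivVF_apply]
  ring

-- The mixed component of `L_Z Ψ`; its vanishing is the condition that `θ` is a potential of `Y`.
include hY in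
lemma SmoothCov.defect_pull_horFlat {e : N} {f : SmoothFn F S} {u : SmoothVF 𝓘(ℝ, F) S}
    (hf : C.Represents e f u) {G : SmoothFn E N} (hG : C.HorFlat e G) :
    C.Ψ.defect (Y - hθ.field) (C.pull f) G e = derivVF Y (derivVF (C.hor u) G) e
      - derivVF (C.hor u) (derivVF Y G) e - C.ΨV.br (hθ.eval u) G e := by
  obtain ⟨b, hb⟩ := exists_dAt_eq (θ e)
  have h0 : θ e - dAt (C.pr e) b = 0 := by rw [hb, sub_self]
  rw [hθ.defect_sub_field hb, (hθ.sub (C.smoothCov_dAt b)).dAt_derivVF_horFlat h0 hG,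
    (hθ.sub (C.smoothCov_dAt b)).dAt_derivVF_pull h0 hf]
  have h1 : (hθ.sub (C.smoothCov_dAt b)).eval u = hθ.eval u - C.pull (derivVF u b) := rfl
  have h2 : dAt e (C.pull (derivVF u b)) (C.Ψ.hamField G e) = 0 := hG.br_pull_right _
  have h3 : dAt e (hθ.eval u) (C.Ψ.hamField G e) = -C.ΨV.br (hθ.eval u) G e := by
    rw [BivectorField.br_skew_apply, hG.brV_left, neg_neg]; rfl
  rw [h1, map_sub, neg_apply, sub_apply, h2, h3]
  change derivVF Y (C.Ψ.br (C.pull f) G) e - C.Ψ.br (derivVF Y (C.pull f)) G e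
    - C.Ψ.br (C.pull f) (derivVF Y G) e - _ + (0 : ℝ) = _
  rw [hY.derivVF_pull, map_zero, hf.br_eq, derivVF_apply Y, ← hf.dAt_derivVF_hor hG,
    ← derivVF_apply Y]
  change _ - (0 : ℝ) - _ - _ + _ = _
  ring

-- The component of `L_Z Ψ` along the base, which is `-(∂θ + L_Y σ)`. Besides giving the last of the
-- three conditions, it shows that this expression is tensorial in `u` and `v`.
include hY in
lemma SmoothCov.defect_pull_pull {e : N} {f g : SmoothFn F S} {u v : SmoothVF 𝓘(ℝ, F) S}
    (hf : C.Represents e f u) (hg : C.Represents e g v) :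
    C.Ψ.defect (Y - hθ.field) (C.pull f) (C.pull g) e =
      -(hθ.ext u v e + derivVF Y (C.sig u v) e) := by
  obtain ⟨b, hb⟩ := exists_dAt_eq (θ e)
  have h0 : θ e - dAt (C.pr e) b = 0 := by rw [hb, sub_self]
  rw [hθ.defect_sub_field hb, (hθ.sub (C.smoothCov_dAt b)).dAt_derivVF_pull h0 hg,
    (hθ.sub (C.smoothCov_dAt b)).dAt_derivVF_pull h0 hf, hf.hamField_eq, hg.hamField_eq]
  have h1 (u) : (hθ.sub (C.smoothCov_dAt b)).eval u = hθ.eval u - C.pull (derivVF u b) := rfl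
  have h4 : hθ.eval (lieVF u v) e = derivVF (lieVF u v) b (C.pr e) := by
    rw [derivVF_apply, hb]; rfl
  have h2 : C.Ψ.defect Y (C.pull f) (C.pull g) e = -derivVF Y (C.sig u v) e := by
    change derivVF Y (C.Ψ.br (C.pull f) (C.pull g)) e - C.Ψ.br (derivVF Y (C.pull f)) (C.pull g) e
      - C.Ψ.br (C.pull f) (derivVF Y (C.pull g)) e = _
    rw [hY.derivVF_pull, hY.derivVF_pull, map_zero, map_zero, derivVF_apply Y, derivVF_apply Y,
      hf.dAt_sig_vertical hg (hY e)]
    change _ - (0 : ℝ) - (0 : ℝ) = _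
    ring
  rw [h2, h1, h1, neg_apply, neg_apply, ← derivVF_apply, ← derivVF_apply, map_sub, map_sub,
    derivVF_hor_pull, derivVF_hor_pull]
  change _ - -(derivVF (C.hor v) (hθ.eval u) e - derivVF v (derivVF u b) (C.pr e)) +
    -(derivVF (C.hor u) (hθ.eval v) e - derivVF u (derivVF v b) (C.pr e)) =
    -(derivVF (C.hor u) (hθ.eval v) e - derivVF (C.hor v) (hθ.eval u) e - hθ.eval (lieVF u v) e + _)
  rw [h4, derivVF_lieVF]
  change _ = -(_ - (derivVF u (derivVF v b) (C.pr e) - derivVF v (derivVF u b) (C.pr e)) + _)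
  ring

/-- The fibrewise component of `L_Z Ψ`: the horizontal field does not contribute, because its
derivatives of flat functions have zero differential. -/
lemma SmoothCov.defect_horFlat {e : N} {G K : SmoothFn E N} (hG : C.HorFlat e G)
    (hK : C.HorFlat e K) :
    C.Ψ.defect (Y - hθ.field) G K e = C.ΨV.defect Y G K e := by
  obtain ⟨b, hb⟩ := exists_dAt_eq (θ e)
  have h0 : θ e - dAt (C.pr e) b = 0 := by rw [hb, sub_self]
  rw [hθ.defect_sub_field hb, (hθ.sub (C.smoothCov_dAt b)).dAt_derivVF_horFlat h0 hG,
    (hθ.sub (C.smoothCov_dAt b)).dAt_derivVF_horFlat h0 hK]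
  change derivVF Y (C.Ψ.br G K) e - C.Ψ.br (derivVF Y G) K e - C.Ψ.br G (derivVF Y K) e - (0 : ℝ)
    + (0 : ℝ) = derivVF Y (C.ΨV.br G K) e - C.ΨV.br (derivVF Y G) K e - C.ΨV.br G (derivVF Y K) e
  rw [hG.brV_left, hK.brV_right, derivVF_apply Y, derivVF_apply Y, hG.dAt_brV hK]
  ring

include hY in
lemma IsVertical.defectV_pull (f : SmoothFn F S) (G : SmoothFn E N) :
    C.ΨV.defect Y (C.pull f) G = 0 := by
  simp [BivectorField.defect, brV_pull_left, hY.derivVF_pull]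

include hY in
/-- The vector field `Y - Ψ♯(pr^* θ)` with `Y` vertical is a Poisson vector field if and only if
`Y` is a Poisson vector field of the vertical part, `θ` is a potential of `Y` and
`∂θ + L_Y σ = 0`. -/
theorem SmoothCov.sub_field_mem_poiss_iff : Y - hθ.field ∈ C.Ψ.poiss ↔
    Y ∈ C.ΨV.poiss ∧
    (∀ u G, derivVF (C.hor u) (derivVF Y G) - derivVF Y (derivVF (C.hor u) G) =
      -C.ΨV.br (hθ.eval u) G) ∧
    ∀ u v, hθ.ext u v + derivVF Y (C.sig u v) = 0 := by
  constructor
  · intro h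
    rw [BivectorField.mem_poiss_iff] at h
    refine ⟨?_, fun u G => ?_, fun u v => ?_⟩
    · rw [BivectorField.mem_poiss_iff]
      intro G K
      ext e
      refine C.defectV_eq_zero_of_horFlat hY.defectV_pull e (fun G K hG hK => ?_) G K
      rw [← hθ.defect_horFlat hG hK, h]; rfl
    · rw [← sub_eq_zero]
      ext e
      refine C.eq_zero_of_pull_of_horFlat e (fun G => (derivVF (C.hor u) (derivVF Y G)
        - derivVF Y (derivVF (C.hor u) G) - -C.ΨV.br (hθ.eval u) G) e) (fun G G' => ?_)
        (fun f => ?_) (fun G hG => ?_) G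
      · simp only [map_add, neg_add]
        simp only [ContMDiffMap.coe_add, ContMDiffMap.coe_sub, Pi.add_apply, Pi.sub_apply]
        ring
      · simp only [hY.derivVF_pull, derivVF_hor_pull, brV_pull_right, map_zero]
        simp
      · obtain ⟨f, hf⟩ := C.exists_represents e u
        have := hθ.defect_pull_horFlat hY hf hG
        rw [h] at this
        change (0 : ℝ) = _ at this
        change derivVF (C.hor u) (derivVF Y G) e - derivVF Y (derivVF (C.hor u) G) e
          - -C.ΨV.br (hθ.eval u) G e = 0
        linarith
    · ext e
      obtain ⟨f, hf⟩ := C.exists_represents e u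
      obtain ⟨g, hg⟩ := C.exists_represents e v
      have := hθ.defect_pull_pull hY hf hg
      rw [h] at this
      change (0 : ℝ) = _ at this
      change hθ.ext u v e + derivVF Y (C.sig u v) e = 0
      linarith
  · rintro ⟨h1, h2, h3⟩
    rw [BivectorField.mem_poiss_iff] at h1 ⊢
    have hb (e : N) (f : SmoothFn F S) (G : SmoothFn E N) :
        C.Ψ.defect (Y - hθ.field) (C.pull f) G e = 0 := by
      -- The conditions concern vector fields on the base and the defect concerns functions. Here
      -- `f` is given, and `u` extends the base component of its Hamiltonian field at `e`.
      obtain ⟨u, hu⟩ := C.exists_represents' e f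
      refine C.eq_zero_of_pull_of_horFlat e
        (fun G => C.Ψ.defect (Y - hθ.field) (C.pull f) G e) (fun G G' => ?_)
        (fun g => ?_) (fun G hG => ?_) G
      · rw [BivectorField.defect_add_right]; rfl
      · obtain ⟨v, hv⟩ := C.exists_represents' e g
        rw [hθ.defect_pull_pull hY hu hv, neg_eq_zero]
        exact DFunLike.congr_fun (h3 u v) e
      · rw [hθ.defect_pull_horFlat hY hu hG]
        have : derivVF (C.hor u) (derivVF Y G) e - derivVF Y (derivVF (C.hor u) G) e =
          -C.ΨV.br (hθ.eval u) G e := DFunLike.congr_fun (h2 u G) e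
        linarith
    intro G K
    ext e
    refine C.eq_zero_of_pull_of_horFlat e (fun G => C.Ψ.defect (Y - hθ.field) G K e)
      (fun G G' => ?_) (fun f => hb e f K) (fun G hG => ?_) G
    · rw [BivectorField.defect_add_left]; rfl
    refine C.eq_zero_of_pull_of_horFlat e (fun K => C.Ψ.defect (Y - hθ.field) G K e)
      (fun G G' => ?_) (fun f => ?_) (fun K hK => ?_) K
    · rw [BivectorField.defect_add_right]; rfl
    · rw [BivectorField.defect_skew]
      exact neg_eq_zero.2 (hb e f G)
    · rw [hθ.defect_horFlat hG hK, h1]; rfl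

end Formulas

/-! #### The horizontal part of a vector field -/

/-- The 1-form `θ` such that `Z + Ψ♯(pr^* θ)` is vertical. -/
def covOfField (C : TransverseFibration E N F S) (Z : SmoothVF 𝓘(ℝ, E) N) (x : N) :
    TangentSpace 𝓘(ℝ, F) (C.pr x) →L[ℝ] ℝ := -(C.baseEquiv x).symm (C.dpr x (Z x))

lemma smoothCov_covOfField (C : TransverseFibration E N F S) (Z : SmoothVF 𝓘(ℝ, E) N) :
    C.SmoothCov (C.covOfField Z) := by
  intro v x₀
  obtain ⟨y, w, hyw⟩ := exists_dual_frames (E := F) (C.pr x₀)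
  have h : (fun x => C.covOfField Z x (v (C.pr x))) =ᶠ[𝓝 x₀] fun x =>
      ∑ i, derivVF Z (C.pull (y i)) x * C.invForm v (w i) x := by
    filter_upwards [C.contMDiff_pr.continuous.continuousAt.eventually hyw] with x hx
    rw [covOfField, neg_apply, baseEquiv_symm_skew, neg_neg, hx.2 (C.dpr x (Z x)), map_sum]
    refine Finset.sum_congr rfl fun i _ => ?_
    rw [map_smul, smul_eq_mul, derivVF_apply, dAt_pull]
    rfl
  refine ContMDiffAt.congr_of_eventuallyEq ?_ h
  exact ContMDiffAt.sum fun i _ =>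
    ((derivVF Z (C.pull (y i))).contMDiff x₀).mul (C.contMDiff_invForm v (w i) x₀)

lemma dpr_field {θ : ∀ x, TangentSpace 𝓘(ℝ, F) (C.pr x) →L[ℝ] ℝ} (hθ : C.SmoothCov θ) (x : N) :
    C.dpr x (hθ.field x) = C.baseEquiv x (θ x) := rfl

/-- The vertical part of a vector field. -/
def vertPart (C : TransverseFibration E N F S) (Z : SmoothVF 𝓘(ℝ, E) N) : SmoothVF 𝓘(ℝ, E) N :=
  Z + (C.smoothCov_covOfField Z).field

lemma isVertical_vertPart (Z : SmoothVF 𝓘(ℝ, E) N) : C.IsVertical (C.vertPart Z) := by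
  intro x
  change C.dpr x (Z x + (C.smoothCov_covOfField Z).field x) = 0
  rw [map_add, dpr_field, covOfField, map_neg, LinearEquiv.apply_symm_apply, add_neg_cancel]

lemma vertPart_sub_field (Z : SmoothVF 𝓘(ℝ, E) N) :
    C.vertPart Z - (C.smoothCov_covOfField Z).field = Z := add_sub_cancel_right _ _

end TransverseFibration

end Transverse

end SemilocalPoisson

namespace SemilocalPoisson

/-! ### Vector fields on the base, and forms of degree at most two. -/

section Transverse

variable {E : Type*} [NormedAddCommGroup E] [NormedSpace ℝ E] [FiniteDimensional ℝ E]
  {N : Type*} [TopologicalSpace N] [ChartedSpace E N] [IsManifold 𝓘(ℝ, E) ∞ N]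
  {F : Type*} [NormedAddCommGroup F] [NormedSpace ℝ F] [FiniteDimensional ℝ F]
  {S : Type*} [TopologicalSpace S] [ChartedSpace F S] [IsManifold 𝓘(ℝ, F) ∞ S] [T2Space S]

/-- Global functions realize every covector, so identities of vector fields can be checked as
identities of derivations. -/
lemma vectorField_ext {X Y : SmoothVF 𝓘(ℝ, F) S} (h : ∀ f, derivVF X f = derivVF Y f) : X = Y := by
  ext s
  refine eq_of_forall_covector fun a => ?_
  obtain ⟨f, rfl⟩ := exists_dAt_eq a
  exact DFunLike.congr_fun (h f) s

lemma lieVF_jacobi (u v w : SmoothVF 𝓘(ℝ, F) S) :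
    lieVF (lieVF u v) w - lieVF (lieVF u w) v + lieVF (lieVF v w) u = 0 := by
  refine vectorField_ext fun f => ?_
  rw [derivVF_add, derivVF_sub]
  simp only [derivVF_lieVF, map_sub]
  rw [show derivVF (0 : SmoothVF 𝓘(ℝ, F) S) f = 0 by ext x; simp [derivVF_apply]]
  abel

lemma lieVF_add_left (u u' v : SmoothVF 𝓘(ℝ, F) S) :
    lieVF (u + u') v = lieVF u v + lieVF u' v := by
  refine vectorField_ext fun f => ?_
  simp only [derivVF_add, derivVF_lieVF, map_add]
  abel

lemma lieVF_smul_left (c : ℝ) (u v : SmoothVF 𝓘(ℝ, F) S) :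
    lieVF (c • u) v = c • lieVF u v := by
  refine vectorField_ext fun f => ?_
  simp only [derivVF_smul, derivVF_lieVF, map_smul, smul_sub]

lemma lieVF_skew (u v : SmoothVF 𝓘(ℝ, F) S) : lieVF u v = -lieVF v u := by
  refine vectorField_ext fun f => ?_
  simp only [derivVF_neg, derivVF_lieVF]
  abel

/-- Linearity of the choice is what later turns a tensorial expression in vector fields into a
multilinear form on tangent vectors. -/
lemma exists_linear_extension (s : S) :
    ∃ X : TangentSpace 𝓘(ℝ, F) s →ₗ[ℝ] SmoothVF 𝓘(ℝ, F) S, ∀ v, X v s = v := by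
  obtain ⟨y, w, hyw⟩ := exists_dual_frames (E := F) s
  refine ⟨∑ i, (dAt s (y i)).toLinearMap.smulRight (w i), fun v => ?_⟩
  conv_rhs => rw [hyw.self_of_nhds.2 v]
  rw [LinearMap.sum_apply]
  exact map_sum (⟨⟨fun u : SmoothVF 𝓘(ℝ, F) S => u s, rfl⟩, fun _ _ => rfl⟩ :
    SmoothVF 𝓘(ℝ, F) S →+ TangentSpace 𝓘(ℝ, F) s) _ _

namespace TransverseFibration

variable (C : TransverseFibration E N F S)

/-! #### Forms of low degree -/

/-- The family of covectors given by a 1-form with values in functions. -/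
def covOf (β : RawForm 𝓘(ℝ, F) C.pr 1) (x : N) : TangentSpace 𝓘(ℝ, F) (C.pr x) →L[ℝ] ℝ :=
  LinearMap.toContinuousLinearMap (functionalOf (β x))

/-- The 1-form given by a family of covectors. -/
def formOf (θ : ∀ x, TangentSpace 𝓘(ℝ, F) (C.pr x) →L[ℝ] ℝ) : RawForm 𝓘(ℝ, F) C.pr 1 :=
  fun x => alternatingOne (θ x).toLinearMap

lemma evalForm_one (β : RawForm 𝓘(ℝ, F) C.pr 1) (u : Fin 1 → SmoothVF 𝓘(ℝ, F) S) (x : N) :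
    evalForm β u x = C.covOf β x (u 0 (C.pr x)) := by
  change β x _ = β x _
  congr 1
  funext i
  rw [Subsingleton.elim i 0]; rfl

lemma smoothCov_covOf {β : RawForm 𝓘(ℝ, F) C.pr 1}
    (hβ : β ∈ horForm 𝓘(ℝ, E) 𝓘(ℝ, F) C.pr 1) : C.SmoothCov (C.covOf β) := fun v =>
  (hβ ![v]).congr fun x => (C.evalForm_one β ![v] x).symm

lemma eval_covOf {β : RawForm 𝓘(ℝ, F) C.pr 1} (hβ : β ∈ horForm 𝓘(ℝ, E) 𝓘(ℝ, F) C.pr 1)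
    (u : Fin 1 → SmoothVF 𝓘(ℝ, F) S) :
    ((C.smoothCov_covOf hβ).eval (u 0) : N → ℝ) = evalForm β u :=
  funext fun x => (C.evalForm_one β u x).symm

variable {C} in
lemma SmoothCov.evalForm_formOf {θ : ∀ x, TangentSpace 𝓘(ℝ, F) (C.pr x) →L[ℝ] ℝ}
    (hθ : C.SmoothCov θ) (u : Fin 1 → SmoothVF 𝓘(ℝ, F) S) :
    evalForm (C.formOf θ) u = hθ.eval (u 0) := rfl

variable {C} in
lemma SmoothCov.formOf_mem {θ : ∀ x, TangentSpace 𝓘(ℝ, F) (C.pr x) →L[ℝ] ℝ}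
    (hθ : C.SmoothCov θ) : C.formOf θ ∈ horForm 𝓘(ℝ, E) 𝓘(ℝ, F) C.pr 1 := fun u => hθ (u 0)

variable {C} in
lemma SmoothCov.covD_formOf {θ : ∀ x, TangentSpace 𝓘(ℝ, F) (C.pr x) →L[ℝ] ℝ}
    (hθ : C.SmoothCov θ) (u : Fin 2 → SmoothVF 𝓘(ℝ, F) S) :
    C.conn.covD (C.formOf θ) u = hθ.ext (u 0) (u 1) := by
  funext x
  refine (congrArg₂ (· - ·) (Fin.sum_univ_two _) (Fin.sum_univ_one _)).trans ?_
  -- The inner index set `Finset.Ici 0` in `Fin 1` is a singleton.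
  refine (congrArg (fun t => _ - t) (Finset.sum_singleton _ (0 : Fin 1))).trans ?_
  simp only [Fin.val_zero, Fin.val_one, pow_zero, pow_one, one_mul, add_zero]
  change derivVF (C.hor (u 0)) (hθ.eval (u 1)) x + -1 * derivVF (C.hor (u 1)) (hθ.eval (u 0)) x
    - hθ.eval (lieVF (u 0) (u 1)) x = derivVF (C.hor (u 0)) (hθ.eval (u 1)) x
    - derivVF (C.hor (u 1)) (hθ.eval (u 0)) x - hθ.eval (lieVF (u 0) (u 1)) x
  ring

lemma formOf_covOf (β : RawForm 𝓘(ℝ, F) C.pr 1) : C.formOf (C.covOf β) = β := by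
  funext x
  refine AlternatingMap.ext fun m => ?_
  change β x ![m 0] = β x m
  congr 1
  funext i
  rw [Subsingleton.elim i 0]; rfl

/-- The function `τ(u, v)`. -/
def evalTwo {τ : RawForm 𝓘(ℝ, F) C.pr 2} (hτ : τ ∈ horForm 𝓘(ℝ, E) 𝓘(ℝ, F) C.pr 2)
    (u v : SmoothVF 𝓘(ℝ, F) S) : SmoothFn E N := ⟨_, hτ ![u, v]⟩

lemma covD_two {τ : RawForm 𝓘(ℝ, F) C.pr 2} (hτ : τ ∈ horForm 𝓘(ℝ, E) 𝓘(ℝ, F) C.pr 2)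
    (u : Fin 3 → SmoothVF 𝓘(ℝ, F) S) :
    C.conn.covD τ u = (derivVF (C.hor (u 0)) (C.evalTwo hτ (u 1) (u 2))
      - derivVF (C.hor (u 1)) (C.evalTwo hτ (u 0) (u 2))
      + derivVF (C.hor (u 2)) (C.evalTwo hτ (u 0) (u 1))
      - (C.evalTwo hτ (lieVF (u 0) (u 1)) (u 2) - C.evalTwo hτ (lieVF (u 0) (u 2)) (u 1)
        + C.evalTwo hτ (lieVF (u 1) (u 2)) (u 0)) : SmoothFn E N) := by
  funext x
  have hm (i : Fin 3) (a b : SmoothVF 𝓘(ℝ, F) S) (h : i.removeNth u = ![a, b]) :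
      lieD (C.conn.hor (u i)) (evalForm τ (i.removeNth u)) x =
        derivVF (C.hor (u i)) (C.evalTwo hτ a b) x := by rw [h]; rfl
  have hb (a b c : SmoothVF 𝓘(ℝ, F) S) (r : Fin 1 → SmoothVF 𝓘(ℝ, F) S) (hr : r 0 = c) :
      τ x (Matrix.vecCons (VectorField.mlieBracket 𝓘(ℝ, F) (fun s => a s) (fun s => b s) (C.pr x))
        (fun k => r k (C.pr x))) = C.evalTwo hτ (lieVF a b) c x := by
    subst hr
    change τ x _ = τ x _
    congr 1
    funext i
    fin_cases i <;> rfl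
  -- The index pairs of the double sum are `(0, 0)`, `(0, 1)`, `(1, 1)`; they encode the pairs of
  -- arguments `(0, 1)`, `(0, 2)`, `(1, 2)`, with signs `+`, `-`, `+`.
  refine (congrArg₂ (· - ·) (Fin.sum_univ_three _) ((Fin.sum_univ_two _).trans
    (congrArg₂ (· + ·) (Finset.sum_pair (a := (0 : Fin 2)) (b := 1) (by decide))
      (Finset.sum_singleton _ (1 : Fin 2))))).trans ?_
  rw [hm 0 (u 1) (u 2) (by funext i; fin_cases i <;> rfl),
    hm 1 (u 0) (u 2) (by funext i; fin_cases i <;> rfl),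
    hm 2 (u 0) (u 1) (by funext i; fin_cases i <;> rfl)]
  rw [hb _ _ (u 2) _ rfl, hb _ _ (u 1) _ rfl, hb _ _ (u 0) _ rfl]
  simp only [Fin.val_zero, Fin.val_one, Fin.val_two, pow_zero, pow_one, one_mul, add_zero, zero_add]
  change _ = derivVF (C.hor (u 0)) (C.evalTwo hτ (u 1) (u 2)) x
      - derivVF (C.hor (u 1)) (C.evalTwo hτ (u 0) (u 2)) x
      + derivVF (C.hor (u 2)) (C.evalTwo hτ (u 0) (u 1)) x
      - (C.evalTwo hτ (lieVF (u 0) (u 1)) (u 2) x - C.evalTwo hτ (lieVF (u 0) (u 2)) (u 1) x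
        + C.evalTwo hτ (lieVF (u 1) (u 2)) (u 0) x)
  change _ + _ + _ - (C.evalTwo hτ (lieVF (u 0) (u 1)) (u 2) x
    + -1 * C.evalTwo hτ (lieVF (u 0) (u 2)) (u 1) x
    + (-1) ^ 2 * C.evalTwo hτ (lieVF (u 1) (u 2)) (u 0) x) = _
  ring

lemma isCasimir_iff [T2Space N] (K : SmoothFn E N) : C.ΨV.IsCasimir K ↔ ∀ G, C.ΨV.br K G = 0 := by
  constructor
  · intro h G
    ext x
    rw [BivectorField.br_apply]
    exact (congrArg (dAt x G) (h.2 x)).trans (map_zero _)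
  · intro h
    refine ⟨K.contMDiff, fun x => eq_of_forall_covector fun a => ?_⟩
    obtain ⟨G, rfl⟩ := exists_dAt_eq a
    rw [map_zero]
    exact DFunLike.congr_fun (h G) x

end TransverseFibration

end Transverse

end SemilocalPoisson

namespace SemilocalPoisson

/-! ### The 2-form `∂θ + L_Y σ`: Casimir values, closedness, tensoriality. -/

section Transverse

variable {E : Type*} [NormedAddCommGroup E] [NormedSpace ℝ E] [FiniteDimensional ℝ E]
  {N : Type*} [TopologicalSpace N] [ChartedSpace E N] [IsManifold 𝓘(ℝ, E) ∞ N]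
  {F : Type*} [NormedAddCommGroup F] [NormedSpace ℝ F] [FiniteDimensional ℝ F]
  {S : Type*} [TopologicalSpace S] [ChartedSpace F S] [IsManifold 𝓘(ℝ, F) ∞ S] [T2Space S]

namespace TransverseFibration

variable {C : TransverseFibration E N F S}
  {θ : ∀ x, TangentSpace 𝓘(ℝ, F) (C.pr x) →L[ℝ] ℝ} (hθ : C.SmoothCov θ)
  {Y : SmoothVF 𝓘(ℝ, E) N}

/-- `θ` is a potential of `Y`. -/
def SmoothCov.IsPot (hθ : C.SmoothCov θ) (Y : SmoothVF 𝓘(ℝ, E) N) : Prop :=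
  ∀ u G, derivVF (C.hor u) (derivVF Y G) - derivVF Y (derivVF (C.hor u) G) =
    -C.ΨV.br (hθ.eval u) G

/-- The function `(∂θ + L_Y σ)(u, v)`. -/
def SmoothCov.tau (hθ : C.SmoothCov θ) (Y : SmoothVF 𝓘(ℝ, E) N) (u v : SmoothVF 𝓘(ℝ, F) S) :
    SmoothFn E N := hθ.ext u v + derivVF Y (C.sig u v)

/-- Each summand has a Hamiltonian derivation expressed by commutators of `Y` and lifts: `θ(w)`
gives `[Y, hor w]` and `σ(u, v)` gives `hor [u, v] - [hor u, hor v]`. Their total vanishes by the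
Jacobi identity for commutators. -/
lemma SmoothCov.tau_casimir (h : hθ.IsPot Y) (hY : Y ∈ C.ΨV.poiss) (u v : SmoothVF 𝓘(ℝ, F) S)
    (G : SmoothFn E N) : C.ΨV.br (hθ.tau Y u v) G = 0 := by
  have hD (w K) : C.ΨV.br (derivVF (C.hor w) K) = derivVF (C.hor w) ∘ₗ C.ΨV.br K
      - C.ΨV.br K ∘ₗ derivVF (C.hor w) := by
    ext1 G
    rw [LinearMap.sub_apply, LinearMap.comp_apply, LinearMap.comp_apply, derivVF_hor_brV,
      add_sub_cancel_right]
  have hYD (K) : C.ΨV.br (derivVF Y K) = derivVF Y ∘ₗ C.ΨV.br K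
      - C.ΨV.br K ∘ₗ derivVF Y := by
    ext1 G
    have := (C.ΨV.mem_poiss_iff Y).1 hY K G
    rw [BivectorField.defect, sub_sub, sub_eq_zero] at this
    rw [LinearMap.sub_apply, LinearMap.comp_apply, LinearMap.comp_apply, this, add_sub_cancel_right]
  have hP (w) : C.ΨV.br (hθ.eval w) =
      derivVF Y ∘ₗ derivVF (C.hor w) - derivVF (C.hor w) ∘ₗ derivVF Y := by
    ext1 G
    rw [LinearMap.sub_apply, LinearMap.comp_apply, LinearMap.comp_apply, ← neg_sub, h w G,
      neg_neg]
  have hS : C.ΨV.br (C.sig u v) = derivVF (C.hor (lieVF u v))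
      - derivVF (C.hor u) ∘ₗ derivVF (C.hor v) + derivVF (C.hor v) ∘ₗ derivVF (C.hor u) := by
    ext1 G
    have := C.derivVF_hor_comm u v G
    rw [LinearMap.add_apply, LinearMap.sub_apply, LinearMap.comp_apply, LinearMap.comp_apply]
    rw [eq_sub_iff_add_eq, ← eq_sub_iff_add_eq'] at this
    rw [this]; abel
  have key : C.ΨV.br (hθ.tau Y u v) = 0 := by
    rw [tau, ext, map_add, map_sub, map_sub, hD, hD, hYD, hP, hP, hP, hS]
    simp only [← Module.End.mul_eq_comp]
    simp only [mul_sub, sub_mul, mul_add, add_mul, mul_assoc]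
    abel
  rw [key]; rfl

/-- By the curvature identity `∂∂θ` consists of brackets of `σ` with `θ`. Since `∂σ = 0`, the form
`∂(L_Y σ)` consists of the commutators `[hor u, Y]` applied to `σ`, which the potential `θ` turns
into the same brackets with the opposite sign. -/
lemma SmoothCov.tau_closed (h : hθ.IsPot Y) (u v w : SmoothVF 𝓘(ℝ, F) S) :
    derivVF (C.hor u) (hθ.tau Y v w) - derivVF (C.hor v) (hθ.tau Y u w)
      + derivVF (C.hor w) (hθ.tau Y u v) - (hθ.tau Y (lieVF u v) w - hθ.tau Y (lieVF u w) v
        + hθ.tau Y (lieVF v w) u) = 0 := by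
  have hJ : hθ.eval (lieVF (lieVF u v) w) - hθ.eval (lieVF (lieVF u w) v)
      + hθ.eval (lieVF (lieVF v w) u) = 0 := by
    have : hθ.eval (lieVF (lieVF u v) w) - hθ.eval (lieVF (lieVF u w) v)
      + hθ.eval (lieVF (lieVF v w) u) = hθ.eval (lieVF (lieVF u v) w - lieVF (lieVF u w) v +
        lieVF (lieVF v w) u) := by
      ext x
      symm
      change θ x (_ - _ + _) = _
      rw [map_add, map_sub]; rfl
    rw [this, lieVF_jacobi]
    ext x
    exact map_zero (θ x)
  have hc (a b c) := C.derivVF_hor_comm a b (hθ.eval c)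
  have hp (a b c) := h a (C.sig b c)
  have hY := congrArg (derivVF Y) (C.sig_closed u v w)
  -- The closedness of `σ` is stated cyclically; this puts its arguments in the order used by the
  -- covariant derivative.
  have hlin (a b c) : C.sig (lieVF a b) c = - C.sig (lieVF b a) c := by
    ext x
    change C.sig _ _ x = -C.sig _ _ x
    rw [lieVF_skew, C.sig_apply, C.sig_apply]
    rw [show ((-lieVF b a : SmoothVF 𝓘(ℝ, F) S)) (C.pr x) = -(lieVF b a (C.pr x)) from rfl, map_neg]
    rfl
  rw [hlin w u v, C.sig_skew w u] at hY
  simp only [map_sub, map_add, map_neg, map_zero] at hY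
  have h1 := hc u v w
  have h2 := hc u w v
  have h3 := hc v w u
  have h4 := hp u v w
  have h5 := hp v u w
  have h6 := hp w u v
  rw [BivectorField.br_skew, neg_neg] at h4 h5 h6
  simp only [tau, ext, map_add, map_sub]
  generalize derivVF (C.hor (lieVF u v)) (hθ.eval w) = a1 at *
  linear_combination h1 - h2 + h3 + h4 - h5 + h6 + hY + hJ

variable (hY : C.IsVertical Y)
include hY

/-- At `e` the value is minus a defect evaluated on functions that represent `u` and `v`, and
representing depends only on the values of the fields at `C.pr e`. -/
lemma SmoothCov.tau_congr {e : N} {u u' v v' : SmoothVF 𝓘(ℝ, F) S} (hu : u (C.pr e) = u' (C.pr e))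
    (hv : v (C.pr e) = v' (C.pr e)) : hθ.tau Y u v e = hθ.tau Y u' v' e := by
  obtain ⟨f, hf⟩ := C.exists_represents e u
  obtain ⟨g, hg⟩ := C.exists_represents e v
  have h1 := hθ.defect_pull_pull hY hf hg
  have h2 := hθ.defect_pull_pull hY (u := u') (v := v') (hf.trans hu) (hg.trans hv)
  rw [h1] at h2
  exact neg_inj.1 h2

omit hY

lemma hor_add (u v : SmoothVF 𝓘(ℝ, F) S) : C.hor (u + v) = C.hor u + C.hor v := by
  ext x
  exact map_add (C.lift x) _ _

lemma hor_smul (c : ℝ) (u : SmoothVF 𝓘(ℝ, F) S) : C.hor (c • u) = c • C.hor u := by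
  ext x
  exact map_smul (C.lift x) _ _

lemma SmoothCov.eval_add (u v : SmoothVF 𝓘(ℝ, F) S) :
    hθ.eval (u + v) = hθ.eval u + hθ.eval v := by
  ext x
  exact map_add (θ x) _ _

lemma SmoothCov.eval_smul (c : ℝ) (u : SmoothVF 𝓘(ℝ, F) S) :
    hθ.eval (c • u) = c • hθ.eval u := by
  ext x
  exact map_smul (θ x) _ _

lemma sig_add_left (u u' v : SmoothVF 𝓘(ℝ, F) S) :
    C.sig (u + u') v = C.sig u v + C.sig u' v := by
  ext x
  change C.sig _ _ x = C.sig _ _ x + C.sig _ _ x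
  rw [sig_apply, sig_apply, sig_apply, ContMDiffSection.coe_add, Pi.add_apply, map_add, add_apply,
    neg_add]

lemma sig_smul_left (c : ℝ) (u v : SmoothVF 𝓘(ℝ, F) S) :
    C.sig (c • u) v = c • C.sig u v := by
  ext x
  change C.sig _ _ x = c * C.sig _ _ x
  rw [sig_apply, sig_apply, ContMDiffSection.coe_smul, Pi.smul_apply, map_smul, smul_apply,
    smul_eq_mul, mul_neg]

lemma SmoothCov.tau_skew (u v : SmoothVF 𝓘(ℝ, F) S) : hθ.tau Y u v = -hθ.tau Y v u := by
  have h : hθ.eval (-lieVF v u) = -hθ.eval (lieVF v u) := by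
    have := hθ.eval_smul (-1) (lieVF v u)
    simpa using this
  rw [tau, tau, ext, ext, C.sig_skew u v, lieVF_skew u v, h, map_neg]
  abel

lemma SmoothCov.tau_add_left (u u' v : SmoothVF 𝓘(ℝ, F) S) :
    hθ.tau Y (u + u') v = hθ.tau Y u v + hθ.tau Y u' v := by
  simp only [tau, ext, hor_add, derivVF_add, hθ.eval_add, map_add, lieVF_add_left, sig_add_left]
  abel

lemma SmoothCov.tau_smul_left (c : ℝ) (u v : SmoothVF 𝓘(ℝ, F) S) :
    hθ.tau Y (c • u) v = c • hθ.tau Y u v := by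
  simp only [tau, ext, hor_smul, derivVF_smul, hθ.eval_smul, map_smul, lieVF_smul_left,
    sig_smul_left, smul_add, smul_sub]

/-- The bilinear map underlying `∂θ + L_Y σ`. -/
def SmoothCov.tauBilin (hθ : C.SmoothCov θ) (Y : SmoothVF 𝓘(ℝ, E) N) (e : N) :
    SmoothVF 𝓘(ℝ, F) S →ₗ[ℝ] SmoothVF 𝓘(ℝ, F) S →ₗ[ℝ] ℝ :=
  LinearMap.mk₂ ℝ (fun u v => hθ.tau Y u v e)
    (fun u u' v => by rw [tau_add_left]; rfl)
    (fun c u v => by rw [tau_smul_left]; rfl)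
    (fun u v v' => by
      rw [tau_skew, tau_add_left, neg_add, ← tau_skew, ← tau_skew]; rfl)
    (fun c u v => by
      rw [tau_skew, tau_smul_left, ← smul_neg, ← tau_skew]; rfl)

include hY in
/-- The expression `∂θ + L_Y σ` is a 2-form. -/
lemma SmoothCov.exists_tauForm : ∃ τ : RawForm 𝓘(ℝ, F) C.pr 2, ∀ u : Fin 2 → SmoothVF 𝓘(ℝ, F) S,
    evalForm τ u = hθ.tau Y (u 0) (u 1) := by
  choose X hX using fun s : S => exists_linear_extension (F := F) s
  refine ⟨fun e => alternatingTwo ((hθ.tauBilin Y e).compl₁₂ (X (C.pr e)) (X (C.pr e)))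
    (fun v => ?_), fun u => funext fun e => ?_⟩
  · have := DFunLike.congr_fun (hθ.tau_skew (Y := Y) (X (C.pr e) v) (X (C.pr e) v)) e
    change hθ.tau Y _ _ e = -hθ.tau Y _ _ e at this
    change hθ.tau Y _ _ e = 0
    linarith
  · exact hθ.tau_congr hY (hX _ _) (hX _ _)

end TransverseFibration

end Transverse

end SemilocalPoisson

namespace SemilocalPoisson

/-! ### Existence of potentials. -/

section Transverse

variable {E : Type*} [NormedAddCommGroup E] [NormedSpace ℝ E] [FiniteDimensional ℝ E]
  {N : Type*} [TopologicalSpace N] [ChartedSpace E N] [IsManifold 𝓘(ℝ, E) ∞ N]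
  {F : Type*} [NormedAddCommGroup F] [NormedSpace ℝ F] [FiniteDimensional ℝ F]
  {S : Type*} [TopologicalSpace S] [ChartedSpace F S] [IsManifold 𝓘(ℝ, F) ∞ S] [T2Space S]

namespace TransverseFibration

variable {C : TransverseFibration E N F S} {Y : SmoothVF 𝓘(ℝ, E) N}

variable (C Y) in
/-- The commutator of the derivations `hor u` and `Y`. -/
def commHor (u : SmoothVF 𝓘(ℝ, F) S) (G : SmoothFn E N) : SmoothFn E N :=
  derivVF (C.hor u) (derivVF Y G) - derivVF Y (derivVF (C.hor u) G)

/-- Verticality of `Y` makes the commutator vanish on pullbacks. On flat functions both terms can be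
computed from any function representing `u` at `e`, so no derivative of `u` enters. -/
lemma commHor_congr (hY : C.IsVertical Y) {e : N} {u u' : SmoothVF 𝓘(ℝ, F) S}
    (h : u (C.pr e) = u' (C.pr e)) (G : SmoothFn E N) :
    C.commHor Y u G e = C.commHor Y u' G e := by
  rw [← sub_eq_zero]
  refine C.eq_zero_of_pull_of_horFlat e (fun G => C.commHor Y u G e - C.commHor Y u' G e)
    (fun G G' => ?_) (fun f => ?_) (fun G hG => ?_) G
  · simp only [commHor, map_add]
    simp only [ContMDiffMap.coe_add, ContMDiffMap.coe_sub, Pi.add_apply, Pi.sub_apply]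
    ring
  · simp only [commHor, hY.derivVF_pull, derivVF_hor_pull, map_zero]
    simp
  · obtain ⟨f, hf⟩ := C.exists_represents e u
    change derivVF (C.hor u) (derivVF Y G) e - derivVF Y (derivVF (C.hor u) G) e
      - (derivVF (C.hor u') (derivVF Y G) e - derivVF Y (derivVF (C.hor u') G) e) = 0
    rw [derivVF_hor_apply, derivVF_hor_apply, derivVF_apply Y, derivVF_apply Y,
      hf.dAt_derivVF_hor hG, Represents.dAt_derivVF_hor (u := u') (hf.trans h) hG, h, sub_self]

/-- The commutator as a linear map in the vector field on the base. -/
def commHorLin (C : TransverseFibration E N F S) (Y : SmoothVF 𝓘(ℝ, E) N) (G : SmoothFn E N)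
    (e : N) : SmoothVF 𝓘(ℝ, F) S →ₗ[ℝ] ℝ where
  toFun u := C.commHor Y u G e
  map_add' u v := by
    simp only [commHor, hor_add, derivVF_add, map_add]
    simp only [ContMDiffMap.coe_add, ContMDiffMap.coe_sub, Pi.add_apply, Pi.sub_apply]
    ring
  map_smul' c u := by
    simp only [commHor, hor_smul, derivVF_smul, map_smul]
    simp only [ContMDiffMap.coe_smul, ContMDiffMap.coe_sub, Pi.smul_apply, Pi.sub_apply,
      RingHom.id_apply, smul_eq_mul]
    ring

/-- If every `[hor u, Y]` is Hamiltonian then `Y` has a potential. -/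
theorem exists_isPot [SigmaCompactSpace S] (hY : C.IsVertical Y)
    (h : ∀ u, ∃ K : SmoothFn E N, ∀ G, C.commHor Y u G = C.ΨV.br K G) :
    ∃ θ, ∃ hθ : C.SmoothCov θ, hθ.IsPot Y := by
  classical
  choose K hK using h
  choose y w hyw using fun s : S => exists_dual_frames (E := F) s
  let U (s : S) : Set S :=
    interior {x | ∀ v : TangentSpace 𝓘(ℝ, F) x, v = ∑ i, dAt x (y s i) v • w s i x}
  obtain ⟨ρ, hρ⟩ := SmoothPartitionOfUnity.exists_isSubordinate 𝓘(ℝ, F) (isClosed_univ (X := S)) U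
    (fun s => isOpen_interior) (fun s _ => Set.mem_iUnion.2 ⟨s, mem_interior_iff_mem_nhds.2
      ((hyw s).mono fun x hx => hx.2)⟩)
  have hfr (s x) (hx : ρ s x ≠ 0) (v : TangentSpace 𝓘(ℝ, F) x) :
      v = ∑ i, dAt x (y s i) v • w s i x :=
    interior_subset (hρ s (subset_tsupport _ hx)) v
  -- The Hamiltonians `K (w s i)` of the frame fields are assembled with the partition of unity and
  -- the dual frames. The minus sign is the one in the definition of a potential.
  let T (t : Finset S) (x : N) : TangentSpace 𝓘(ℝ, F) (C.pr x) →L[ℝ] ℝ :=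
    -∑ s ∈ t, ∑ i, (ρ s (C.pr x) * K (w s i) x) • dAt (C.pr x) (y s i)
  let Q (t : Finset S) (v : SmoothVF 𝓘(ℝ, F) S) : SmoothFn E N :=
    -∑ s ∈ t, ∑ i, C.pull (ρ s * derivVF v (y s i)) * K (w s i)
  let θ (x : N) := T (ρ.finsupport (C.pr x)) x
  -- The finite index set of `θ` varies with the point; near `e` it may be replaced by a fixed one,
  -- which gives smoothness and allows differentiation.
  have hθT (e : N) : ∀ᶠ x in 𝓝 e, θ x = T (ρ.fintsupport (C.pr e)) x := by
    filter_upwards [C.contMDiff_pr.continuous.continuousAt.eventually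
      (ρ.eventually_finsupport_subset (C.pr e))] with x hx
    refine congrArg Neg.neg (Finset.sum_subset hx fun s _ hs => ?_)
    have : ρ s (C.pr x) = 0 := by
      simpa [SmoothPartitionOfUnity.mem_finsupport] using hs
    simp [this]
  have hTQ (t x v) : T t x (v (C.pr x)) = Q t v x := by
    simp only [T, Q, neg_apply, sum_apply, smul_apply, ContMDiffMap.coe_neg, Pi.neg_apply,
      SmoothFn.sum_apply, smul_eq_mul]
    refine congrArg Neg.neg (Finset.sum_congr rfl fun s _ => Finset.sum_congr rfl fun i _ => ?_)
    change _ = ρ s (C.pr x) * dAt (C.pr x) (y s i) (v (C.pr x)) * K (w s i) x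
    ring
  have hθQ (e : N) (v) : ∀ᶠ x in 𝓝 e, θ x (v (C.pr x)) = Q (ρ.fintsupport (C.pr e)) v x :=
    (hθT e).mono fun x hx => by rw [hx, hTQ]
  have hθ : C.SmoothCov θ := fun v e => ((Q _ v).contMDiff e).congr_of_eventuallyEq (hθQ e v)
  refine ⟨θ, hθ, fun v G => ?_⟩
  ext e
  set t := ρ.fintsupport (C.pr e)
  have h1 : dAt e (hθ.eval v) = dAt e (Q t v) := dAt_congr (hθQ e v)
  have h2 : -C.ΨV.br (hθ.eval v) G e = C.ΨV.br G (Q t v) e := by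
    rw [BivectorField.br_skew_apply, neg_neg, BivectorField.br_apply, h1, BivectorField.br_apply]
  have h3 : C.ΨV.br G (Q t v) e =
      ∑ s ∈ t, ∑ i, (ρ s (C.pr e) * dAt (C.pr e) (y s i) (v (C.pr e))) *
        C.commHorLin Y G e (w s i) := by
    -- The coefficients are pullbacks, hence Casimirs of `C.ΨV`, and pass through the bracket.
    simp only [Q, map_neg, map_sum, BivectorField.br_mul_right, brV_pull_right, mul_zero, add_zero]
    simp only [ContMDiffMap.coe_neg, Pi.neg_apply, SmoothFn.sum_apply, ← Finset.sum_neg_distrib]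
    refine Finset.sum_congr rfl fun s _ => Finset.sum_congr rfl fun i _ => ?_
    rw [BivectorField.br_skew, ← hK]
    change -((ρ s (C.pr e) * dAt (C.pr e) (y s i) (v (C.pr e))) *
      -C.commHor Y (w s i) G e) = _ * C.commHor Y (w s i) G e
    ring
  -- The combination of frame fields with coefficients frozen at `C.pr e` agrees with `v` only at
  -- this point, which is enough because the commutator is tensorial in the base field.
  have h4 : (∑ s ∈ t, ∑ i, (ρ s (C.pr e) * dAt (C.pr e) (y s i) (v (C.pr e))) • w s i :
      SmoothVF 𝓘(ℝ, F) S) (C.pr e) = v (C.pr e) := by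
    let ev : SmoothVF 𝓘(ℝ, F) S →+ TangentSpace 𝓘(ℝ, F) (C.pr e) :=
      ⟨⟨fun u => u (C.pr e), rfl⟩, fun _ _ => rfl⟩
    change ev _ = _
    simp only [map_sum]
    have : ∀ s ∈ t, ∑ i, ev ((ρ s (C.pr e) * dAt (C.pr e) (y s i) (v (C.pr e))) • w s i) =
        ρ s (C.pr e) • v (C.pr e) := by
      intro s _
      by_cases hs : ρ s (C.pr e) = 0
      · simp [hs]
      · conv_rhs => rw [hfr s _ hs (v (C.pr e)), Finset.smul_sum]
        refine Finset.sum_congr rfl fun i _ => ?_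
        rw [mul_smul]; rfl
    rw [Finset.sum_congr rfl this, ← Finset.sum_smul,
      ρ.sum_finsupport' _ (Set.mem_univ _) (ρ.finsupport_subset_fintsupport _), one_smul]
  change C.commHor Y v G e = -C.ΨV.br (hθ.eval v) G e
  rw [h2, h3, ← commHor_congr hY h4]
  change C.commHorLin Y G e _ = _
  simp only [map_sum, map_smul, smul_eq_mul]

end TransverseFibration

end Transverse

end SemilocalPoisson

namespace SemilocalPoisson

section Transverse

variable {E : Type*} [NormedAddCommGroup E] [NormedSpace ℝ E] [FiniteDimensional ℝ E]
  {N : Type*} [TopologicalSpace N] [ChartedSpace E N] [IsManifold 𝓘(ℝ, E) ∞ N] [T2Space N]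
  {F : Type*} [NormedAddCommGroup F] [NormedSpace ℝ F] [FiniteDimensional ℝ F]
  {S : Type*} [TopologicalSpace S] [ChartedSpace F S] [IsManifold 𝓘(ℝ, F) ∞ S] [T2Space S]

namespace TransverseFibration

variable (C : TransverseFibration E N F S)

open EhresmannConnection

lemma evalForm_two (τ : RawForm 𝓘(ℝ, F) C.pr 2) (u : Fin 2 → SmoothVF 𝓘(ℝ, F) S) :
    evalForm τ u = evalForm τ ![u 0, u 1] := by
  congr 1
  funext i
  fin_cases i <;> rfl

lemma derivVF_zero (G : SmoothFn E N) : derivVF (0 : SmoothVF 𝓘(ℝ, E) N) G = 0 := by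
  ext x
  exact map_zero (dAt x G)

/-! #### Potentials and the form `∂β + L_Y σ` -/

variable {C}

lemma isPotential_iff {Y : SmoothVF 𝓘(ℝ, E) N} {β : RawForm 𝓘(ℝ, F) C.pr 1}
    (hβ : β ∈ horForm 𝓘(ℝ, E) 𝓘(ℝ, F) C.pr 1) :
    C.conn.IsPotential C.ΨV Y β ↔ (C.smoothCov_covOf hβ).IsPot Y := by
  have key (u : SmoothVF 𝓘(ℝ, F) S) :
      (∀ e, VectorField.mlieBracket 𝓘(ℝ, E) (C.conn.hor u) (fun x => Y x) e =
        -C.ΨV.hamVF (evalForm β ![u]) e) ↔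
      lieVF (C.hor u) Y = -C.ΨV.hamField ((C.smoothCov_covOf hβ).eval u) := by
    have h1 : -C.ΨV.hamVF (evalForm β ![u]) =
        fun e => -C.ΨV.hamField ((C.smoothCov_covOf hβ).eval u) e := by
      rw [← C.eval_covOf hβ]; rfl
    constructor
    · intro h
      ext e
      exact (h e).trans (congrFun h1 e)
    · intro h e
      have := DFunLike.congr_fun h e
      exact this.trans (congrFun h1 e).symm
  constructor
  · rintro ⟨-, h⟩ u G
    rw [← derivVF_lieVF, (key u).1 (h u), derivVF_neg, BivectorField.br_eq]
  · refine fun h => ⟨hβ, fun u => (key u).2 (vectorField_ext fun G => ?_)⟩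
    rw [derivVF_neg, ← BivectorField.br_eq, ← h u, derivVF_lieVF]

lemma SmoothCov.isPotential_formOf_iff {θ : ∀ x, TangentSpace 𝓘(ℝ, F) (C.pr x) →L[ℝ] ℝ}
    (hθ : C.SmoothCov θ) {Y : SmoothVF 𝓘(ℝ, E) N} :
    C.conn.IsPotential C.ΨV Y (C.formOf θ) ↔ hθ.IsPot Y :=
  isPotential_iff hθ.formOf_mem

lemma mem_algA_iff {Y : SmoothVF 𝓘(ℝ, E) N} : Y ∈ C.conn.algA C.ΨV ↔
    Y ∈ C.ΨV.poiss ∧ C.IsVertical Y ∧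
      ∀ u, ∃ K : SmoothFn E N, ∀ G, C.commHor Y u G = C.ΨV.br K G := by
  refine and_congr Iff.rfl (and_congr Iff.rfl (forall_congr' fun u => ?_))
  have key (K : SmoothFn E N) :
      (∀ e, VectorField.mlieBracket 𝓘(ℝ, E) (C.conn.hor u) (fun x => Y x) e =
        C.ΨV.hamVF K e) ↔ ∀ G, C.commHor Y u G = C.ΨV.br K G := by
    constructor
    · intro h G
      have : lieVF (C.hor u) Y = C.ΨV.hamField K := by ext e; exact h e
      rw [commHor, ← derivVF_lieVF, this, BivectorField.br_eq]
    · intro h e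
      have : lieVF (C.hor u) Y = C.ΨV.hamField K := vectorField_ext fun G => by
        rw [derivVF_lieVF, ← BivectorField.br_eq, ← h]; rfl
      exact DFunLike.congr_fun this e
  constructor
  · rintro ⟨K, hK, h⟩
    exact ⟨⟨K, hK⟩, (key ⟨K, hK⟩).1 h⟩
  · rintro ⟨K, h⟩
    exact ⟨K, K.contMDiff, (key K).2 h⟩

lemma SmoothCov.isTau_formOf_iff {θ : ∀ x, TangentSpace 𝓘(ℝ, F) (C.pr x) →L[ℝ] ℝ}
    (hθ : C.SmoothCov θ) {Y : SmoothVF 𝓘(ℝ, E) N} {τ : RawForm 𝓘(ℝ, F) C.pr 2} :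
    C.conn.IsTau C.sigma Y (C.formOf θ) τ ↔
      ∀ u : Fin 2 → SmoothVF 𝓘(ℝ, F) S, evalForm τ u = hθ.tau Y (u 0) (u 1) := by
  refine forall_congr' fun u => ?_
  rw [hθ.covD_formOf, C.evalForm_two C.sigma]
  rfl

lemma SmoothCov.mem_cocycles_two {θ : ∀ x, TangentSpace 𝓘(ℝ, F) (C.pr x) →L[ℝ] ℝ}
    (hθ : C.SmoothCov θ) {Y : SmoothVF 𝓘(ℝ, E) N} (h : hθ.IsPot Y)
    {τ : RawForm 𝓘(ℝ, F) C.pr 2} (hτ : τ ∈ casForm 𝓘(ℝ, F) C.ΨV C.pr 2)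
    (e : ∀ u : Fin 2 → SmoothVF 𝓘(ℝ, F) S, evalForm τ u = hθ.tau Y (u 0) (u 1)) :
    τ ∈ C.conn.cocycles C.ΨV 2 := by
  refine ⟨hτ, fun u => ?_⟩
  have h' := casForm_le_horForm C.ΨV 2 hτ
  have he (a b : SmoothVF 𝓘(ℝ, F) S) : C.evalTwo h' a b = hθ.tau Y a b := by
    ext x
    exact congrFun (e ![a, b]) x
  rw [C.covD_two h']
  simp only [he]
  rw [hθ.tau_closed h]
  rfl

lemma SmoothCov.exists_cocycle {θ : ∀ x, TangentSpace 𝓘(ℝ, F) (C.pr x) →L[ℝ] ℝ}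
    (hθ : C.SmoothCov θ) {Y : SmoothVF 𝓘(ℝ, E) N} (h : hθ.IsPot Y) (hY : Y ∈ C.ΨV.poiss)
    (hv : C.IsVertical Y) : ∃ τ ∈ C.conn.cocycles C.ΨV 2,
      C.conn.IsTau C.sigma Y (C.formOf θ) τ := by
  obtain ⟨τ, e⟩ := hθ.exists_tauForm hv
  refine ⟨τ, hθ.mem_cocycles_two h (fun u => ?_) e, hθ.isTau_formOf_iff.2 e⟩
  rw [e, isCasimir_iff]
  exact hθ.tau_casimir h hY _ _

lemma isPot_zero_iff {θ : ∀ x, TangentSpace 𝓘(ℝ, F) (C.pr x) →L[ℝ] ℝ} (hθ : C.SmoothCov θ) :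
    hθ.IsPot 0 ↔ ∀ u, C.ΨV.IsCasimir (hθ.eval u) := by
  simp only [SmoothCov.IsPot, derivVF_zero, map_zero, sub_zero, isCasimir_iff]
  simp [eq_comm]

lemma SmoothCov.tau_zero {θ : ∀ x, TangentSpace 𝓘(ℝ, F) (C.pr x) →L[ℝ] ℝ} (hθ : C.SmoothCov θ)
    (u v : SmoothVF 𝓘(ℝ, F) S) : hθ.tau 0 u v = hθ.ext u v := by
  rw [tau, derivVF_zero, add_zero]

lemma SmoothCov.mem_casForm_iff {θ : ∀ x, TangentSpace 𝓘(ℝ, F) (C.pr x) →L[ℝ] ℝ}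
    (hθ : C.SmoothCov θ) : C.formOf θ ∈ casForm 𝓘(ℝ, F) C.ΨV C.pr 1 ↔ hθ.IsPot 0 := by
  rw [isPot_zero_iff]
  exact ⟨fun h u => h ![u], fun h u => h (u 0)⟩

lemma SmoothCov.mem_cocycles_iff {θ : ∀ x, TangentSpace 𝓘(ℝ, F) (C.pr x) →L[ℝ] ℝ}
    (hθ : C.SmoothCov θ) : C.formOf θ ∈ C.conn.cocycles C.ΨV 1 ↔
      hθ.IsPot 0 ∧ ∀ u v, hθ.ext u v = 0 := by
  refine and_congr hθ.mem_casForm_iff ?_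
  constructor
  · intro h u v
    ext x
    have := congrFun (h ![u, v]) x
    rw [hθ.covD_formOf] at this
    exact this
  · intro h u
    rw [hθ.covD_formOf, h]
    rfl

lemma SmoothCov.mem_coboundaries_iff {θ : ∀ x, TangentSpace 𝓘(ℝ, F) (C.pr x) →L[ℝ] ℝ}
    (hθ : C.SmoothCov θ) : C.formOf θ ∈ C.conn.coboundaries C.ΨV 1 ↔
      hθ.IsPot 0 ∧ ∃ K : SmoothFn E N, (∀ G, C.ΨV.br K G = 0) ∧
        ∀ u, hθ.eval u = derivVF (C.hor u) K := by
  refine and_congr hθ.mem_casForm_iff ?_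
  constructor
  · rintro ⟨η, hη, e⟩
    refine ⟨⟨_, (hη Fin.elim0).1⟩, (C.isCasimir_iff ⟨_, (hη Fin.elim0).1⟩).1 (hη Fin.elim0),
      fun u => ?_⟩
    ext x
    exact congrFun (e ![u]) x
  · rintro ⟨K, hK, e⟩
    refine ⟨fun x => AlternatingMap.constOfIsEmpty ℝ _ (Fin 0) (K x), fun _ =>
      (C.isCasimir_iff K).2 hK, fun u => ?_⟩
    rw [hθ.evalForm_formOf, e]
    rfl

variable (C)

/-- By the curvature identity `∂∂K` is a bracket of `K` with `σ`, and `K` is a Casimir. -/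
lemma coboundaries_one_le : C.conn.coboundaries C.ΨV 1 ≤ C.conn.cocycles C.ΨV 1 := by
  intro β h
  have hθ := C.smoothCov_covOf (casForm_le_horForm C.ΨV 1 h.1)
  rw [← C.formOf_covOf β] at h ⊢
  rw [hθ.mem_coboundaries_iff] at h
  obtain ⟨h0, K, hK, e⟩ := h
  refine hθ.mem_cocycles_iff.2 ⟨h0, fun u v => ?_⟩
  have := C.derivVF_hor_comm u v K
  rw [SmoothCov.ext, e, e, e, this, BivectorField.br_skew, hK]
  simp

/-- A Casimir-valued 1-form is a potential of the zero field, so this is the closedness of `∂θ + L_Y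
σ` for `Y = 0`. -/
lemma coboundaries_two_le : C.conn.coboundaries C.ΨV 2 ≤ C.conn.cocycles C.ΨV 2 := by
  rintro τ ⟨hτ, β, hβ, e⟩
  have hθ := C.smoothCov_covOf (casForm_le_horForm C.ΨV 1 hβ)
  rw [← C.formOf_covOf β] at hβ e
  refine hθ.mem_cocycles_two (hθ.mem_casForm_iff.1 hβ) hτ fun u => ?_
  rw [e, hθ.covD_formOf, hθ.tau_zero]

/-- Two representatives of `ρ(Y)` are cohomologous. -/
lemma isTau_sub_mem {Y : SmoothVF 𝓘(ℝ, E) N} {β β' : RawForm 𝓘(ℝ, F) C.pr 1}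
    {τ τ' : RawForm 𝓘(ℝ, F) C.pr 2} (hβ : C.conn.IsPotential C.ΨV Y β)
    (hβ' : C.conn.IsPotential C.ΨV Y β') (hτ : C.conn.IsTau C.sigma Y β τ)
    (hτ' : C.conn.IsTau C.sigma Y β' τ') (h : τ ∈ casForm 𝓘(ℝ, F) C.ΨV C.pr 2)
    (h' : τ' ∈ casForm 𝓘(ℝ, F) C.ΨV C.pr 2) : τ - τ' ∈ C.conn.coboundaries C.ΨV 2 := by
  -- Two potentials of the same field differ by a Casimir-valued form, and the terms `L_Y σ` cancel.
  refine ⟨sub_mem h h', β - β', fun u => ?_, fun u => ?_⟩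
  · have h1 := (isPotential_iff hβ.1).1 hβ
    have h2 := (isPotential_iff hβ'.1).1 hβ'
    have h3 : evalForm (β - β') u = ((C.smoothCov_covOf hβ.1).eval (u 0) -
        (C.smoothCov_covOf hβ'.1).eval (u 0) : SmoothFn E N) := by
      rw [ContMDiffMap.coe_sub, C.eval_covOf hβ.1, C.eval_covOf hβ'.1]; rfl
    rw [h3, isCasimir_iff]
    intro G
    rw [map_sub, LinearMap.sub_apply, sub_eq_zero, ← neg_inj, ← h1, ← h2]
  · have h1 := hτ u
    have h2 := hτ' u
    have h3 : evalForm (τ - τ') u = evalForm τ u - evalForm τ' u := rfl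
    have h4 : β - β' = β + (-1 : ℝ) • β' := by rw [neg_one_smul, sub_eq_add_neg]
    rw [h3, h1, h2, h4, covD_add _ hβ.1 (Submodule.smul_mem _ _ hβ'.1), covD_smul _ _ hβ'.1]
    simp [sub_eq_add_neg]

lemma isPotential_add {Y Y' : SmoothVF 𝓘(ℝ, E) N} {β β' : RawForm 𝓘(ℝ, F) C.pr 1}
    (hβ : C.conn.IsPotential C.ΨV Y β) (hβ' : C.conn.IsPotential C.ΨV Y' β') :
    C.conn.IsPotential C.ΨV (Y + Y') (β + β') := by
  rw [isPotential_iff (add_mem hβ.1 hβ'.1)]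
  intro u G
  have h1 := (isPotential_iff hβ.1).1 hβ u G
  have h2 := (isPotential_iff hβ'.1).1 hβ' u G
  have h3 : (C.smoothCov_covOf (add_mem hβ.1 hβ'.1)).eval u = (C.smoothCov_covOf hβ.1).eval u
    + (C.smoothCov_covOf hβ'.1).eval u := by ext x; rfl
  rw [h3, derivVF_add, derivVF_add, map_add, map_add, LinearMap.add_apply, neg_add, ← h1, ← h2]
  abel

lemma isPotential_smul (c : ℝ) {Y : SmoothVF 𝓘(ℝ, E) N} {β : RawForm 𝓘(ℝ, F) C.pr 1}
    (hβ : C.conn.IsPotential C.ΨV Y β) : C.conn.IsPotential C.ΨV (c • Y) (c • β) := by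
  rw [isPotential_iff (Submodule.smul_mem _ c hβ.1)]
  intro u G
  have h1 := (isPotential_iff hβ.1).1 hβ u G
  have h3 : (C.smoothCov_covOf (Submodule.smul_mem _ c hβ.1)).eval u =
    c • (C.smoothCov_covOf hβ.1).eval u := by ext x; rfl
  rw [h3, derivVF_smul, derivVF_smul, map_smul, map_smul, LinearMap.smul_apply, ← smul_neg, ← h1,
    smul_sub]

lemma isTau_add {Y Y' : SmoothVF 𝓘(ℝ, E) N} {β β' : RawForm 𝓘(ℝ, F) C.pr 1}
    {τ τ' : RawForm 𝓘(ℝ, F) C.pr 2} (hβ : C.conn.IsPotential C.ΨV Y β)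
    (hβ' : C.conn.IsPotential C.ΨV Y' β') (hτ : C.conn.IsTau C.sigma Y β τ)
    (hτ' : C.conn.IsTau C.sigma Y' β' τ') :
    C.conn.IsTau C.sigma (Y + Y') (β + β') (τ + τ') := by
  intro u
  have h1 : lieD (fun x => (Y + Y') x) (evalForm C.sigma u) =
      lieD (fun x => Y x) (evalForm C.sigma u) + lieD (fun x => Y' x) (evalForm C.sigma u) := by
    funext x; simp [lieD]
  rw [evalForm_add, hτ u, hτ' u, covD_add _ hβ.1 hβ'.1, h1]
  abel

lemma isTau_smul (c : ℝ) {Y : SmoothVF 𝓘(ℝ, E) N} {β : RawForm 𝓘(ℝ, F) C.pr 1}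
    {τ : RawForm 𝓘(ℝ, F) C.pr 2} (hβ : C.conn.IsPotential C.ΨV Y β)
    (hτ : C.conn.IsTau C.sigma Y β τ) : C.conn.IsTau C.sigma (c • Y) (c • β) (c • τ) := by
  intro u
  have h1 : lieD (fun x => (c • Y) x) (evalForm C.sigma u) =
      c • lieD (fun x => Y x) (evalForm C.sigma u) := by
    funext x; simp [lieD]
  rw [evalForm_smul, hτ u, covD_smul _ _ hβ.1, h1, smul_add]

/-- Every potential of `Y ∈ A` gives a cocycle. -/
lemma exists_isTau {Y : SmoothVF 𝓘(ℝ, E) N} (hY : Y ∈ C.conn.algA C.ΨV)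
    {β : RawForm 𝓘(ℝ, F) C.pr 1} (hβ : C.conn.IsPotential C.ΨV Y β) :
    ∃ τ : C.conn.cocycles C.ΨV 2, C.conn.IsTau C.sigma Y β τ := by
  obtain ⟨h1, h2, -⟩ := mem_algA_iff.1 hY
  obtain ⟨τ, hτ, h⟩ := (C.smoothCov_covOf hβ.1).exists_cocycle ((isPotential_iff hβ.1).1 hβ) h1 h2
  rw [C.formOf_covOf] at h
  exact ⟨⟨τ, hτ⟩, h⟩

/-- The potentials are chosen without regard to linearity. Sums and multiples of potentials are
again potentials, and the class does not depend on the potential, so the resulting map is linear all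
the same. -/
theorem exists_isRho [SigmaCompactSpace S] :
    ∃ ρ : C.conn.algA C.ΨV →ₗ[ℝ] C.conn.cohomology C.ΨV 2, C.conn.IsRho C.ΨV C.sigma ρ := by
  have hex (Y : C.conn.algA C.ΨV) : ∃ β, C.conn.IsPotential C.ΨV Y β := by
    obtain ⟨h1, h2, h3⟩ := mem_algA_iff.1 Y.2
    obtain ⟨θ, hθ, h⟩ := exists_isPot h2 h3
    exact ⟨_, hθ.isPotential_formOf_iff.2 h⟩
  choose β hβ using hex
  choose τ hτ using fun Y => C.exists_isTau Y.2 (hβ Y)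
  have huniq (Y : C.conn.algA C.ΨV) {β' : RawForm 𝓘(ℝ, F) C.pr 1} {τ' : C.conn.cocycles C.ΨV 2}
      (hβ' : C.conn.IsPotential C.ΨV Y β') (hτ' : C.conn.IsTau C.sigma Y β' τ') :
      (Submodule.Quotient.mk (τ Y) : C.conn.cohomology C.ΨV 2) = Submodule.Quotient.mk τ' :=
    (Submodule.Quotient.eq _).2
      (C.isTau_sub_mem (hβ Y) hβ' (hτ Y) hτ' (τ Y).2.1 τ'.2.1)
  refine ⟨⟨⟨fun Y => Submodule.Quotient.mk (τ Y), fun Y Y' => ?_⟩, fun c Y => ?_⟩,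
    fun Y => ⟨⟨_, hβ Y⟩, fun β' hβ' => ?_⟩⟩
  · exact huniq (Y + Y') (τ' := τ Y + τ Y') (C.isPotential_add (hβ Y) (hβ Y'))
      (C.isTau_add (hβ Y) (hβ Y') (hτ Y) (hτ Y'))
  · exact huniq (c • Y) (τ' := c • τ Y) (C.isPotential_smul c (hβ Y))
      (C.isTau_smul c (hβ Y) (hτ Y))
  · obtain ⟨τ', hτ'⟩ := C.exists_isTau Y.2 hβ'
    exact ⟨τ', hτ', huniq Y hβ' hτ'⟩

end TransverseFibration

end Transverse

end SemilocalPoisson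

namespace SemilocalPoisson

/-- Over a field every linear surjection has a linear section. -/
lemma nonempty_equiv_prod_of_exact {U V W : Type*} [AddCommGroup U] [Module ℝ U] [AddCommGroup V]
    [Module ℝ V] [AddCommGroup W] [Module ℝ W] {j : U →ₗ[ℝ] V} {q : V →ₗ[ℝ] W}
    (hex : Function.Exact j q) (hj : Function.Injective j) (hq : Function.Surjective q) :
    Nonempty (V ≃ₗ[ℝ] (U × W)) := by
  obtain ⟨l, hl⟩ := q.exists_rightInverse_of_surjective (LinearMap.range_eq_top.2 hq)
  exact ⟨(hex.splitSurjectiveEquiv hj ⟨l, hl⟩).1⟩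

/-! ### The exact sequence for the first Poisson cohomology. -/

section Transverse

variable {E : Type*} [NormedAddCommGroup E] [NormedSpace ℝ E] [FiniteDimensional ℝ E]
  {N : Type*} [TopologicalSpace N] [ChartedSpace E N] [IsManifold 𝓘(ℝ, E) ∞ N] [T2Space N]
  {F : Type*} [NormedAddCommGroup F] [NormedSpace ℝ F] [FiniteDimensional ℝ F]
  {S : Type*} [TopologicalSpace S] [ChartedSpace F S] [IsManifold 𝓘(ℝ, F) ∞ S] [T2Space S]

namespace TransverseFibration

variable {C : TransverseFibration E N F S}

open EhresmannConnection

/-- The vertical part of vector fields as a linear map. -/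
def vertPartLin (C : TransverseFibration E N F S) :
    SmoothVF 𝓘(ℝ, E) N →ₗ[ℝ] SmoothVF 𝓘(ℝ, E) N where
  toFun := C.vertPart
  map_add' Z W := by
    ext x
    let L : TangentSpace 𝓘(ℝ, E) x →ₗ[ℝ] TangentSpace 𝓘(ℝ, E) x := LinearMap.id -
      C.Ψ.sharp x ∘ₗ C.pullCov x ∘ₗ (C.baseEquiv x).symm.toLinearMap ∘ₗ (C.dpr x).toLinearMap
    have h (Z : SmoothVF 𝓘(ℝ, E) N) : C.vertPart Z x = L (Z x) := by
      change Z x + C.Ψ.sharp x (C.pullCov x (-_)) = Z x - _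
      rw [map_neg, map_neg, sub_eq_add_neg]; rfl
    change C.vertPart _ x = C.vertPart _ x + C.vertPart _ x
    rw [h, h, h]
    exact map_add L _ _
  map_smul' c Z := by
    ext x
    let L : TangentSpace 𝓘(ℝ, E) x →ₗ[ℝ] TangentSpace 𝓘(ℝ, E) x := LinearMap.id -
      C.Ψ.sharp x ∘ₗ C.pullCov x ∘ₗ (C.baseEquiv x).symm.toLinearMap ∘ₗ (C.dpr x).toLinearMap
    have h (Z : SmoothVF 𝓘(ℝ, E) N) : C.vertPart Z x = L (Z x) := by
      change Z x + C.Ψ.sharp x (C.pullCov x (-_)) = Z x - _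
      rw [map_neg, map_neg, sub_eq_add_neg]; rfl
    change C.vertPart _ x = c • C.vertPart _ x
    rw [h, h]
    exact map_smul L _ _

lemma IsVertical.vertPart_sub_field {Y : SmoothVF 𝓘(ℝ, E) N} (hY : C.IsVertical Y)
    {θ : ∀ x, TangentSpace 𝓘(ℝ, F) (C.pr x) →L[ℝ] ℝ} (hθ : C.SmoothCov θ) :
    C.vertPart (Y - hθ.field) = Y := by
  ext x
  have h : C.covOfField (Y - hθ.field) x = θ x := by
    rw [covOfField]
    change -(C.baseEquiv x).symm (C.dpr x (Y x - hθ.field x)) = _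
    rw [map_sub, hY, dpr_field, zero_sub, map_neg, neg_neg, LinearEquiv.symm_apply_apply]
  change Y x - hθ.field x + C.Ψ.sharp x (C.pullCov x (C.covOfField (Y - hθ.field) x)) = Y x
  rw [h, ← hθ.field_apply, sub_add_cancel]

lemma field_injective {θ θ' : ∀ x, TangentSpace 𝓘(ℝ, F) (C.pr x) →L[ℝ] ℝ} {hθ : C.SmoothCov θ}
    {hθ' : C.SmoothCov θ'} (h : hθ.field = hθ'.field) : θ = θ' := by
  funext x
  have := congrArg (C.dpr x) (DFunLike.congr_fun h x)
  rw [dpr_field, dpr_field] at this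
  exact (C.baseEquiv x).injective this

lemma isVertical_hamField_ΨV (K : SmoothFn E N) : C.IsVertical (C.ΨV.hamField K) :=
  fun x => C.dpr_sharpV x _

lemma smoothCov_horCov (C : TransverseFibration E N F S) (K : SmoothFn E N) :
    C.SmoothCov (fun x => -C.horCov x (dAt x K)) := fun v => (derivVF (C.hor v) K).contMDiff.neg

/-- In the decomposition `Y - Ψ♯(pr^* θ)` the field of `K` has `θ = -∂K`. In particular, taking
vertical parts sends Hamiltonian fields of `Ψ` to those of `ΨV`, with the same Hamiltonian. -/
lemma hamField_eq_sub (K : SmoothFn E N) :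
    C.Ψ.hamField K = C.ΨV.hamField K - (C.smoothCov_horCov K).field := by
  ext x
  change C.Ψ.sharp x (dAt x K) = (C.Ψ.sharp x (dAt x K) - C.sharpH x (dAt x K)) -
    C.Ψ.sharp x (C.pullCov x (-C.horCov x (dAt x K)))
  rw [map_neg, map_neg, sub_neg_eq_add]
  exact (sub_add_cancel _ _).symm

lemma vertPart_hamField (K : SmoothFn E N) : C.vertPart (C.Ψ.hamField K) = C.ΨV.hamField K := by
  rw [hamField_eq_sub]
  exact (isVertical_hamField_ΨV K).vertPart_sub_field _

/-- The kernel of `ρ` consists of the vertical parts of the Poisson vector fields. -/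
lemma mem_map_ker_iff {ρ : C.conn.algA C.ΨV →ₗ[ℝ] C.conn.cohomology C.ΨV 2}
    (hρ : C.conn.IsRho C.ΨV C.sigma ρ) {Y : SmoothVF 𝓘(ℝ, E) N} :
    Y ∈ (LinearMap.ker ρ).map (C.conn.algA C.ΨV).subtype ↔
      C.IsVertical Y ∧ ∃ θ, ∃ hθ : C.SmoothCov θ, Y - hθ.field ∈ C.Ψ.poiss := by
  constructor
  · rintro ⟨Y, hY, rfl⟩
    obtain ⟨⟨β, hβ⟩, h⟩ := hρ Y
    obtain ⟨τ, hτ, hY'⟩ := h β hβ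
    rw [SetLike.mem_coe, LinearMap.mem_ker, hY', Submodule.Quotient.mk_eq_zero] at hY
    obtain ⟨-, η, hη, e⟩ := hY
    obtain ⟨h1, h2, -⟩ := mem_algA_iff.1 Y.2
    have hη' := casForm_le_horForm C.ΨV 1 hη
    -- If `∂β + L_Y σ = ∂η` with `η` Casimir-valued, then `β - η` is still a potential of `Y` and
    -- satisfies the equation exactly.
    let hθ := (C.smoothCov_covOf hβ.1).sub (C.smoothCov_covOf hη')
    have hp := (isPotential_iff hβ.1).1 hβ
    have hq : (C.smoothCov_covOf hη').IsPot 0 := by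
      rw [← SmoothCov.mem_casForm_iff, C.formOf_covOf]; exact hη
    refine ⟨h2, _, hθ, (hθ.sub_field_mem_poiss_iff h2).2 ⟨h1, fun u G => ?_, fun u v => ?_⟩⟩
    · have h3 : hθ.eval u = (C.smoothCov_covOf hβ.1).eval u - (C.smoothCov_covOf hη').eval u := rfl
      have h4 := hp u G
      have h5 := hq u G
      simp only [derivVF_zero, map_zero, sub_zero] at h5
      rw [h3, map_sub, LinearMap.sub_apply, neg_sub, h4, neg_eq_zero.1 h5.symm, zero_sub]
    · rw [← C.formOf_covOf β, (C.smoothCov_covOf hβ.1).isTau_formOf_iff] at hτ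
      have h6 : (C.smoothCov_covOf hβ.1).tau Y u v = (C.smoothCov_covOf hη').ext u v := by
        ext x
        refine (congrFun (hτ ![u, v]) x).symm.trans ((congrFun (e ![u, v]) x).trans ?_)
        have := (C.smoothCov_covOf hη').covD_formOf ![u, v]
        rw [C.formOf_covOf] at this
        exact congrFun this x
      have h7 : hθ.ext u v =
          (C.smoothCov_covOf hβ.1).ext u v - (C.smoothCov_covOf hη').ext u v := by
        have h3 (u) : hθ.eval u =
          (C.smoothCov_covOf hβ.1).eval u - (C.smoothCov_covOf hη').eval u := rfl
        simp only [SmoothCov.ext, h3, map_sub]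
        abel
      rw [h7, ← h6, SmoothCov.tau]
      abel
  · rintro ⟨hv, θ, hθ, h⟩
    obtain ⟨h1, h2, h3⟩ := (hθ.sub_field_mem_poiss_iff hv).1 h
    have hA : Y ∈ C.conn.algA C.ΨV := by
      refine mem_algA_iff.2 ⟨h1, hv, fun u => ⟨-hθ.eval u, fun G => ?_⟩⟩
      rw [map_neg]
      exact h2 u G
    refine ⟨⟨Y, hA⟩, ?_, rfl⟩
    obtain ⟨τ, hτ, e⟩ := (hρ ⟨Y, hA⟩).2 (C.formOf θ) (hθ.isPotential_formOf_iff.2 h2)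
    rw [SetLike.mem_coe, LinearMap.mem_ker, e, Submodule.Quotient.mk_eq_zero]
    -- For this potential the representative is the zero form itself, hence the primitive `0`.
    refine ⟨τ.2.1, 0, zero_mem _, fun u => ?_⟩
    have h4 : C.conn.covD (0 : RawForm 𝓘(ℝ, F) C.pr 1) u = 0 := by
      have := C.conn.covD_smul 0 (zero_mem (horForm 𝓘(ℝ, E) 𝓘(ℝ, F) C.pr 1)) u
      simpa using this
    rw [h4]
    refine (hθ.isTau_formOf_iff.1 hτ u).trans ?_
    rw [SmoothCov.tau, h3]
    rfl

lemma vertPart_mem_map_ker {ρ : C.conn.algA C.ΨV →ₗ[ℝ] C.conn.cohomology C.ΨV 2}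
    (hρ : C.conn.IsRho C.ΨV C.sigma ρ) {Z : SmoothVF 𝓘(ℝ, E) N} (hZ : Z ∈ C.Ψ.poiss) :
    C.vertPart Z ∈ (LinearMap.ker ρ).map (C.conn.algA C.ΨV).subtype :=
  (mem_map_ker_iff hρ).2 ⟨isVertical_vertPart Z, _, C.smoothCov_covOfField Z, by
    rwa [vertPart_sub_field]⟩

lemma ham_le_map_ker {ρ : C.conn.algA C.ΨV →ₗ[ℝ] C.conn.cohomology C.ΨV 2}
    (hρ : C.conn.IsRho C.ΨV C.sigma ρ) :
    C.ΨV.ham ≤ (LinearMap.ker ρ).map (C.conn.algA C.ΨV).subtype := by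
  intro Y hY
  obtain ⟨K, rfl⟩ := (C.ΨV.mem_ham_iff Y).1 hY
  rw [← vertPart_hamField]
  exact vertPart_mem_map_ker hρ (C.Ψ.hamField_mem_poiss C.poisson K)

variable (C) in
/-- The Poisson vector field of a 1-cocycle. -/
def cocycleField : C.conn.cocycles C.ΨV 1 →ₗ[ℝ] C.Ψ.poiss where
  toFun β := ⟨-(C.smoothCov_covOf (casForm_le_horForm C.ΨV 1 β.2.1)).field, by
    have hθ := C.smoothCov_covOf (casForm_le_horForm C.ΨV 1 β.2.1)
    have hβ := β.2
    rw [← C.formOf_covOf β, hθ.mem_cocycles_iff] at hβ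
    have := (hθ.sub_field_mem_poiss_iff (Y := 0) (fun x => map_zero (C.dpr x))).2
      ⟨zero_mem _, hβ.1, fun u v => by rw [hβ.2, derivVF_zero, add_zero]⟩
    rwa [zero_sub] at this⟩
  map_add' β β' := by
    ext x
    change -(C.Ψ.sharp x (C.pullCov x (C.covOf _ x + C.covOf _ x))) =
      -(C.Ψ.sharp x (C.pullCov x (C.covOf _ x))) + -(C.Ψ.sharp x (C.pullCov x (C.covOf _ x)))
    rw [map_add, map_add, neg_add]
  map_smul' c β := by
    ext x
    change -(C.Ψ.sharp x (C.pullCov x (c • C.covOf _ x))) =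
      c • -(C.Ψ.sharp x (C.pullCov x (C.covOf _ x)))
    rw [map_smul, map_smul, smul_neg]

/-- The decomposition of the first Poisson cohomology. -/
theorem nonempty_H1_equiv {ρ : C.conn.algA C.ΨV →ₗ[ℝ] C.conn.cohomology C.ΨV 2}
    (hρ : C.conn.IsRho C.ΨV C.sigma ρ) :
    Nonempty (C.Ψ.H1 ≃ₗ[ℝ] (C.conn.cohomology C.ΨV 1 ×
      (↥((LinearMap.ker ρ).map (C.conn.algA C.ΨV).subtype) ⧸
        C.ΨV.ham.submoduleOf ((LinearMap.ker ρ).map (C.conn.algA C.ΨV).subtype)))) := by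
  let q := Submodule.mapQ (C.Ψ.ham.submoduleOf C.Ψ.poiss)
    (C.ΨV.ham.submoduleOf ((LinearMap.ker ρ).map (C.conn.algA C.ΨV).subtype))
    (C.vertPartLin.restrict fun Z hZ => vertPart_mem_map_ker hρ hZ) (by
      rintro ⟨Z, hZ⟩ h
      obtain ⟨K, rfl⟩ := (C.Ψ.mem_ham_iff Z).1 h
      exact (C.ΨV.mem_ham_iff _).2 ⟨K, vertPart_hamField K⟩)
  let j := Submodule.mapQ ((C.conn.coboundaries C.ΨV 1).submoduleOf (C.conn.cocycles C.ΨV 1))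
    (C.Ψ.ham.submoduleOf C.Ψ.poiss) C.cocycleField (by
      rintro ⟨β, hβ⟩ h
      have hθ := C.smoothCov_covOf (casForm_le_horForm C.ΨV 1 hβ.1)
      change β ∈ C.conn.coboundaries C.ΨV 1 at h
      rw [← C.formOf_covOf β, hθ.mem_coboundaries_iff] at h
      obtain ⟨-, K, hK, e⟩ := h
      -- The field of a cocycle `β` is `-Ψ♯(pr^* β)`. For `β = ∂K` with `K` a Casimir this is the
      -- Hamiltonian field of `-K`, whose vertical part is zero.
      refine (C.Ψ.mem_ham_iff _).2 ⟨-K, ?_⟩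
      have h1 : C.ΨV.hamField (-K) = 0 := vectorField_ext fun G => by
        rw [← BivectorField.br_eq, map_neg, LinearMap.neg_apply, hK, derivVF_zero, neg_zero]
      rw [hamField_eq_sub, h1, zero_sub]
      have h2 : C.covOf β = fun x => -C.horCov x (dAt x (-K)) := by
        funext x
        rw [map_neg, map_neg, neg_neg]
        ext v
        obtain ⟨u, rfl⟩ := exists_vectorField_eq v
        exact DFunLike.congr_fun (e u) x
      change -hθ.field = _
      congr 1
      ext x
      rw [hθ.field_apply, h2]; rfl)
  have hinj : Function.Injective j := by
    rw [← LinearMap.ker_eq_bot, LinearMap.ker_eq_bot']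
    intro m hm
    obtain ⟨⟨β, hβ⟩, rfl⟩ := Submodule.Quotient.mk_surjective _ m
    rw [Submodule.mapQ_apply, Submodule.Quotient.mk_eq_zero] at hm
    obtain ⟨K, hK⟩ := (C.Ψ.mem_ham_iff _).1 hm
    have hθ := C.smoothCov_covOf (casForm_le_horForm C.ΨV 1 hβ.1)
    change -hθ.field = C.Ψ.hamField K at hK
    have hz : C.IsVertical 0 := fun x => map_zero (C.dpr x)
    -- The field of the cocycle has no vertical part, so `K` is a Casimir; comparing horizontal
    -- parts gives `β = ∂(-K)`.
    have h1 := hz.vertPart_sub_field hθ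
    rw [zero_sub, hK, vertPart_hamField] at h1
    rw [hamField_eq_sub, h1, zero_sub, neg_inj] at hK
    have h2 := field_injective hK
    rw [Submodule.Quotient.mk_eq_zero]
    change β ∈ C.conn.coboundaries C.ΨV 1
    have hβ' := hβ
    rw [← C.formOf_covOf β] at hβ' ⊢
    refine hθ.mem_coboundaries_iff.2 ⟨(hθ.mem_cocycles_iff.1 hβ').1, -K, fun G => ?_, fun u => ?_⟩
    · rw [map_neg, BivectorField.br, LinearMap.neg_apply]
      change -derivVF (C.ΨV.hamField K) G = 0
      rw [h1, derivVF_zero, neg_zero]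
    · ext x
      change C.covOf β x (u (C.pr x)) = _
      rw [h2, map_neg]; rfl
  have hsurj : Function.Surjective q := by
    intro m
    obtain ⟨⟨Y, hY⟩, rfl⟩ := Submodule.Quotient.mk_surjective _ m
    obtain ⟨hv, θ, hθ, h⟩ := (mem_map_ker_iff hρ).1 hY
    refine ⟨Submodule.Quotient.mk ⟨_, h⟩, ?_⟩
    rw [Submodule.mapQ_apply]
    congr 1
    exact Subtype.ext (hv.vertPart_sub_field hθ)
  have hex : Function.Exact j q := by
    intro m
    obtain ⟨⟨Z, hZ⟩, rfl⟩ := Submodule.Quotient.mk_surjective _ m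
    rw [Submodule.mapQ_apply, Submodule.Quotient.mk_eq_zero]
    constructor
    · intro h
      obtain ⟨K, hK⟩ := (C.ΨV.mem_ham_iff _).1 h
      change C.vertPart Z = _ at hK
      -- If the vertical part of `Z` is Hamiltonian for `ΨV` with function `K`, removing the field
      -- of `K` from `Z` leaves a horizontal Poisson field, which is the field of a cocycle.
      let W := Z - C.Ψ.hamField K
      have hW : W ∈ C.Ψ.poiss := sub_mem hZ (C.Ψ.hamField_mem_poiss C.poisson K)
      have h1 : C.vertPart W = 0 := by
        change C.vertPartLin (Z - _) = 0
        rw [map_sub]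
        change C.vertPart Z - C.vertPart _ = 0
        rw [hK, vertPart_hamField, sub_self]
      let hθ := C.smoothCov_covOfField W
      have h2 : W = 0 - hθ.field := by
        conv_lhs => rw [← vertPart_sub_field (C := C) W, h1]
      rw [h2] at hW
      have hz : C.IsVertical 0 := fun x => map_zero (C.dpr x)
      obtain ⟨-, h3, h4⟩ := (hθ.sub_field_mem_poiss_iff hz).1 hW
      refine ⟨Submodule.Quotient.mk ⟨C.formOf (C.covOfField W), hθ.mem_cocycles_iff.2
        ⟨h3, fun u v => by simpa [derivVF_zero] using h4 u v⟩⟩, ?_⟩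
      rw [Submodule.mapQ_apply, Submodule.Quotient.eq]
      refine (C.Ψ.mem_ham_iff _).2 ⟨-K, ?_⟩
      have h5 : W - Z = C.Ψ.hamField (-K) := by
        change Z - _ - Z = _
        rw [sub_sub_cancel_left]
        exact vectorField_ext fun G => by
          rw [derivVF_neg, ← BivectorField.br_eq, ← BivectorField.br_eq, map_neg,
            LinearMap.neg_apply]
      rw [← h5]
      change -hθ.field - Z = W - Z
      rw [← zero_sub]
      exact congrArg (· - Z) h2.symm
    · rintro ⟨m, hm⟩
      obtain ⟨⟨β, hβ⟩, rfl⟩ := Submodule.Quotient.mk_surjective _ m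
      have hθ := C.smoothCov_covOf (casForm_le_horForm C.ΨV 1 hβ.1)
      have hz : C.IsVertical 0 := fun x => map_zero (C.dpr x)
      rw [Submodule.mapQ_apply, Submodule.Quotient.eq] at hm
      obtain ⟨K, hK⟩ := (C.Ψ.mem_ham_iff _).1 hm
      change -hθ.field - Z = _ at hK
      have h1 := congrArg C.vertPartLin hK
      rw [map_sub] at h1
      change C.vertPart _ - C.vertPart Z = C.vertPart _ at h1
      have h2 := hz.vertPart_sub_field hθ
      rw [zero_sub] at h2
      rw [h2, vertPart_hamField, zero_sub] at h1
      refine (C.ΨV.mem_ham_iff _).2 ⟨-K, ?_⟩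
      change C.vertPart Z = _
      rw [← neg_neg (C.vertPart Z), h1]
      exact vectorField_ext fun G => by
          rw [derivVF_neg, ← BivectorField.br_eq, ← BivectorField.br_eq, map_neg,
            LinearMap.neg_apply]
  exact nonempty_equiv_prod_of_exact hex hinj hsurj

end TransverseFibration

end Transverse

end SemilocalPoisson

namespace SemilocalPoisson

/-! ### Gluing of local homeomorphisms -/

section Gluing

/-- Local homeomorphisms near the points of a subset, which are graphs of a common relation in
uniform balls, restrict to a homeomorphism from a neighborhood of the subset. -/
theorem exists_glued_openPartialHomeomorph {X Y S : Type*} [PseudoMetricSpace X]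
    [TopologicalSpace Y] [Nonempty S] {q : Y → X} (hq : Continuous q) (z : S → X)
    (R : X → Y → Prop) (h : S → OpenPartialHomeomorph X Y) (ε : S → ℝ) (hε : ∀ j, 0 < ε j)
    (hz : ∀ j, z j ∈ (h j).source) (hqz : ∀ j, q (h j (z j)) = z j)
    (hR : ∀ j, ∀ x ∈ (h j).source, R x (h j x))
    (hu : ∀ j x y, dist x (z j) < ε j → dist (q y) (z j) < ε j → R x y →
      x ∈ (h j).source ∧ h j x = y) :
    ∃ (f : OpenPartialHomeomorph X Y) (U : S → Set X), f.source = ⋃ j, U j ∧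
      ∀ j, IsOpen (U j) ∧ z j ∈ U j ∧ U j ⊆ (h j).source ∧ Set.EqOn f (h j) (U j) := by
  classical
  -- With a quarter of the radius, three consecutive steps, each shorter than a quarter of the
  -- larger radius, stay inside the ball in which uniqueness is known.
  let U (j : S) : Set X := ((h j).source ∩ (h j) ⁻¹' (q ⁻¹' Metric.ball (z j) (ε j / 4))) ∩
    Metric.ball (z j) (ε j / 4)
  have hUo (j) : IsOpen (U j) :=
    ((h j).isOpen_inter_preimage (Metric.isOpen_ball.preimage hq)).inter Metric.isOpen_ball
  have hUs (j) : U j ⊆ (h j).source := fun x hx => hx.1.1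
  have hUd {j x} (hx : x ∈ U j) : dist x (z j) < ε j / 4 := hx.2
  have hUq {j x} (hx : x ∈ U j) : dist (q (h j x)) (z j) < ε j / 4 := hx.1.2
  -- Uniqueness is applied in the larger of the two balls; the foot point given by `h k` is reached
  -- through `z k` and `x`.
  have key {j k x} (hj : x ∈ U j) (hk : x ∈ U k) (hjk : ε k ≤ ε j) : h j x = h k x := by
    refine (hu j x (h k x) ?_ ?_ (hR k x (hUs k hk))).2
    · linarith [hUd hj, hε j]
    · have h1 := dist_triangle4 (q (h k x)) (z k) x (z j)
      have h2 := hUd hk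
      rw [dist_comm] at h2
      linarith [hUd hj, hUq hk, hε j]
  have hcompat {j k x} (hj : x ∈ U j) (hk : x ∈ U k) : h j x = h k x := by
    rcases le_total (ε k) (ε j) with h1 | h1
    · exact key hj hk h1
    · exact (key hk hj h1).symm
  -- Now `x'` is reached from `z j` through the common foot point and `z k`; uniqueness shows that
  -- `h j` takes the same value at `x` and `x'`, and `h j` is injective.
  have kinj {j k x x'} (hj : x ∈ U j) (hk : x' ∈ U k) (hjk : ε k ≤ ε j) (he : h j x = h k x') :
      x = x' := by
    have h1 : x' ∈ (h j).source ∧ h j x' = h j x := by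
      refine hu j x' (h j x) ?_ ?_ (he ▸ hR k x' (hUs k hk))
      · have h2 := dist_triangle4 x' (z k) (q (h j x)) (z j)
        have h3 := hUq hk
        rw [← he, dist_comm] at h3
        linarith [hUd hk, hUq hj, hε j]
      · linarith [hUq hj, hε j]
    exact (h j).injOn (hUs j hj) h1.1 h1.2.symm
  let f₀ (x : X) : Y := h (Classical.epsilon fun j => x ∈ U j) x
  have hf₀ {j x} (hj : x ∈ U j) : f₀ x = h j x :=
    hcompat (Classical.epsilon_spec (p := fun j => x ∈ U j) ⟨j, hj⟩) hj
  have hinj : Set.InjOn f₀ (⋃ j, U j) := by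
    intro x hx x' hx' he
    obtain ⟨j, hj⟩ := Set.mem_iUnion.1 hx
    obtain ⟨k, hk⟩ := Set.mem_iUnion.1 hx'
    rw [hf₀ hj, hf₀ hk] at he
    rcases le_total (ε k) (ε j) with h1 | h1
    · exact kinj hj hk h1 he
    · exact (kinj hk hj h1 he.symm).symm
  have : Nonempty X := ⟨z (Classical.arbitrary S)⟩
  let e : PartialEquiv X Y := hinj.toPartialEquiv f₀ _
  have hes : e.source = ⋃ j, U j := rfl
  have hcont : ContinuousOn e e.source := by
    intro x hx
    obtain ⟨j, hj⟩ := Set.mem_iUnion.1 hx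
    have h1 : ContinuousAt (h j) x := (h j).continuousAt (hUs j hj)
    have h2 : e =ᶠ[𝓝 x] h j := by
      filter_upwards [(hUo j).mem_nhds hj] with y hy using hf₀ hy
    exact (h1.congr h2.symm).continuousWithinAt
  have hopen : IsOpenMap (e.source.domRestrict e) := by
    intro A hA
    have hso : IsOpen e.source := isOpen_iUnion hUo
    have hA' : IsOpen (Subtype.val '' A) := hso.isOpenMap_subtype_val A hA
    have h1 : e.source.domRestrict e '' A = ⋃ j, h j '' (U j ∩ Subtype.val '' A) := by
      ext y
      constructor
      · rintro ⟨⟨x, hx⟩, hxA, rfl⟩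
        obtain ⟨j, hj⟩ := Set.mem_iUnion.1 hx
        exact Set.mem_iUnion.2 ⟨j, x, ⟨hj, ⟨x, hx⟩, hxA, rfl⟩, (hf₀ hj).symm⟩
      · intro hy
        obtain ⟨j, x, ⟨hj, ⟨x', hx'⟩, hxA, rfl⟩, rfl⟩ := Set.mem_iUnion.1 hy
        exact ⟨⟨x', hx'⟩, hxA, hf₀ hj⟩
    rw [h1]
    exact isOpen_iUnion fun j => (h j).isOpen_image_of_subset_source ((hUo j).inter hA')
      (Set.inter_subset_left.trans (hUs j))
  refine ⟨OpenPartialHomeomorph.ofContinuousOpenRestrict e hcont hopen (isOpen_iUnion hUo), U, rfl,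
    fun j => ⟨hUo j, ⟨⟨hz j, ?_⟩, ?_⟩, hUs j, fun x hx => hf₀ hx⟩⟩
  · change q (h j (z j)) ∈ Metric.ball (z j) (ε j / 4)
    rw [hqz]
    exact Metric.mem_ball_self (by linarith [hε j])
  · exact Metric.mem_ball_self (by linarith [hε j])

end Gluing

/-! ### The inverse function theorem -/

section Inverse

variable {E : Type*} [NormedAddCommGroup E] [NormedSpace ℝ E] [CompleteSpace E]
  {F : Type*} [NormedAddCommGroup F] [NormedSpace ℝ F]

/-- The inverse function theorem on a neighborhood. -/
theorem exists_openPartialHomeomorph_of_contDiffOn {g : E → F} {O : Set E} (hO : IsOpen O)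
    (hg : ContDiffOn ℝ ∞ g O) {a : E} (ha : a ∈ O) {g' : E ≃L[ℝ] F}
    (hg' : HasFDerivAt g (g' : E →L[ℝ] F) a) :
    ∃ h : OpenPartialHomeomorph E F, a ∈ h.source ∧ h.source ⊆ O ∧ (h : E → F) = g ∧
      ContDiffOn ℝ ∞ h h.source ∧ ContDiffOn ℝ ∞ h.symm h.target := by
  have hga (x) (hx : x ∈ O) : ContDiffAt ℝ ∞ g x := (hg x hx).contDiffAt (hO.mem_nhds hx)
  let h₀ := (hga a ha).toOpenPartialHomeomorph g hg' (by simp)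
  -- Restricting to the open set where the derivative is invertible makes the inverse smooth on the
  -- entire target.
  let A : Set E := O ∩ fderiv ℝ g ⁻¹' Set.range ((↑) : (E ≃L[ℝ] F) → E →L[ℝ] F)
  have hA : IsOpen A := (hg.continuousOn_fderiv_of_isOpen hO (by simp)).isOpen_inter_preimage hO
    ContinuousLinearEquiv.isOpen
  have hsrc : (h₀.restrOpen A hA).source = h₀.source ∩ A := h₀.restrOpen_source A hA
  refine ⟨h₀.restrOpen A hA, ?_, ?_, rfl, ?_, ?_⟩
  · rw [hsrc]
    exact ⟨(hga a ha).mem_toOpenPartialHomeomorph_source hg' (by simp), ha, g', hg'.fderiv.symm⟩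
  · rw [hsrc]
    exact Set.inter_subset_right.trans Set.inter_subset_left
  · rw [hsrc]
    exact hg.mono (Set.inter_subset_right.trans Set.inter_subset_left)
  · intro y hy
    have hx := (h₀.restrOpen A hA).map_target hy
    set x := (h₀.restrOpen A hA).symm y
    rw [hsrc] at hx
    obtain ⟨L, hL⟩ := hx.2.2
    refine ContDiffAt.contDiffWithinAt ?_
    refine (h₀.restrOpen A hA).contDiffAt_symm hy (f₀' := L) ?_ (hga x hx.2.1)
    rw [hL]
    exact ((hga x hx.2.1).differentiableAt (by simp)).hasFDerivAt

end Inverse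

end SemilocalPoisson

namespace SemilocalPoisson

/-! ### Charts defined by an implicit relation. -/

section ImplicitChart

variable {F : Type*} [NormedAddCommGroup F] [NormedSpace ℝ F] [FiniteDimensional ℝ F]
  {G : Type*} [NormedAddCommGroup G] [NormedSpace ℝ G] [FiniteDimensional ℝ G]

/-- The linear isomorphism `(a, b) ↦ (a + B b, b)`. -/
def shear (B : G →L[ℝ] F) : (F × G) ≃L[ℝ] (F × G) :=
  ContinuousLinearEquiv.equivOfInverse
    ((ContinuousLinearMap.fst ℝ F G + B ∘L ContinuousLinearMap.snd ℝ F G).prod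
      (ContinuousLinearMap.snd ℝ F G))
    ((ContinuousLinearMap.fst ℝ F G - B ∘L ContinuousLinearMap.snd ℝ F G).prod
      (ContinuousLinearMap.snd ℝ F G))
    (fun x => by ext <;> simp) (fun x => by ext <;> simp)

/-- The linear isomorphism `(t, p) ↦ (L p - t, p)`. -/
def subEquiv {P : Type*} [NormedAddCommGroup P] [NormedSpace ℝ P] (L : P →L[ℝ] F) :
    (F × P) ≃L[ℝ] (F × P) :=
  ContinuousLinearEquiv.equivOfInverse
    ((L ∘L ContinuousLinearMap.snd ℝ F P - ContinuousLinearMap.fst ℝ F P).prod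
      (ContinuousLinearMap.snd ℝ F P))
    ((L ∘L ContinuousLinearMap.snd ℝ F P - ContinuousLinearMap.fst ℝ F P).prod
      (ContinuousLinearMap.snd ℝ F P))
    (fun x => by ext <;> simp) (fun x => by ext <;> simp)

/-- A map `Γ : F × (F × G) → F × G` that vanishes on the graph of `t ↦ (t, 0)`, and whose
derivative is unipotent, defines a chart `h` by `Γ(t, p) = (0, v)` if and only if `h p = (t, v)`. -/
theorem exists_chart_of_relation {Γ : F × (F × G) → F × G} {O : Set (F × (F × G))}
    (hO : IsOpen O) (hΓ : ContDiffOn ℝ ∞ Γ O) {t₀ : F} (h₀ : (t₀, ((t₀, 0) : F × G)) ∈ O)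
    (hz : ∀ t, (t, ((t, 0) : F × G)) ∈ O → Γ (t, (t, 0)) = 0) {B : G →L[ℝ] F}
    (hB : ∀ w, fderiv ℝ Γ (t₀, (t₀, 0)) (0, w) = (w.1 + B w.2, w.2)) :
    ∃ (h : OpenPartialHomeomorph (F × G) (F × G)) (A : Set (F × (F × G))),
      (t₀, 0) ∈ h.source ∧ h (t₀, 0) = (t₀, 0) ∧ ContDiffOn ℝ ∞ h h.source ∧
      ContDiffOn ℝ ∞ h.symm h.target ∧
      (∀ v, (fderiv ℝ h.symm (t₀, 0) v).2 = v.2) ∧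
      (∀ p ∈ h.source, ((h p).1, p) ∈ O ∧ Γ ((h p).1, p) = (0, (h p).2)) ∧
      IsOpen A ∧ (t₀, ((t₀, 0) : F × G)) ∈ A ∧
      ∀ t p v, (t, p) ∈ A → Γ (t, p) = (0, v) → p ∈ h.source ∧ h p = (t, v) := by
  set c : F × (F × G) := (t₀, (t₀, 0)) with hc
  have hd : HasFDerivAt Γ (fderiv ℝ Γ c) c :=
    (((hΓ c h₀).contDiffAt (hO.mem_nhds h₀)).differentiableAt (by simp)).hasFDerivAt
  -- The derivative in the first variable is forced: differentiating `Γ(t, (t, 0)) = 0` gives it as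
  -- minus the derivative in the direction `(0, (t, 0))`.
  have hdt (t : F) : fderiv ℝ Γ c (t, 0) = (-t, 0) := by
    have h1 : HasFDerivAt (fun t : F => (t, ((t, 0) : F × G)))
        ((ContinuousLinearMap.id ℝ F).prod ((ContinuousLinearMap.id ℝ F).prod 0)) t₀ :=
      (hasFDerivAt_id t₀).prodMk ((hasFDerivAt_id t₀).prodMk (hasFDerivAt_const 0 t₀))
    have h2 := (hd.comp t₀ h1 : HasFDerivAt (fun t => Γ (t, (t, 0))) _ t₀)
    have h3 : (fun t => Γ (t, (t, 0))) =ᶠ[𝓝 t₀] fun _ => 0 := by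
      filter_upwards [h1.continuousAt.preimage_mem_nhds (hO.mem_nhds h₀)] with t ht using hz t ht
    have h4 := h2.unique ((hasFDerivAt_const (0 : F × G) t₀).congr_of_eventuallyEq h3)
    have h5 := congrArg (fun L => L t) h4
    change fderiv ℝ Γ c (t, (t, 0)) = 0 at h5
    have h6 : ((t, (t, 0)) : F × (F × G)) = (t, 0) + (0, (t, 0)) := by simp
    rw [h6, map_add, hB, map_zero, add_zero] at h5
    rw [eq_neg_of_add_eq_zero_left h5]
    simp
  have hdΓ (x : F × (F × G)) : fderiv ℝ Γ c x = (x.2.1 + B x.2.2 - x.1, x.2.2) := by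
    have h6 : x = (x.1, 0) + (0, x.2) := by simp
    conv_lhs => rw [h6, map_add, hdt, hB]
    ext <;> simp
    abel
  let L : (F × G) →L[ℝ] F :=
    ContinuousLinearMap.fst ℝ F G + B ∘L ContinuousLinearMap.snd ℝ F G
  -- Inverting `(t, p) ↦ (Γ₁(t, p), p)` solves `Γ₁(t, p) = 0` for `t = τ p`. The derivative at the
  -- base point is `(t, p) ↦ (L p - t, p)`.
  obtain ⟨k, hk0, hkO, hkc, hks, hksy⟩ := exists_openPartialHomeomorph_of_contDiffOn hO
    (g := fun x => ((Γ x).1, x.2)) (hΓ.fst.prodMk contDiffOn_snd) h₀ (g' := subEquiv L) (by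
      refine (hd.fst.prodMk hasFDerivAt_snd).congr_fderiv ?_
      ext x <;> simp [subEquiv, L, hdΓ])
  have hkc' (x) : k x = ((Γ x).1, x.2) := congrFun hkc x
  have hΓc : Γ c = 0 := hz t₀ h₀
  have hkt : ((0, (t₀, 0)) : F × (F × G)) ∈ k.target := by
    have := k.map_source hk0
    rwa [hkc', hΓc] at this
  have hkt' : k.symm (0, (t₀, 0)) = c := by
    have := k.left_inv hk0
    rwa [hkc', hΓc] at this
  let ι₀ : (F × G) → F × (F × G) := fun p => (0, p)
  have hι₀ : ContDiff ℝ ∞ ι₀ := contDiff_const.prodMk contDiff_id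
  let P : Set (F × G) := ι₀ ⁻¹' k.target
  have hP : IsOpen P := k.open_target.preimage hι₀.continuous
  let τ : (F × G) → F := fun p => (k.symm (0, p)).1
  have hks2 {p} (hp : p ∈ P) : k.symm (0, p) = (τ p, p) ∧ Γ (τ p, p) = (0, (Γ (τ p, p)).2) ∧
      (τ p, p) ∈ k.source := by
    have h1 := k.right_inv hp
    have h2 := k.map_target hp
    change k.symm (0, p) ∈ _ at h2
    change k (k.symm (0, p)) = (0, p) at h1
    rw [hkc', Prod.ext_iff] at h1
    have h3 : k.symm (0, p) = (τ p, p) := Prod.ext rfl h1.2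
    rw [h3] at h1 h2
    exact ⟨h3, Prod.ext h1.1 rfl, h2⟩
  have hτ : ContDiffOn ℝ ∞ τ P := (hksy.comp hι₀.contDiffOn fun _ hp => hp).fst
  have hτO : Set.MapsTo (fun p => (τ p, p)) P O := fun p hp => hkO (hks2 hp).2.2
  have hp₀ : ((t₀, 0) : F × G) ∈ P := hkt
  have hτ₀ : τ (t₀, 0) = t₀ := congrArg Prod.fst hkt'
  -- Obtained by differentiating the identity `Γ₁(τ p, p) = 0`.
  have hτd : HasFDerivAt τ L (t₀, 0) := by
    have h1 : HasFDerivAt τ (fderiv ℝ τ (t₀, 0)) (t₀, 0) :=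
      (((hτ _ hp₀).contDiffAt (hP.mem_nhds hp₀)).differentiableAt (by simp)).hasFDerivAt
    have h2 : HasFDerivAt (fun p => (τ p, p)) ((fderiv ℝ τ (t₀, 0)).prod (.id ℝ _))
      ((t₀, 0) : F × G) := h1.prodMk (hasFDerivAt_id _)
    have h3 : HasFDerivAt Γ (fderiv ℝ Γ c) ((fun p : F × G => (τ p, p)) (t₀, 0)) := by
      change HasFDerivAt Γ _ (τ (t₀, 0), (t₀, 0))
      rw [hτ₀]
      exact hd
    have h4 := (HasFDerivAt.comp (f := fun p : F × G => (τ p, p)) _ h3 h2).fst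
    have h5 : (fun p => (Γ (τ p, p)).1) =ᶠ[𝓝 ((t₀, 0) : F × G)] fun _ => 0 := by
      filter_upwards [hP.mem_nhds hp₀] with p hp
      rw [(hks2 hp).2.1]
    have h6 := h4.unique ((hasFDerivAt_const (0 : F) _).congr_of_eventuallyEq h5)
    refine h1.congr_fderiv ?_
    refine ContinuousLinearMap.ext fun w => ?_
    have h7 := congrArg (fun L => L w) h6
    change (fderiv ℝ Γ c (fderiv ℝ τ (t₀, 0) w, w)).1 = 0 at h7
    rw [hdΓ] at h7
    exact (sub_eq_zero.1 h7).symm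
  -- The chart is `p ↦ (τ p, Γ₂(τ p, p))`. Its derivative at the base point is the shear by `B`, so
  -- neither it nor its inverse changes the normal component.
  have hgs : ContDiffOn ℝ ∞ (fun p => (τ p, (Γ (τ p, p)).2)) P :=
    hτ.prodMk (hΓ.comp (hτ.prodMk contDiffOn_id) hτO).snd
  have hgd : HasFDerivAt (fun p => (τ p, (Γ (τ p, p)).2)) (shear B : (F × G) →L[ℝ] F × G)
      (t₀, 0) := by
    have h2 : HasFDerivAt (fun p => (τ p, p)) (L.prod (.id ℝ _))
      ((t₀, 0) : F × G) := hτd.prodMk (hasFDerivAt_id _)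
    have h3 : HasFDerivAt Γ (fderiv ℝ Γ c) ((fun p : F × G => (τ p, p)) (t₀, 0)) := by
      change HasFDerivAt Γ _ (τ (t₀, 0), (t₀, 0))
      rw [hτ₀]
      exact hd
    refine (hτd.prodMk (HasFDerivAt.comp (f := fun p : F × G => (τ p, p)) _ h3 h2).snd).congr_fderiv ?_
    refine ContinuousLinearMap.ext fun w => ?_
    change (L w, (fderiv ℝ Γ c (L w, w)).2) = shear B w
    rw [hdΓ]
    rfl
  obtain ⟨h, hh0, hhP, hhc, hhs, hhsy⟩ := exists_openPartialHomeomorph_of_contDiffOn hP hgs hp₀ hgd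
  have hhc' (p) : h p = (τ p, (Γ (τ p, p)).2) := congrFun hhc p
  have hh₀ : h (t₀, 0) = (t₀, 0) := by
    rw [hhc', hτ₀, ← hc, hΓc]; rfl
  refine ⟨h, k.source ∩ Prod.snd ⁻¹' h.source, hh0, hh₀, hhs, hhsy, fun v => ?_, fun p hp => ?_,
    k.open_source.inter (h.open_source.preimage continuous_snd), ⟨hk0, hh0⟩,
    fun t p v htp hv => ⟨htp.2, ?_⟩⟩
  · have h1 : (t₀, 0) ∈ h.target := by
      have := h.map_source hh0
      rwa [hh₀] at this
    have h2 : h.symm (t₀, 0) = (t₀, 0) := by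
      have := h.left_inv hh0
      rwa [hh₀] at this
    have h3 : HasFDerivAt h.symm ((shear B).symm : (F × G) →L[ℝ] F × G) (t₀, 0) := by
      refine h.hasFDerivAt_symm h1 ?_
      rw [h2, hhc]
      exact hgd
    rw [h3.fderiv]
    rfl
  · obtain ⟨h1, h2, h3⟩ := hks2 (hhP hp)
    rw [hhc']
    exact ⟨hkO h3, h2⟩
  · have h1 := k.left_inv htp.1
    rw [hkc', hv] at h1
    have h2 : τ p = t := congrArg Prod.fst h1
    rw [hhc', h2, hv]

end ImplicitChart

end SemilocalPoisson

namespace SemilocalPoisson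

/-! ### Slice charts and the normal bundle. -/

section Slice

universe u

variable {E : Type*} [NormedAddCommGroup E] [NormedSpace ℝ E]
  {M : Type*} [TopologicalSpace M] [ChartedSpace E M]
  {F : Type*} [NormedAddCommGroup F] [NormedSpace ℝ F]
  {S : Type*} [TopologicalSpace S] [ChartedSpace F S]
  {G : Type*} [NormedAddCommGroup G] [NormedSpace ℝ G]

/-- A family of slice charts `Φ` for `ι : S → M`, that extend charts `ψ` of `S`. -/
structure SliceAtlas (E : Type*) [NormedAddCommGroup E] [NormedSpace ℝ E]
    {M : Type*} [TopologicalSpace M] [ChartedSpace E M]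
    (F : Type*) [NormedAddCommGroup F] [NormedSpace ℝ F]
    {S : Type*} [TopologicalSpace S] [ChartedSpace F S]
    (G : Type*) [NormedAddCommGroup G] [NormedSpace ℝ G] (ι : S → M) where
  /-- slice charts -/
  Φ : S → OpenPartialHomeomorph M (F × G)
  /-- charts of the submanifold -/
  ψ : S → OpenPartialHomeomorph S F
  contMDiffOn_Φ : ∀ i, ContMDiffOn 𝓘(ℝ, E) 𝓘(ℝ, F × G) ∞ (Φ i) (Φ i).source
  contMDiffOn_Φ_symm : ∀ i, ContMDiffOn 𝓘(ℝ, F × G) 𝓘(ℝ, E) ∞ (Φ i).symm (Φ i).target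
  contMDiffOn_ψ : ∀ i, ContMDiffOn 𝓘(ℝ, F) 𝓘(ℝ, F) ∞ (ψ i) (ψ i).source
  contMDiffOn_ψ_symm : ∀ i, ContMDiffOn 𝓘(ℝ, F) 𝓘(ℝ, F) ∞ (ψ i).symm (ψ i).target
  mem_source : ∀ i, i ∈ (ψ i).source
  ι_mem : ∀ {i s}, s ∈ (ψ i).source → ι s ∈ (Φ i).source
  Φ_ι : ∀ {i s}, s ∈ (ψ i).source → Φ i (ι s) = (ψ i s, 0)

/-- Immersions have slice charts. -/
theorem exists_sliceAtlas {E : Type u} [NormedAddCommGroup E] [NormedSpace ℝ E]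
    [FiniteDimensional ℝ E]
    {M : Type*} [TopologicalSpace M] [ChartedSpace E M] [IsManifold 𝓘(ℝ, E) ∞ M]
    {F : Type*} [NormedAddCommGroup F] [NormedSpace ℝ F]
    {S : Type*} [TopologicalSpace S] [ChartedSpace F S] [IsManifold 𝓘(ℝ, F) ∞ S] [Nonempty S]
    {ι : S → M} (hι : Manifold.IsImmersion 𝓘(ℝ, F) 𝓘(ℝ, E) ∞ ι) :
    ∃ (G : Type u) (_ : NormedAddCommGroup G) (_ : NormedSpace ℝ G),
      FiniteDimensional ℝ G ∧ Nonempty (SliceAtlas E F G ι) := by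
  have h := hι.isImmersionOfComplement_complement
  refine ⟨hι.complement, inferInstance, inferInstance, ?_, ⟨?_⟩⟩
  · have e := (h (Classical.arbitrary S)).equiv
    have : FiniteDimensional ℝ (F × hι.complement) :=
      LinearEquiv.finiteDimensional e.symm.toLinearEquiv
    exact FiniteDimensional.of_surjective (LinearMap.snd ℝ F hι.complement)
      LinearMap.snd_surjective
  · refine
      { Φ := fun i => (h i).codChart.trans (h i).equiv.symm.toHomeomorph.toOpenPartialHomeomorph
        ψ := fun i => (h i).domChart
        contMDiffOn_Φ := fun i => ?_
        contMDiffOn_Φ_symm := fun i => ?_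
        contMDiffOn_ψ := fun i => contMDiffOn_of_mem_maximalAtlas (h i).domChart_mem_maximalAtlas
        contMDiffOn_ψ_symm := fun i =>
          contMDiffOn_symm_of_mem_maximalAtlas (h i).domChart_mem_maximalAtlas
        mem_source := fun i => (h i).mem_domChart_source
        ι_mem := fun {i s} hs => ?_
        Φ_ι := fun {i s} hs => ?_ }
    · have h1 := contMDiffOn_of_mem_maximalAtlas (h i).codChart_mem_maximalAtlas
      refine ((h i).equiv.symm.contDiff.contMDiff.comp_contMDiffOn h1).mono ?_
      exact fun x hx => hx.1
    · have h1 := contMDiffOn_symm_of_mem_maximalAtlas (h i).codChart_mem_maximalAtlas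
      refine h1.comp (h i).equiv.contDiff.contMDiff.contMDiffOn ?_
      exact fun x hx => hx.2
    · exact ⟨(h i).source_subset_preimage_source hs, Set.mem_univ _⟩
    · have hm : (h i).domChart s ∈ ((h i).domChart.extend 𝓘(ℝ, F)).target := by
        simpa using (h i).domChart.map_source hs
      have h1 := (h i).writtenInCharts hm
      simp only [Function.comp_apply, OpenPartialHomeomorph.extend_coe_symm,
        OpenPartialHomeomorph.extend_coe, modelWithCornersSelf_coe_symm, modelWithCornersSelf_coe,
        id_eq, (h i).domChart.left_inv hs] at h1
      change (h i).equiv.symm ((h i).codChart (ι s)) = _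
      rw [h1, ContinuousLinearEquiv.symm_apply_apply]

namespace SliceAtlas

variable {ι : S → M} (A : SliceAtlas E F G ι)

/-- The transition maps of slice charts. -/
def trans (k i : S) : OpenPartialHomeomorph (F × G) (F × G) := (A.Φ i).symm.trans (A.Φ k)

lemma trans_apply (k i : S) (p : F × G) : A.trans k i p = A.Φ k ((A.Φ i).symm p) := rfl

lemma contDiffOn_trans (k i : S) : ContDiffOn ℝ ∞ (A.trans k i) (A.trans k i).source := by
  rw [← contMDiffOn_iff_contDiffOn]
  exact (A.contMDiffOn_Φ k).comp ((A.contMDiffOn_Φ_symm i).mono fun x hx => hx.1)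
    fun x hx => hx.2

lemma mem_trans_source {k i s : S} (hi : s ∈ (A.ψ i).source) (hk : s ∈ (A.ψ k).source) :
    (A.ψ i s, (0 : G)) ∈ (A.trans k i).source := by
  rw [← A.Φ_ι hi]
  refine ⟨(A.Φ i).map_source (A.ι_mem hi), ?_⟩
  change (A.Φ i).symm _ ∈ (A.Φ k).source
  rw [(A.Φ i).left_inv (A.ι_mem hi)]
  exact A.ι_mem hk

lemma trans_zero {k i s : S} (hi : s ∈ (A.ψ i).source) (hk : s ∈ (A.ψ k).source) :
    A.trans k i (A.ψ i s, 0) = (A.ψ k s, 0) := by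
  rw [trans_apply, ← A.Φ_ι hi, (A.Φ i).left_inv (A.ι_mem hi), A.Φ_ι hk]

/-- The derivatives of the transition maps along the submanifold. -/
def D (k i s : S) : (F × G) →L[ℝ] (F × G) := fderiv ℝ (A.trans k i) (A.ψ i s, 0)

lemma hasFDerivAt_trans {k i s : S} (hi : s ∈ (A.ψ i).source) (hk : s ∈ (A.ψ k).source) :
    HasFDerivAt (A.trans k i) (A.D k i s) (A.ψ i s, 0) := by
  have h := A.mem_trans_source hi hk
  exact (((A.contDiffOn_trans k i _ h).contDiffAt
    ((A.trans k i).open_source.mem_nhds h)).differentiableAt (by simp)).hasFDerivAt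

lemma D_self {i s : S} (hi : s ∈ (A.ψ i).source) : A.D i i s = .id ℝ _ := by
  refine (A.hasFDerivAt_trans hi hi).unique ((hasFDerivAt_id _).congr_of_eventuallyEq ?_)
  filter_upwards [(A.trans i i).open_source.mem_nhds (A.mem_trans_source hi hi)] with p hp
  exact (A.Φ i).right_inv hp.1

lemma D_comp {i j k s : S} (hi : s ∈ (A.ψ i).source) (hj : s ∈ (A.ψ j).source)
    (hk : s ∈ (A.ψ k).source) : A.D k j s ∘L A.D j i s = A.D k i s := by
  refine HasFDerivAt.unique (f := A.trans k i) ?_ (A.hasFDerivAt_trans hi hk)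
  have h1 := A.hasFDerivAt_trans hj hk
  rw [← A.trans_zero hi hj] at h1
  refine (h1.comp _ (A.hasFDerivAt_trans hi hj)).congr_of_eventuallyEq ?_
  filter_upwards [(A.trans j i).open_source.mem_nhds (A.mem_trans_source hi hj)] with p hp
  exact (congrArg (A.Φ k) ((A.Φ j).left_inv hp.2)).symm

/-- Transition maps preserve the slice `F × {0}`, so their derivatives along it are block
triangular. Therefore the diagonal blocks `tang` and `norm` satisfy the cocycle identities. -/
lemma D_inl_snd {i k s : S} (hi : s ∈ (A.ψ i).source) (hk : s ∈ (A.ψ k).source) (a : F) :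
    (A.D k i s (a, 0)).2 = 0 := by
  have h1 : HasFDerivAt (fun t : F => ((t, 0) : F × G)) ((ContinuousLinearMap.id ℝ F).prod 0)
    (A.ψ i s) := (hasFDerivAt_id _).prodMk (hasFDerivAt_const _ _)
  have h2 := (HasFDerivAt.comp (A.ψ i s) (A.hasFDerivAt_trans hi hk) h1).snd
  have hi' : A.ψ i s ∈ (A.ψ i).target := (A.ψ i).map_source hi
  have h3 : (fun t : F => (A.trans k i (t, 0)).2) =ᶠ[𝓝 (A.ψ i s)] fun _ => 0 := by
    have hc : ∀ᶠ t in 𝓝 (A.ψ i s), (A.ψ i).symm t ∈ (A.ψ k).source := by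
      refine ((A.ψ i).continuousAt_symm hi').eventually ?_
      rw [(A.ψ i).left_inv hi]
      exact (A.ψ k).open_source.mem_nhds hk
    filter_upwards [hc, (A.ψ i).open_target.mem_nhds hi'] with t ht hti
    have := A.trans_zero ((A.ψ i).map_target hti) ht
    rw [(A.ψ i).right_inv hti] at this
    rw [this]
  have h4 := h2.unique ((hasFDerivAt_const (0 : G) _).congr_of_eventuallyEq h3)
  exact congrArg (fun L => L a) h4

/-- The transition maps of the tangent bundle of the submanifold. -/
def tang (k i s : S) : F →L[ℝ] F :=
  ContinuousLinearMap.fst ℝ F G ∘L A.D k i s ∘L ContinuousLinearMap.inl ℝ F G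

/-- The transition maps of the normal bundle. -/
def norm (k i s : S) : G →L[ℝ] G :=
  ContinuousLinearMap.snd ℝ F G ∘L A.D k i s ∘L ContinuousLinearMap.inr ℝ F G

lemma tang_apply (k i s : S) (a : F) : A.tang k i s a = (A.D k i s (a, 0)).1 := rfl

lemma norm_apply (k i s : S) (v : G) : A.norm k i s v = (A.D k i s (0, v)).2 := rfl

lemma D_inl {i k s : S} (hi : s ∈ (A.ψ i).source) (hk : s ∈ (A.ψ k).source) (a : F) :
    A.D k i s (a, 0) = (A.tang k i s a, 0) :=
  Prod.ext rfl (A.D_inl_snd hi hk a)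

lemma D_eq {i k s : S} (hi : s ∈ (A.ψ i).source) (hk : s ∈ (A.ψ k).source) (w : F × G) :
    A.D k i s w = (A.tang k i s w.1 + (A.D k i s (0, w.2)).1, A.norm k i s w.2) := by
  have h : w = (w.1, 0) + (0, w.2) := by simp
  conv_lhs => rw [h, map_add, A.D_inl hi hk]
  ext <;> simp [norm_apply]

lemma tang_self {i s : S} (hi : s ∈ (A.ψ i).source) (a : F) : A.tang i i s a = a := by
  rw [tang_apply, D_self A hi]; rfl

lemma norm_self {i s : S} (hi : s ∈ (A.ψ i).source) (v : G) : A.norm i i s v = v := by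
  rw [norm_apply, D_self A hi]; rfl

lemma tang_comp {i j k s : S} (hi : s ∈ (A.ψ i).source) (hj : s ∈ (A.ψ j).source)
    (hk : s ∈ (A.ψ k).source) (a : F) : A.tang k j s (A.tang j i s a) = A.tang k i s a := by
  rw [tang_apply _ k i, ← A.D_comp hi hj hk, ContinuousLinearMap.comp_apply, A.D_inl hi hj,
    tang_apply _ k j]

lemma norm_comp {i j k s : S} (hi : s ∈ (A.ψ i).source) (hj : s ∈ (A.ψ j).source)
    (hk : s ∈ (A.ψ k).source) (v : G) : A.norm k j s (A.norm j i s v) = A.norm k i s v := by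
  rw [norm_apply _ k i, ← A.D_comp hi hj hk, ContinuousLinearMap.comp_apply, A.D_eq hj hk]
  rfl

lemma contMDiffOn_D (k i : S) : ContMDiffOn 𝓘(ℝ, F) 𝓘(ℝ, (F × G) →L[ℝ] (F × G)) ∞ (A.D k i)
    ((A.ψ i).source ∩ (A.ψ k).source) := by
  have h1 : ContDiffOn ℝ ∞ (fderiv ℝ (A.trans k i)) (A.trans k i).source :=
    (A.contDiffOn_trans k i).fderiv_of_isOpen (A.trans k i).open_source (by simp)
  have h2 : ContMDiffOn 𝓘(ℝ, F) 𝓘(ℝ, F × G) ∞ (fun s => (A.ψ i s, (0 : G)))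
      ((A.ψ i).source ∩ (A.ψ k).source) := by
    have h3 : ContDiff ℝ ∞ (fun t : F => ((t, 0) : F × G)) := contDiff_id.prodMk contDiff_const
    exact h3.contMDiff.comp_contMDiffOn ((A.contMDiffOn_ψ i).mono Set.inter_subset_left)
  exact h1.contMDiffOn.comp h2 fun s hs => A.mem_trans_source hs.1 hs.2

lemma contMDiffOn_tang (k i : S) : ContMDiffOn 𝓘(ℝ, F) 𝓘(ℝ, F →L[ℝ] F) ∞ (A.tang k i)
    ((A.ψ i).source ∩ (A.ψ k).source) := by
  have h : ContDiff ℝ ∞ (fun L : (F × G) →L[ℝ] (F × G) =>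
      ContinuousLinearMap.fst ℝ F G ∘L L ∘L ContinuousLinearMap.inl ℝ F G) :=
    contDiff_const.clm_comp (contDiff_id.clm_comp contDiff_const)
  exact h.contMDiff.comp_contMDiffOn (A.contMDiffOn_D k i)

lemma contMDiffOn_norm (k i : S) : ContMDiffOn 𝓘(ℝ, F) 𝓘(ℝ, G →L[ℝ] G) ∞ (A.norm k i)
    ((A.ψ i).source ∩ (A.ψ k).source) := by
  have h : ContDiff ℝ ∞ (fun L : (F × G) →L[ℝ] (F × G) =>
      ContinuousLinearMap.snd ℝ F G ∘L L ∘L ContinuousLinearMap.inr ℝ F G) :=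
    contDiff_const.clm_comp (contDiff_id.clm_comp contDiff_const)
  exact h.contMDiff.comp_contMDiffOn (A.contMDiffOn_D k i)

/-- The normal bundle. -/
def core : VectorBundleCore ℝ S G S where
  baseSet i := (A.ψ i).source
  isOpen_baseSet i := (A.ψ i).open_source
  indexAt s := s
  mem_baseSet_at := A.mem_source
  coordChange i k s := A.norm k i s
  coordChange_self _ _ hs := A.norm_self hs
  continuousOn_coordChange i k := (A.contMDiffOn_norm k i).continuousOn
  coordChange_comp _ _ _ _ hs := A.norm_comp hs.1.1 hs.1.2 hs.2

instance : A.core.IsContMDiff 𝓘(ℝ, F) ∞ := ⟨fun i k => A.contMDiffOn_norm k i⟩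

end SliceAtlas

end Slice

end SemilocalPoisson

namespace SemilocalPoisson

/-! ### The averaged displacement and the chart it defines. -/

section Slice

variable {E : Type*} [NormedAddCommGroup E] [NormedSpace ℝ E]
  {M : Type*} [TopologicalSpace M] [ChartedSpace E M]
  {F : Type*} [NormedAddCommGroup F] [NormedSpace ℝ F]
  {S : Type*} [TopologicalSpace S] [ChartedSpace F S]
  {G : Type*} [NormedAddCommGroup G] [NormedSpace ℝ G]

namespace SliceAtlas

variable {ι : S → M} (A : SliceAtlas E F G ι)

/-- The transition maps of the direct sum of the tangent and the normal bundle. -/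
def gr (k i s : S) : (F × G) →L[ℝ] (F × G) := (A.tang k i s).prodMap (A.norm k i s)

lemma gr_apply (k i s : S) (w : F × G) : A.gr k i s w = (A.tang k i s w.1, A.norm k i s w.2) := rfl

lemma gr_comp {i j k s : S} (hi : s ∈ (A.ψ i).source) (hj : s ∈ (A.ψ j).source)
    (hk : s ∈ (A.ψ k).source) (w : F × G) : A.gr k j s (A.gr j i s w) = A.gr k i s w := by
  simp only [gr_apply, A.tang_comp hi hj hk, A.norm_comp hi hj hk]

/-- The block diagonal part undoes the diagonal of the triangular derivative, and a unipotent map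
remains. Maps of this shape are stable under averaging, so the averaged displacement is
nondegenerate for every partition of unity. -/
lemma gr_D {i j s : S} (hi : s ∈ (A.ψ i).source) (hj : s ∈ (A.ψ j).source) (w : F × G) :
    A.gr j i s (A.D i j s w) = (w.1 + A.tang j i s (A.D i j s (0, w.2)).1, w.2) := by
  rw [A.D_eq hj hi, gr_apply]
  simp only [map_add, A.tang_comp hj hi hj, A.tang_self hj, A.norm_comp hj hi hj, A.norm_self hj]

lemma contMDiffOn_gr (k i : S) : ContMDiffOn 𝓘(ℝ, F) 𝓘(ℝ, (F × G) →L[ℝ] (F × G)) ∞ (A.gr k i)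
    ((A.ψ i).source ∩ (A.ψ k).source) :=
  (A.contMDiffOn_tang k i).clm_prodMap (A.contMDiffOn_norm k i)

variable (ρ : SmoothPartitionOfUnity S 𝓘(ℝ, F) S)

/-- The average over the slice charts of the displacement from the point `s` of the submanifold,
as an element of `T_s S × V_s`, read in the charts at `j`. -/
def disp (j s : S) (x : M) : F × G :=
  ∑ i ∈ ρ.finsupport s, ρ i s • A.gr j i s (A.Φ i x - (A.ψ i s, 0))

/-- The displacement `disp` in the charts at `j`. -/
def dispCoord (j : S) (c : F × (F × G)) : F × G :=
  ∑ i ∈ ρ.fintsupport j, ρ i ((A.ψ j).symm c.1) • A.gr j i ((A.ψ j).symm c.1)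
    (A.trans i j c.2 - (A.ψ i ((A.ψ j).symm c.1), 0))

variable {ρ}

lemma mem_source_of_mem_finsupport (hρ : ρ.IsSubordinate fun i => (A.ψ i).source) {i s : S}
    (hi : i ∈ ρ.finsupport s) : s ∈ (A.ψ i).source :=
  hρ i (subset_tsupport _ ((ρ.mem_finsupport s).1 hi))

/-- Hence the condition that the displacement is purely normal does not depend on the chart in which
it is read. -/
lemma gr_disp (hρ : ρ.IsSubordinate fun i => (A.ψ i).source) {j k s : S}
    (hj : s ∈ (A.ψ j).source) (hk : s ∈ (A.ψ k).source) (x : M) :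
    A.gr k j s (A.disp ρ j s x) = A.disp ρ k s x := by
  simp only [disp, map_sum, map_smul]
  exact Finset.sum_congr rfl fun i hi => by
    rw [A.gr_comp (A.mem_source_of_mem_finsupport hρ hi) hj hk]

lemma dispCoord_eq {j s : S} {x : M} (hj : s ∈ (A.ψ j).source) (hx : x ∈ (A.Φ j).source)
    (hs : ρ.finsupport s ⊆ ρ.fintsupport j) :
    A.dispCoord ρ j (A.ψ j s, A.Φ j x) = A.disp ρ j s x := by
  simp only [dispCoord, disp, (A.ψ j).left_inv hj, trans_apply, (A.Φ j).left_inv hx]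
  refine (Finset.sum_subset hs fun i _ hi => ?_).symm
  have : ρ i s = 0 := by simpa [SmoothPartitionOfUnity.mem_finsupport] using hi
  rw [this, zero_smul]

variable (ρ) in
/-- A domain in `F × (F × G)` on which `dispCoord` is smooth. -/
def dispDomain (j : S) (W : Set S) : Set (F × (F × G)) :=
  ((A.ψ j).symm.source ∩ (A.ψ j).symm ⁻¹' W) ×ˢ
    ((A.Φ j).target ∩ ⋂ i ∈ ρ.fintsupport j, (A.trans i j).source)

lemma isOpen_dispDomain (j : S) {W : Set S} (hW : IsOpen W) : IsOpen (A.dispDomain ρ j W) :=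
  ((A.ψ j).symm.isOpen_inter_preimage hW).prod
    ((A.Φ j).open_target.inter (isOpen_biInter_finset fun i _ => (A.trans i j).open_source))

/-- Near `j` the average involves only a fixed finite set of charts, all defined there; smoothness
of `dispCoord` rests on this. -/
lemma exists_nhds_finsupport (hρ : ρ.IsSubordinate fun i => (A.ψ i).source) (j : S) :
    ∃ W : Set S, IsOpen W ∧ j ∈ W ∧ ∀ s ∈ W, s ∈ (A.ψ j).source ∧
      ρ.finsupport s ⊆ ρ.fintsupport j ∧ ∀ i ∈ ρ.fintsupport j, s ∈ (A.ψ i).source := by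
  have h1 : ∀ᶠ s in 𝓝 j, ∀ i ∈ ρ.fintsupport j, s ∈ (A.ψ i).source := by
    rw [Filter.eventually_all_finset]
    exact fun i hi => (A.ψ i).open_source.mem_nhds (hρ i ((ρ.mem_fintsupport_iff j i).1 hi))
  obtain ⟨W, hW, hWo, hj⟩ := mem_nhds_iff.1 (Filter.inter_mem
    ((A.ψ j).open_source.mem_nhds (A.mem_source j))
    (Filter.inter_mem (ρ.eventually_finsupport_subset j) h1))
  exact ⟨W, hWo, hj, fun s hs => hW hs⟩

lemma contDiffOn_dispCoord {j : S} {W : Set S}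
    (hW : ∀ s ∈ W, s ∈ (A.ψ j).source ∧ ∀ i ∈ ρ.fintsupport j, s ∈ (A.ψ i).source) :
    ContDiffOn ℝ ∞ (A.dispCoord ρ j) (A.dispDomain ρ j W) := by
  refine ContDiffOn.sum fun i hi => ?_
  have hs : ContMDiffOn 𝓘(ℝ, F × (F × G)) 𝓘(ℝ, F) ∞ (fun c => (A.ψ j).symm c.1)
      (A.dispDomain ρ j W) :=
    (A.contMDiffOn_ψ_symm j).comp contDiff_fst.contMDiff.contMDiffOn fun c hc => hc.1.1
  have hm : Set.MapsTo (fun c => (A.ψ j).symm c.1) (A.dispDomain ρ j W)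
      ((A.ψ i).source ∩ (A.ψ j).source) := fun c hc => ⟨(hW _ hc.1.2).2 i hi, (hW _ hc.1.2).1⟩
  have h1 := (((ρ i).contMDiff).comp_contMDiffOn hs).contDiffOn
  have h2 := ((A.contMDiffOn_gr j i).comp hs hm).contDiffOn
  have h3 := ((A.contMDiffOn_ψ i).comp hs fun c hc => (hm hc).1).contDiffOn
  have h4 : ContDiffOn ℝ ∞ (fun c : F × (F × G) => A.trans i j c.2) (A.dispDomain ρ j W) :=
    (A.contDiffOn_trans i j).comp contDiff_snd.contDiffOn
      fun c hc => Set.mem_iInter₂.1 hc.2.2 i hi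
  exact h1.smul (h2.clm_apply (h4.sub (h3.prodMk contDiffOn_const)))

lemma dispCoord_zero {j : S} {W : Set S}
    (hW : ∀ s ∈ W, s ∈ (A.ψ j).source ∧ ∀ i ∈ ρ.fintsupport j, s ∈ (A.ψ i).source) {t : F}
    (ht : (t, (t, 0)) ∈ A.dispDomain ρ j W) : A.dispCoord ρ j (t, (t, 0)) = 0 := by
  refine Finset.sum_eq_zero fun i hi => ?_
  have h1 := hW _ ht.1.2
  have h2 := A.trans_zero h1.1 (h1.2 i hi)
  have h3 : A.ψ j ((A.ψ j).symm t) = t := (A.ψ j).right_inv ht.1.1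
  rw [h3] at h2
  change ρ i _ • A.gr j i _ (A.trans i j (t, 0) - (A.ψ i ((A.ψ j).symm t), 0)) = 0
  rw [h2, sub_self, map_zero, smul_zero]

lemma hasFDerivAt_dispCoord {j : S} (hρ : ρ.IsSubordinate fun i => (A.ψ i).source) :
    HasFDerivAt (fun p => A.dispCoord ρ j (A.ψ j j, p))
      (∑ i ∈ ρ.fintsupport j, ρ i j • (A.gr j i j ∘L A.D i j j)) (A.ψ j j, 0) := by
  have hj := A.mem_source j
  refine HasFDerivAt.fun_sum fun i hi => ?_
  have hi' : j ∈ (A.ψ i).source := hρ i ((ρ.mem_fintsupport_iff j i).1 hi)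
  simp only [(A.ψ j).left_inv hj]
  have h1 : HasFDerivAt (fun p => A.gr j i j (A.trans i j p - (A.ψ i j, 0)))
      (A.gr j i j ∘L A.D i j j) (A.ψ j j, 0) :=
    (A.gr j i j).hasFDerivAt.comp (f := fun p => A.trans i j p - (A.ψ i j, 0)) _
      ((A.hasFDerivAt_trans hj hi').sub_const _)
  exact h1.const_smul (ρ i j)

lemma sum_gr_D (hρ : ρ.IsSubordinate fun i => (A.ψ i).source) (j : S) (w : F × G) :
    (∑ i ∈ ρ.fintsupport j, ρ i j • (A.gr j i j ∘L A.D i j j)) w =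
      (w.1 + (∑ i ∈ ρ.fintsupport j, ρ i j • (A.tang j i j ∘L ContinuousLinearMap.fst ℝ F G ∘L
        A.D i j j ∘L ContinuousLinearMap.inr ℝ F G)) w.2, w.2) := by
  have hs := ρ.sum_finsupport' _ (Set.mem_univ j) (ρ.finsupport_subset_fintsupport j)
  have h1 : (∑ i ∈ ρ.fintsupport j, ρ i j • (A.gr j i j ∘L A.D i j j)) w =
      ∑ i ∈ ρ.fintsupport j, (ρ i j • w + ρ i j • (A.tang j i j (A.D i j j (0, w.2)).1, (0 : G))) := by
    rw [sum_apply]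
    refine Finset.sum_congr rfl fun i hi => ?_
    have h2 := A.gr_D (hρ i ((ρ.mem_fintsupport_iff j i).1 hi)) (A.mem_source j) w
    change ρ i j • A.gr j i j (A.D i j j w) = _
    rw [h2]
    ext <;> simp
  rw [h1, Finset.sum_add_distrib, ← Finset.sum_smul, hs, one_smul]
  ext <;> simp [Prod.fst_sum, Prod.snd_sum, sum_apply]

variable [FiniteDimensional ℝ F] [FiniteDimensional ℝ G]

/-- The chart sends a point to its foot point, where the tangential displacement vanishes, and to
its normal displacement. The last clause says that nearby the foot point is unique, which is the
input for the gluing. -/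
theorem exists_tubularChart (hρ : ρ.IsSubordinate fun i => (A.ψ i).source)
    (j : S) :
    ∃ h : OpenPartialHomeomorph (F × G) (F × G), (A.ψ j j, 0) ∈ h.source ∧ h (A.ψ j j, 0) = (A.ψ j j, 0) ∧
      ContDiffOn ℝ ∞ h h.source ∧ ContDiffOn ℝ ∞ h.symm h.target ∧
      (∀ v, (fderiv ℝ h.symm (A.ψ j j, 0) v).2 = v.2) ∧
      (∀ x ∈ (A.Φ j).source, A.Φ j x ∈ h.source → (h (A.Φ j x)).1 ∈ (A.ψ j).target ∧
        A.disp ρ j ((A.ψ j).symm (h (A.Φ j x)).1) x = (0, (h (A.Φ j x)).2)) ∧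
      ∃ U ∈ 𝓝 (ι j), ∃ W ∈ 𝓝 j, ∀ x ∈ U, ∀ s ∈ W, ∀ v, A.disp ρ j s x = (0, v) →
        s ∈ (A.ψ j).source ∧ x ∈ (A.Φ j).source ∧ A.Φ j x ∈ h.source ∧
          h (A.Φ j x) = (A.ψ j s, v) := by
  obtain ⟨W, hWo, hjW, hW⟩ := A.exists_nhds_finsupport hρ j
  have hW' : ∀ s ∈ W, s ∈ (A.ψ j).source ∧ ∀ i ∈ ρ.fintsupport j, s ∈ (A.ψ i).source :=
    fun s hs => ⟨(hW s hs).1, (hW s hs).2.2⟩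
  have hj := A.mem_source j
  have hO := A.isOpen_dispDomain (ρ := ρ) j hWo
  have hd := A.contDiffOn_dispCoord hW'
  have h₀ : (A.ψ j j, ((A.ψ j j, 0) : F × G)) ∈ A.dispDomain ρ j W := by
    refine ⟨⟨(A.ψ j).map_source hj, ?_⟩, ?_, Set.mem_iInter₂.2 fun i hi =>
      A.mem_trans_source hj ((hW j hjW).2.2 i hi)⟩
    · change (A.ψ j).symm (A.ψ j j) ∈ W
      rwa [(A.ψ j).left_inv hj]
    · rw [← A.Φ_ι hj]
      exact (A.Φ j).map_source (A.ι_mem hj)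
  have hB (w : F × G) : fderiv ℝ (A.dispCoord ρ j) (A.ψ j j, (A.ψ j j, 0)) (0, w) =
      (w.1 + (∑ i ∈ ρ.fintsupport j, ρ i j • (A.tang j i j ∘L ContinuousLinearMap.fst ℝ F G ∘L
        A.D i j j ∘L ContinuousLinearMap.inr ℝ F G)) w.2, w.2) := by
    rw [← A.sum_gr_D hρ j w]
    have h1 : HasFDerivAt (A.dispCoord ρ j) (fderiv ℝ (A.dispCoord ρ j) (A.ψ j j, (A.ψ j j, 0)))
        (A.ψ j j, (A.ψ j j, 0)) :=
      (((hd _ h₀).contDiffAt (hO.mem_nhds h₀)).differentiableAt (by simp)).hasFDerivAt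
    have h2 : HasFDerivAt (fun p : F × G => (A.ψ j j, p))
        ((0 : (F × G) →L[ℝ] F).prod (.id ℝ _)) (A.ψ j j, 0) :=
      (hasFDerivAt_const _ _).prodMk (hasFDerivAt_id _)
    have h3 := HasFDerivAt.comp (f := fun p : F × G => (A.ψ j j, p)) _ h1 h2
    exact congrArg (fun L => L w) (h3.unique (A.hasFDerivAt_dispCoord hρ))
  obtain ⟨h, T, a1, a2, a3, a4, a5, a6, a7, a8, a9⟩ :=
    exists_chart_of_relation hO hd h₀ (fun t ht => A.dispCoord_zero hW' ht) hB
  refine ⟨h, a1, a2, a3, a4, a5, fun x hx hxh => ?_, ?_⟩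
  · obtain ⟨h1, h2⟩ := a6 _ hxh
    have h3 := hW _ h1.1.2
    refine ⟨h1.1.1, ?_⟩
    rw [← A.dispCoord_eq h3.1 hx h3.2.1, (A.ψ j).right_inv h1.1.1, h2]
  · have hc : ContinuousAt (fun c : M × S => (A.ψ j c.2, A.Φ j c.1)) (ι j, j) :=
      ContinuousAt.prodMk
        (((A.ψ j).continuousAt hj).comp (f := Prod.snd) (x := (ι j, j)) continuousAt_snd)
        (((A.Φ j).continuousAt (A.ι_mem hj)).comp (f := Prod.fst) (x := (ι j, j)) continuousAt_fst)
    have h1 : (fun c : M × S => (A.ψ j c.2, A.Φ j c.1)) ⁻¹' T ∈ 𝓝 (ι j, j) := by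
      refine hc.preimage_mem_nhds (a7.mem_nhds ?_)
      change (A.ψ j j, A.Φ j (ι j)) ∈ T
      rwa [A.Φ_ι hj]
    rw [nhds_prod_eq] at h1
    obtain ⟨U, hU, W', hW'', hUW⟩ := Filter.mem_prod_iff.1 h1
    refine ⟨U ∩ (A.Φ j).source, Filter.inter_mem hU ((A.Φ j).open_source.mem_nhds (A.ι_mem hj)),
      W' ∩ W, Filter.inter_mem hW'' (hWo.mem_nhds hjW), fun x hx s hs v hv => ?_⟩
    have h3 := hW s hs.2
    rw [← A.dispCoord_eq h3.1 hx.2 h3.2.1] at hv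
    exact ⟨h3.1, hx.2, a9 _ _ _ (hUW (Set.mk_mem_prod hx.1 hs.1)) hv⟩

end SliceAtlas

end Slice

end SemilocalPoisson

namespace SemilocalPoisson

/-! ### Charts of the total space and fibres of the normal bundle. -/

section Slice

variable {E : Type*} [NormedAddCommGroup E] [NormedSpace ℝ E]
  {M : Type*} [TopologicalSpace M] [ChartedSpace E M]
  {F : Type*} [NormedAddCommGroup F] [NormedSpace ℝ F]
  {S : Type*} [TopologicalSpace S] [ChartedSpace F S]
  {G : Type*} [NormedAddCommGroup G] [NormedSpace ℝ G]

namespace SliceAtlas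

variable {ι : S → M} (A : SliceAtlas E F G ι)

/-- Charts of the total space of the normal bundle. -/
def χ (j : S) : OpenPartialHomeomorph (Bundle.TotalSpace G A.core.Fiber) (F × G) :=
  (A.core.localTriv j).toOpenPartialHomeomorph.trans ((A.ψ j).prod (OpenPartialHomeomorph.refl G))

lemma χ_apply (j s : S) (v : A.core.Fiber s) :
    A.χ j ⟨s, v⟩ = (A.ψ j s, A.norm j s s (show G from v)) := rfl

lemma mem_χ_source {j : S} {y : Bundle.TotalSpace G A.core.Fiber} :
    y ∈ (A.χ j).source ↔ y.proj ∈ (A.ψ j).source := by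
  constructor
  · exact fun h => ((A.core.mem_localTriv_source j y).1 h.1)
  · exact fun h => ⟨(A.core.mem_localTriv_source j y).2 h, h, Set.mem_univ _⟩

lemma mem_χ_target {j : S} {c : F × G} (hc : c.1 ∈ (A.ψ j).target) : c ∈ (A.χ j).target := by
  refine ⟨⟨hc, Set.mem_univ _⟩, (A.core.mem_localTriv_target j _).2 ?_⟩
  exact (A.ψ j).map_target hc

lemma χ_zero (s : S) : A.χ s (⟨s, 0⟩ : Bundle.TotalSpace G A.core.Fiber) = (A.ψ s s, 0) := by
  rw [χ_apply]
  exact Prod.ext rfl (map_zero _)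

instance (j : S) : MemTrivializationAtlas (A.core.localTriv j) := ⟨⟨j, rfl⟩⟩

variable [IsManifold 𝓘(ℝ, F) ∞ S]

lemma contMDiffOn_χ (j : S) :
    ContMDiffOn (𝓘(ℝ, F).prod 𝓘(ℝ, G)) 𝓘(ℝ, F × G) ∞ (A.χ j) (A.χ j).source := by
  have h1 := (A.core.localTriv j).contMDiffOn (IB := 𝓘(ℝ, F)) (n := ∞)
  have h2 : ContMDiffOn (𝓘(ℝ, F).prod 𝓘(ℝ, G)) 𝓘(ℝ, F × G) ∞ (fun c : S × G => (A.ψ j c.1, c.2))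
      (Prod.fst ⁻¹' (A.ψ j).source) :=
    ((A.contMDiffOn_ψ j).comp contMDiffOn_fst fun c hc => hc).prodMk_space contMDiffOn_snd
  exact h2.comp (h1.mono fun y hy => hy.1) fun y hy => hy.2.1

lemma contMDiffOn_χ_symm (j : S) :
    ContMDiffOn 𝓘(ℝ, F × G) (𝓘(ℝ, F).prod 𝓘(ℝ, G)) ∞ (A.χ j).symm (A.χ j).target := by
  have h1 := (A.core.localTriv j).contMDiffOn_symm (IB := 𝓘(ℝ, F)) (n := ∞)
  have h2 : ContMDiffOn 𝓘(ℝ, F × G) (𝓘(ℝ, F).prod 𝓘(ℝ, G)) ∞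
      (fun c : F × G => ((A.ψ j).symm c.1, c.2)) (Prod.fst ⁻¹' (A.ψ j).target) :=
    ((A.contMDiffOn_ψ_symm j).comp contDiff_fst.contMDiff.contMDiffOn fun c hc => hc).prodMk
      contDiff_snd.contMDiff.contMDiffOn
  exact h1.comp (h2.mono fun y hy => hy.1.1) fun y hy => hy.2

lemma mdifferentiable_Φ (s : S) : (A.Φ s).MDifferentiable 𝓘(ℝ, E) 𝓘(ℝ, F × G) :=
  ⟨(A.contMDiffOn_Φ s).mdifferentiableOn (by simp),
    (A.contMDiffOn_Φ_symm s).mdifferentiableOn (by simp)⟩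

lemma mdifferentiable_ψ (s : S) : (A.ψ s).MDifferentiable 𝓘(ℝ, F) 𝓘(ℝ, F) :=
  ⟨(A.contMDiffOn_ψ s).mdifferentiableOn (by simp),
    (A.contMDiffOn_ψ_symm s).mdifferentiableOn (by simp)⟩

/-- The differential of a slice chart. -/
def dΦ (s : S) : TangentSpace 𝓘(ℝ, E) (ι s) →L[ℝ] F × G :=
  mfderiv 𝓘(ℝ, E) 𝓘(ℝ, F × G) (A.Φ s) (ι s)

lemma bijective_dΦ (s : S) : Function.Bijective (A.dΦ s) :=
  (A.mdifferentiable_Φ s).mfderiv_bijective (A.ι_mem (A.mem_source s))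

lemma hasMFDerivAt_Φ (s : S) :
    HasMFDerivAt 𝓘(ℝ, E) 𝓘(ℝ, F × G) (A.Φ s) (ι s) (A.dΦ s) :=
  ((A.mdifferentiable_Φ s).mdifferentiableAt (A.ι_mem (A.mem_source s))).hasMFDerivAt

lemma dΦ_mfderiv (hι : ContMDiff 𝓘(ℝ, F) 𝓘(ℝ, E) ∞ ι) (s : S) (a : TangentSpace 𝓘(ℝ, F) s) :
    A.dΦ s (mfderiv 𝓘(ℝ, F) 𝓘(ℝ, E) ι s a) =
      ((mfderiv 𝓘(ℝ, F) 𝓘(ℝ, F) (A.ψ s) s a : F), (0 : G)) := by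
  have h1 := (A.hasMFDerivAt_Φ s).comp s ((hι s).mdifferentiableAt (by simp)).hasMFDerivAt
  have h2 : HasFDerivAt (fun t : F => ((t, 0) : F × G)) ((ContinuousLinearMap.id ℝ F).prod 0)
    (A.ψ s s) := (hasFDerivAt_id _).prodMk (hasFDerivAt_const _ _)
  have h3 := h2.hasMFDerivAt.comp s
    ((A.mdifferentiable_ψ s).mdifferentiableAt (A.mem_source s)).hasMFDerivAt
  have h4 : A.Φ s ∘ ι =ᶠ[𝓝 s] (fun t : F => ((t, 0) : F × G)) ∘ A.ψ s := by
    filter_upwards [(A.ψ s).open_source.mem_nhds (A.mem_source s)] with x hx using A.Φ_ι hx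
  exact congrArg (fun L => L a) (hasMFDerivAt_unique h1 (h3.congr_of_eventuallyEq h4))

/-- The differential of the normal coordinate of a slice chart. -/
def normalCoord (s : S) : TangentSpace 𝓘(ℝ, E) (ι s) →ₗ[ℝ] G :=
  (LinearMap.snd ℝ F G) ∘ₗ (A.dΦ s).toLinearMap

lemma ker_normalCoord (hι : ContMDiff 𝓘(ℝ, F) 𝓘(ℝ, E) ∞ ι) (s : S) :
    LinearMap.ker (A.normalCoord s) = (mfderiv 𝓘(ℝ, F) 𝓘(ℝ, E) ι s).range := by
  ext w
  rw [LinearMap.mem_ker]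
  constructor
  · intro hw
    obtain ⟨a, ha⟩ := (A.mdifferentiable_ψ s).mfderiv_surjective (A.mem_source s) (A.dΦ s w).1
    refine ⟨a, (A.bijective_dΦ s).1 ((A.dΦ_mfderiv hι s a).trans ?_)⟩
    exact Prod.ext ha hw.symm
  · rintro ⟨a, rfl⟩
    exact congrArg Prod.snd (A.dΦ_mfderiv hι s a)

lemma surjective_normalCoord (s : S) : Function.Surjective (A.normalCoord s) :=
  Prod.snd_surjective.comp (A.bijective_dΦ s).2

/-- The fibres of the normal bundle. -/
def normalEquiv (hι : ContMDiff 𝓘(ℝ, F) 𝓘(ℝ, E) ∞ ι) (s : S) :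
    A.core.Fiber s ≃ₗ[ℝ] NormalSpace E F ι s :=
  ((Submodule.quotEquivOfEq _ _ (A.ker_normalCoord hι s).symm).trans
    ((A.normalCoord s).quotKerEquivOfSurjective (A.surjective_normalCoord s))).symm

lemma normalEquiv_normalCoord (hι : ContMDiff 𝓘(ℝ, F) 𝓘(ℝ, E) ∞ ι) (s : S)
    (w : TangentSpace 𝓘(ℝ, E) (ι s)) :
    A.normalEquiv hι s (show G from A.normalCoord s w) = Submodule.Quotient.mk w :=
  (LinearEquiv.symm_apply_eq _).2 rfl

end SliceAtlas

end Slice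

end SemilocalPoisson

namespace SemilocalPoisson

/-! ### Local tubes and their gluing. -/

section Slice

universe u

namespace SliceAtlas

variable {E : Type*} [NormedAddCommGroup E] [NormedSpace ℝ E]
  {M : Type*} [TopologicalSpace M] [ChartedSpace E M]
  {F : Type*} [NormedAddCommGroup F] [NormedSpace ℝ F] [FiniteDimensional ℝ F]
  {S : Type*} [TopologicalSpace S] [ChartedSpace F S] [IsManifold 𝓘(ℝ, F) ∞ S]
  {G : Type*} [NormedAddCommGroup G] [NormedSpace ℝ G] [FiniteDimensional ℝ G]
  {ι : S → M} (A : SliceAtlas E F G ι)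
  {ρ : SmoothPartitionOfUnity S 𝓘(ℝ, F) S}

/-- The last clause constrains both `x` and the image of the foot point by one neighborhood in `M`.
This is where an embedding is needed: neighborhoods in `S` must be traces of neighborhoods in `M`.
-/
theorem exists_localTube (hι : Topology.IsEmbedding ι)
    (hρ : ρ.IsSubordinate fun i => (A.ψ i).source) (j : S) :
    ∃ h : OpenPartialHomeomorph M (Bundle.TotalSpace G A.core.Fiber),
      ι j ∈ h.source ∧ h (ι j) = ⟨j, 0⟩ ∧
      ContMDiffOn 𝓘(ℝ, E) (𝓘(ℝ, F).prod 𝓘(ℝ, G)) ∞ h h.source ∧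
      ContMDiffOn (𝓘(ℝ, F).prod 𝓘(ℝ, G)) 𝓘(ℝ, E) ∞ h.symm h.target ∧
      (∀ v : A.core.Fiber j, A.normalCoord j (mfderiv 𝓘(ℝ, ℝ) 𝓘(ℝ, E)
        (fun t : ℝ => h.symm ⟨j, t • v⟩) 0 (1 : ℝ)) = v) ∧
      (∀ x ∈ h.source, A.disp ρ (h x).proj (h x).proj x = (0, (h x).2)) ∧
      ∃ U ∈ 𝓝 (ι j), ∀ x ∈ U, ∀ y : Bundle.TotalSpace G A.core.Fiber, ι y.proj ∈ U →
        A.disp ρ y.proj y.proj x = (0, y.2) → x ∈ h.source ∧ h x = y := by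
  obtain ⟨k, k1, k2, k3, k4, k5, k6, U, hU, W, hW, hUW⟩ := A.exists_tubularChart hρ j
  have hj := A.mem_source j
  let l := (A.Φ j).trans (k.trans (A.χ j).symm)
  have hl {x} (hx : x ∈ (A.Φ j).source) (hk : A.Φ j x ∈ k.source)
      (hc : (k (A.Φ j x)).1 ∈ (A.ψ j).target) : x ∈ l.source :=
    ⟨hx, hk, A.mem_χ_target hc⟩
  have hχ {x} (hx : x ∈ l.source) : A.χ j (l x) = k (A.Φ j x) := (A.χ j).right_inv hx.2.2
  have hlj : ι j ∈ l.source := by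
    have h1 := A.Φ_ι hj
    refine hl (A.ι_mem hj) (by rwa [h1]) ?_
    rw [h1, k2]
    exact (A.ψ j).map_source hj
  have hlj' : l (ι j) = ⟨j, 0⟩ := by
    change (A.χ j).symm (k (A.Φ j (ι j))) = _
    rw [A.Φ_ι hj, k2, ← A.χ_zero]
    exact (A.χ j).left_inv (A.mem_χ_source.2 hj)
  refine ⟨l, hlj, hlj', ?_, ?_, fun v => ?_, fun x hx => ?_, ?_⟩
  · exact (A.contMDiffOn_χ_symm j).comp (k3.contMDiffOn.comp ((A.contMDiffOn_Φ j).mono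
      fun x hx => hx.1) fun x hx => hx.2.1) fun x hx => hx.2.2
  · exact (A.contMDiffOn_Φ_symm j).comp (k4.contMDiffOn.comp ((A.contMDiffOn_χ j).mono
      fun y hy => hy.1.1) fun y hy => hy.1.2) fun y hy => hy.2
  · have e1 : k.symm (A.ψ j j, 0) = (A.ψ j j, 0) := by
      have := k.left_inv k1
      rwa [k2] at this
    have e2 : ((A.ψ j j, 0) : F × G) ∈ k.target := by
      have := k.map_source k1
      rwa [k2] at this
    have e3 : ((A.ψ j j, 0) : F × G) ∈ (A.Φ j).target := by
      rw [← A.Φ_ι hj]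
      exact (A.Φ j).map_source (A.ι_mem hj)
    let w : G := v
    -- The curve is read in the slice chart, where its normal velocity is `w` because the inverse of
    -- `k` preserves normal components to first order.
    let d : ℝ → F × G := fun t => k.symm (A.ψ j j, t • w)
    let c : ℝ → M := fun t => (A.Φ j).symm (d t)
    have hc : (fun t : ℝ => l.symm ⟨j, t • v⟩) = c := by
      funext t
      change (A.Φ j).symm (k.symm (A.χ j ⟨j, t • v⟩)) = (A.Φ j).symm (k.symm (A.ψ j j, t • w))
      rw [A.χ_apply]
      exact congrArg (fun u => (A.Φ j).symm (k.symm (A.ψ j j, u))) (A.norm_self hj _)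
    have hd0 : d 0 = (A.ψ j j, 0) := by
      change k.symm (A.ψ j j, (0 : ℝ) • w) = _
      rw [zero_smul, e1]
    have hc0 : c 0 = ι j := by
      change (A.Φ j).symm (d 0) = _
      rw [hd0, ← A.Φ_ι hj, (A.Φ j).left_inv (A.ι_mem hj)]
    have hk : HasFDerivAt k.symm (fderiv ℝ k.symm (A.ψ j j, 0)) (A.ψ j j, (0 : ℝ) • w) := by
      rw [zero_smul]
      exact (((k4 _ e2).contDiffAt (k.open_target.mem_nhds e2)).differentiableAt
        (by simp)).hasFDerivAt
    have hs : HasFDerivAt (fun t : ℝ => (A.ψ j j, t • w))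
        ((0 : ℝ →L[ℝ] F).prod ((ContinuousLinearMap.id ℝ ℝ).smulRight w)) 0 :=
      (hasFDerivAt_const _ _).prodMk ((hasFDerivAt_id _).smul_const w)
    have hd := HasFDerivAt.comp (f := fun t : ℝ => (A.ψ j j, t • w)) _ hk hs
    have hcd : MDifferentiableAt 𝓘(ℝ, ℝ) 𝓘(ℝ, E) c 0 := by
      refine MDifferentiableAt.comp (I' := 𝓘(ℝ, F × G)) (g := (A.Φ j).symm) (f := d) 0 ?_
        hd.hasMFDerivAt.mdifferentiableAt
      rw [hd0]
      exact (A.mdifferentiable_Φ j).mdifferentiableAt_symm e3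
    have hΦ : HasMFDerivAt 𝓘(ℝ, E) 𝓘(ℝ, F × G) (A.Φ j) (c 0) (A.dΦ j) := by
      rw [hc0]
      exact A.hasMFDerivAt_Φ j
    have hcomp := hΦ.comp 0 hcd.hasMFDerivAt
    have hev : A.Φ j ∘ c =ᶠ[𝓝 0] d := by
      have h1 : d ⁻¹' (A.Φ j).target ∈ 𝓝 0 := by
        refine hd.continuousAt.preimage_mem_nhds ((A.Φ j).open_target.mem_nhds ?_)
        change d 0 ∈ (A.Φ j).target
        rwa [hd0]
      filter_upwards [h1] with t ht using (A.Φ j).right_inv ht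
    have h2 := hasMFDerivAt_unique hcomp (hd.hasMFDerivAt.congr_of_eventuallyEq hev)
    have h3 := congrArg (fun L : ℝ →L[ℝ] F × G => (L 1).2) h2
    rw [hc]
    refine h3.trans ((k5 _).trans ?_)
    exact one_smul ℝ w
  · have h1 := k6 x hx.1 hx.2.1
    rw [← hχ hx] at h1
    have h2 : (l x).proj ∈ (A.ψ j).source := A.mem_χ_source.1 (l.map_source hx).1.1
    generalize l x = y at h1 h2
    obtain ⟨s, v⟩ := y
    rw [A.χ_apply] at h1
    have h3 := h1.2
    rw [(A.ψ j).left_inv h2] at h3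
    -- The relation is transferred from the chart at `j` to the chart at the foot point, in which
    -- the fibre coordinate is the vector itself.
    have h4 := A.gr_disp hρ h2 (A.mem_source s) x
    rw [h3, A.gr_apply] at h4
    refine h4.symm.trans (Prod.ext (map_zero _) ?_)
    exact (A.norm_comp (A.mem_source s) h2 (A.mem_source s) _).trans (A.norm_self (A.mem_source s) _)
  · have hW₂ := Filter.inter_mem hW ((A.ψ j).open_source.mem_nhds hj)
    rw [hι.isInducing.nhds_eq_comap, Filter.mem_comap] at hW₂
    obtain ⟨W', hW', hWW⟩ := hW₂
    refine ⟨U ∩ W', Filter.inter_mem hU hW', fun x hx y hy hR => ?_⟩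
    obtain ⟨s, v⟩ := y
    obtain ⟨hs1, hs2⟩ := hWW hy.2
    have h1 := (congrArg (A.gr j s s) hR).symm.trans (A.gr_disp hρ (A.mem_source s) hs2 x)
    have h2 : A.disp ρ j s x = (0, A.norm j s s (show G from v)) :=
      h1.symm.trans ((A.gr_apply j s s _).trans (Prod.ext (map_zero (A.tang j s s)) rfl))
    obtain ⟨-, h3, h4, h5⟩ := hUW x hx.1 s hs1 _ h2
    refine ⟨hl h3 h4 (by rw [h5]; exact (A.ψ j).map_source hs2), ?_⟩
    change (A.χ j).symm (k (A.Φ j x)) = _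
    rw [h5]
    exact (A.χ j).left_inv (A.mem_χ_source.2 hs2)

end SliceAtlas

open TopologicalSpace in
/-- Existence of tubular neighborhoods. -/
theorem exists_tubularNeighborhood {E : Type u} [NormedAddCommGroup E] [NormedSpace ℝ E]
    [FiniteDimensional ℝ E] {M : Type*} [TopologicalSpace M] [ChartedSpace E M]
    [IsManifold 𝓘(ℝ, E) ∞ M] [T2Space M] [SecondCountableTopology M]
    {F : Type*} [NormedAddCommGroup F] [NormedSpace ℝ F] [FiniteDimensional ℝ F]
    {S : Type*} [TopologicalSpace S] [ChartedSpace F S] [IsManifold 𝓘(ℝ, F) ∞ S] [Nonempty S]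
    {ι : S → M} (hι : Manifold.IsSmoothEmbedding 𝓘(ℝ, F) 𝓘(ℝ, E) ∞ ι) :
    Nonempty (TubularNeighborhood E F ι) := by
  have hs := hι.isImmersion.contMDiff
  have : T2Space S := hι.isEmbedding.t2Space
  have : SecondCountableTopology S := hι.isEmbedding.isInducing.secondCountableTopology
  have : LocallyCompactSpace S := Manifold.locallyCompact_of_finiteDimensional 𝓘(ℝ, F)
  have : LocallyCompactSpace M := Manifold.locallyCompact_of_finiteDimensional 𝓘(ℝ, E)
  obtain ⟨G, _, _, _, ⟨A⟩⟩ := exists_sliceAtlas hι.isImmersion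
  obtain ⟨ρ, hρ⟩ := SmoothPartitionOfUnity.exists_isSubordinate 𝓘(ℝ, F) (isClosed_univ (X := S))
    (fun i => (A.ψ i).source) (fun i => (A.ψ i).open_source)
    fun s _ => Set.mem_iUnion.2 ⟨s, A.mem_source s⟩
  choose h h1 h2 h3 h4 h5 h6 U hU h7 using A.exists_localTube hι.isEmbedding hρ
  -- The metric serves only to compare the sizes of the neighborhoods on which the foot point is
  -- unique.
  let : MetricSpace M := metrizableSpaceMetric M
  choose ε hε hεU using fun j => Metric.mem_nhds_iff.1 (hU j)
  have hq : Continuous fun y : Bundle.TotalSpace G A.core.Fiber => ι y.proj :=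
    hs.continuous.comp A.core.continuous_proj
  obtain ⟨f, O, hf, hO⟩ := exists_glued_openPartialHomeomorph hq ι
    (fun x y => A.disp ρ y.proj y.proj x = (0, y.2)) h ε hε h1
    (fun j => by rw [h2 j]) h6
    (fun j x y hx hy hR => h7 j x (hεU j hx) y (hεU j hy) hR)
  have hmem (j) : O j ⊆ f.source := hf ▸ Set.subset_iUnion O j
  have hfι (j) : f (ι j) = ⟨j, 0⟩ := ((hO j).2.2.2 (hO j).2.1).trans (h2 j)
  -- Near `f x` the glued inverse is a local inverse, so its smoothness and its normal derivative
  -- are inherited from the local tubes.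
  have hfs (j) {x} (hx : x ∈ O j) : ∀ᶠ y in 𝓝 (f x), f.symm y = (h j).symm y := by
    have hx' := hmem j hx
    filter_upwards [(f.continuousAt_symm (f.map_source hx')).preimage_mem_nhds
      ((hO j).1.mem_nhds (by rwa [f.left_inv hx'])), f.open_target.mem_nhds (f.map_source hx')]
      with y hy hyt
    have hy1 : y = h j (f.symm y) := (f.right_inv hyt).symm.trans ((hO j).2.2.2 hy)
    exact ((congrArg (h j).symm hy1).trans ((h j).left_inv ((hO j).2.2.1 hy))).symm
  exact ⟨{
    G := G
    V := A.core.Fiber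
    f := f.symm
    contMDiffOn_f := by
      intro y hy
      have hy' : f.symm y ∈ f.source := f.map_target hy
      rw [hf] at hy'
      obtain ⟨j, hj⟩ := Set.mem_iUnion.1 hy'
      have e1 := hfs j hj
      rw [f.right_inv hy] at e1
      have e2 : y ∈ (h j).target := by
        have := (h j).map_source ((hO j).2.2.1 hj)
        rwa [← (hO j).2.2.2 hj, f.right_inv hy] at this
      exact (((h4 j _ e2).contMDiffAt ((h j).open_target.mem_nhds e2)).congr_of_eventuallyEq
        e1).contMDiffWithinAt
    contMDiffOn_symm := by
      intro x hx
      have hx' : x ∈ f.source := hx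
      rw [hf] at hx'
      obtain ⟨j, hj⟩ := Set.mem_iUnion.1 hx'
      have e2 := (hO j).2.2.1 hj
      refine (((h3 j _ e2).contMDiffAt ((h j).open_source.mem_nhds e2)).congr_of_eventuallyEq
        ?_).contMDiffWithinAt
      filter_upwards [(hO j).1.mem_nhds hj] with z hz using (hO j).2.2.2 hz
    zero_mem := fun s => by
      rw [← hfι]
      exact f.map_source (hmem s (hO s).2.1)
    f_zero := fun s => by
      rw [← hfι]
      exact f.left_inv (hmem s (hO s).2.1)
    normal := A.normalEquiv hs
    normal_eq := fun s v => by
      have e1 := hfs s (hO s).2.1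
      rw [hfι] at e1
      have e2 : Filter.Tendsto (fun t : ℝ => (⟨s, t • v⟩ : Bundle.TotalSpace G A.core.Fiber))
          (𝓝 0) (𝓝 ⟨s, 0⟩) := by
        have e := (FiberBundle.continuous_totalSpaceMk G A.core.Fiber s).comp
          (continuous_id.smul continuous_const : Continuous fun t : ℝ => t • (show G from v))
        refine (e.tendsto 0).trans (le_of_eq (congrArg 𝓝 ?_))
        exact congrArg (Bundle.TotalSpace.mk (E := A.core.Fiber) s) (zero_smul ℝ (show G from v))
      have e3 : (fun t : ℝ => f.symm ⟨s, t • v⟩) =ᶠ[𝓝 0] fun t : ℝ => (h s).symm ⟨s, t • v⟩ :=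
        e2.eventually e1
      have e4 : mfderiv 𝓘(ℝ, ℝ) 𝓘(ℝ, E) (fun t : ℝ => f.symm ⟨s, t • v⟩) 0 =
        mfderiv 𝓘(ℝ, ℝ) 𝓘(ℝ, E) (fun t : ℝ => (h s).symm ⟨s, t • v⟩) 0 := e3.mfderiv_eq
      have e5 := h5 s v
      refine Eq.trans ?_ ((A.normalEquiv_normalCoord hs s _).symm.trans
        (congrArg (A.normalEquiv hs s) e5))
      exact congrArg (fun L : ℝ →L[ℝ] E => (Submodule.Quotient.mk (L 1) : NormalSpace E F ι s)) e4 }⟩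

end Slice

end SemilocalPoisson

namespace SemilocalPoisson

/-! ### Restriction to open subsets -/

section Restrict

open TopologicalSpace

variable {E : Type*} [NormedAddCommGroup E] [NormedSpace ℝ E]
  {M : Type*} [TopologicalSpace M] [ChartedSpace E M]

/-- The charts of an open subset are restrictions of those of `M`, in which the inclusion is the
identity. -/
lemma hasMFDerivAt_opens_val (U : Opens M) (x : U) :
    HasMFDerivAt 𝓘(ℝ, E) 𝓘(ℝ, E) (Subtype.val : U → M) x (ContinuousLinearMap.id ℝ E) := by
  refine ⟨continuous_subtype_val.continuousAt, ?_⟩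
  have h1 : writtenInExtChartAt 𝓘(ℝ, E) 𝓘(ℝ, E) x (Subtype.val : U → M) =ᶠ[𝓝 (chartAt E x x)] id := by
    filter_upwards [(chartAt E x).open_target.mem_nhds ((chartAt E x).map_source
      (mem_chart_source E x))] with y hy
    exact (chartAt E x).right_inv hy
  exact ((hasFDerivAt_id _).congr_of_eventuallyEq h1).hasFDerivWithinAt

lemma mfderiv_opens_val (U : Opens M) (x : U) :
    mfderiv 𝓘(ℝ, E) 𝓘(ℝ, E) (Subtype.val : U → M) x = ContinuousLinearMap.id ℝ E :=
  (hasMFDerivAt_opens_val U x).mfderiv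

lemma mfderiv_comp_opens_val {F : Type*} [NormedAddCommGroup F] [NormedSpace ℝ F]
    {S : Type*} [TopologicalSpace S] [ChartedSpace F S] {U : Opens M} {q : M → S} {x : U}
    (hq : MDifferentiableAt 𝓘(ℝ, E) 𝓘(ℝ, F) q x) :
    mfderiv 𝓘(ℝ, E) 𝓘(ℝ, F) (fun y : U => q y) x = mfderiv 𝓘(ℝ, E) 𝓘(ℝ, F) q x :=
  (HasMFDerivAt.comp x hq.hasMFDerivAt (hasMFDerivAt_opens_val U x)).mfderiv

/-- Restriction of smooth functions to an open subset. -/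
def SmoothFn.restrict (U : Opens M) (f : SmoothFn E M) : SmoothFn E U :=
  ⟨fun x => f x, f.contMDiff.comp contMDiff_subtype_val⟩

lemma dAt_restrict {U : Opens M} (f : SmoothFn E M) (x : U) :
    dAt x (f.restrict U) = dAt (x : M) f :=
  mfderiv_comp_opens_val (f.mdifferentiableAt x)

variable [FiniteDimensional ℝ E] [T2Space M] [IsManifold 𝓘(ℝ, E) ∞ M]

/-- Cutting off with a bump function supported in `U`. Brackets are local, so identities on `U` can
be deduced from those for global functions. -/
lemma exists_eventually_restrict_eq {U : Opens M} (f : SmoothFn E U) (x : U) :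
    ∃ g : SmoothFn E M, ∀ᶠ y in 𝓝 x, g.restrict U y = f y := by
  classical
  obtain ⟨b, -, hb⟩ := (SmoothBumpFunction.nhds_basis_tsupport (I := 𝓘(ℝ, E)) (x : M)).mem_iff.1
    (U.isOpen.mem_nhds x.2)
  let g : M → ℝ := fun y => b y * if h : y ∈ U then f ⟨y, h⟩ else 0
  have hg : ContMDiff 𝓘(ℝ, E) 𝓘(ℝ, ℝ) ∞ g := by
    refine contMDiff_of_tsupport fun y hy => ?_
    have hyU : y ∈ U := hb (tsupport_mul_subset_left hy)
    have h1 : ContMDiffAt 𝓘(ℝ, E) 𝓘(ℝ, ℝ) ∞ (fun z : U => b z * f z) ⟨y, hyU⟩ :=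
      ((b.contMDiff.comp contMDiff_subtype_val).mul f.contMDiff) ⟨y, hyU⟩
    refine (contMDiffAt_subtype_iff (U := U) (x := ⟨y, hyU⟩) (f := g)).1 ?_
    refine h1.congr_of_eventuallyEq (Filter.Eventually.of_forall fun z => ?_)
    simp [g]
  refine ⟨⟨g, hg⟩, ?_⟩
  filter_upwards [continuous_subtype_val.continuousAt.eventually b.eventuallyEq_one] with y hy
  change b y * (if h : (y : M) ∈ U then f ⟨y, h⟩ else 0) = f y
  rw [hy]
  simp

/-- Restriction of bivector fields to an open subset. -/
def BivectorField.restrict (Ψ : BivectorField 𝓘(ℝ, E) M) (U : Opens M) :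
    BivectorField 𝓘(ℝ, E) U where
  sharp x := Ψ.sharp (x : M)
  skew x := Ψ.skew (x : M)
  smooth f hf x := by
    obtain ⟨g, hg⟩ := exists_eventually_restrict_eq ⟨f, hf⟩ x
    -- Near `x` the Hamiltonian field of `f` is the pullback by the inclusion of the Hamiltonian
    -- field of the global function `g`.
    have h1 : ContMDiff 𝓘(ℝ, E) 𝓘(ℝ, E).tangent ∞ (fun y : U =>
        (⟨y, VectorField.mpullback 𝓘(ℝ, E) 𝓘(ℝ, E) (Subtype.val : U → M) (Ψ.hamField g) y⟩ :
          TangentBundle 𝓘(ℝ, E) U)) := by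
      refine (Ψ.hamField g).contMDiff.mpullback_vectorField (n := ∞) contMDiff_subtype_val
        (fun y => ?_) (by simp)
      rw [mfderiv_opens_val]
      exact ⟨.refl ℝ E, rfl⟩
    refine (h1 x).congr_of_eventuallyEq ?_
    filter_upwards [eventually_eventually_nhds.2 hg] with y hy
    refine congrArg (Bundle.TotalSpace.mk y) ?_
    rw [VectorField.mpullback_apply, mfderiv_opens_val]
    have h2 : mvfderiv 𝓘(ℝ, E) f y = dAt (y : M) g :=
      (dAt_congr (F := g.restrict U) (G := ⟨f, hf⟩) hy).symm.trans (dAt_restrict g y)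
    rw [h2]
    exact (congrArg (fun L : E →L[ℝ] E => L (Ψ.hamField g (y : M)))
      (ContinuousLinearMap.inverse_id (R := ℝ) (M := E))).symm

namespace BivectorField

variable (Ψ : BivectorField 𝓘(ℝ, E) M) (U : Opens M)

lemma related_restrict : Related Subtype.val (Ψ.restrict U) Ψ := by
  intro x α
  rw [mfderiv_opens_val]
  rfl

variable {Ψ U}

lemma br_congr {P : BivectorField 𝓘(ℝ, E) M} {f f' g g' : SmoothFn E M} {x : M}
    (hf : ∀ᶠ y in 𝓝 x, f y = f' y) (hg : ∀ᶠ y in 𝓝 x, g y = g' y) :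
    ∀ᶠ y in 𝓝 x, P.br f g y = P.br f' g' y := by
  filter_upwards [eventually_eventually_nhds.2 hf, eventually_eventually_nhds.2 hg] with y h1 h2
  rw [br_apply, br_apply, dAt_congr h1, dAt_congr h2]

lemma br_restrict (f g : SmoothFn E M) :
    (Ψ.restrict U).br (f.restrict U) (g.restrict U) = (Ψ.br f g).restrict U := by
  ext x
  rw [br_apply, dAt_restrict, dAt_restrict]
  rfl

lemma IsPoisson.restrict (hΨ : Ψ.IsPoisson) (U : Opens M) : (Ψ.restrict U).IsPoisson := by
  rw [isPoisson_iff] at hΨ ⊢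
  intro f g k
  ext x
  obtain ⟨f', hf⟩ := exists_eventually_restrict_eq f x
  obtain ⟨g', hg⟩ := exists_eventually_restrict_eq g x
  obtain ⟨k', hk⟩ := exists_eventually_restrict_eq k x
  have h1 := (br_congr (P := Ψ.restrict U) hf (br_congr (P := Ψ.restrict U) hg hk)).self_of_nhds
  have h2 := (br_congr (P := Ψ.restrict U) hg (br_congr (P := Ψ.restrict U) hk hf)).self_of_nhds
  have h3 := (br_congr (P := Ψ.restrict U) hk (br_congr (P := Ψ.restrict U) hf hg)).self_of_nhds
  simp only [br_restrict] at h1 h2 h3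
  have h4 := DFunLike.congr_fun (hΨ f' g' k') (x : M)
  change (Ψ.restrict U).br f ((Ψ.restrict U).br g k) x + (Ψ.restrict U).br g
    ((Ψ.restrict U).br k f) x + (Ψ.restrict U).br k ((Ψ.restrict U).br f g) x = 0
  rw [← h1, ← h2, ← h3]
  exact h4

end BivectorField

variable {F : Type*} [NormedAddCommGroup F] [NormedSpace ℝ F]
  {S : Type*} [TopologicalSpace S] [ChartedSpace F S]

lemma baseMap_restrict (Ψ : BivectorField 𝓘(ℝ, E) M) {U : Opens M} {q : M → S} {x : U}
    (hq : MDifferentiableAt 𝓘(ℝ, E) 𝓘(ℝ, F) q x) :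
    baseMap (F := F) (Ψ.restrict U) (fun y : U => q y) x = baseMap (F := F) Ψ q x := by
  ext a
  change mfderiv 𝓘(ℝ, E) 𝓘(ℝ, F) (fun y : U => q y) x (Ψ.sharp (x : M)
    (a ∘L mfderiv 𝓘(ℝ, E) 𝓘(ℝ, F) (fun y : U => q y) x)) = _
  rw [mfderiv_comp_opens_val hq]
  rfl

end Restrict

/-! ### Openness of transversality. -/

section Transverse

variable {E : Type*} [NormedAddCommGroup E] [NormedSpace ℝ E]
  {N : Type*} [TopologicalSpace N] [ChartedSpace E N] [IsManifold 𝓘(ℝ, E) ∞ N]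
  {F : Type*} [NormedAddCommGroup F] [NormedSpace ℝ F] [FiniteDimensional ℝ F]
  {S : Type*} [TopologicalSpace S] [ChartedSpace F S] [IsManifold 𝓘(ℝ, F) ∞ S] [T2Space S]

lemma bijective_baseMap_iff (Ψ : BivectorField 𝓘(ℝ, E) N) (q : N → S) (x : N) :
    Function.Bijective (baseMap (F := F) Ψ q x) ↔
      ∀ a, baseMap (F := F) Ψ q x a = 0 → a = 0 := by
  rw [← injective_iff_map_eq_zero]
  refine ⟨fun h => h.1, fun h => ⟨h, ?_⟩⟩
  have e : Module.finrank ℝ (TangentSpace 𝓘(ℝ, F) (q x) →L[ℝ] ℝ) =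
      Module.finrank ℝ (TangentSpace 𝓘(ℝ, F) (q x)) := by
    rw [← LinearEquiv.finrank_eq (LinearMap.toContinuousLinearMap (𝕜 := ℝ)
      (E := TangentSpace 𝓘(ℝ, F) (q x)) (F' := ℝ)), Subspace.dual_finrank_eq]
  exact (LinearMap.injective_iff_surjective_of_finrank_eq_finrank e).1 h

/-- In a dual frame of the base, bijectivity is the nonvanishing of the determinant of the matrix of
brackets of pulled back coordinates. -/
lemma isOpen_bijective_baseMap (Ψ : BivectorField 𝓘(ℝ, E) N) {q : N → S}
    (hq : ContMDiff 𝓘(ℝ, E) 𝓘(ℝ, F) ∞ q) :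
    IsOpen {x | Function.Bijective (baseMap (F := F) Ψ q x)} := by
  rw [isOpen_iff_mem_nhds]
  intro x₀ hx₀
  obtain ⟨y, w, hyw⟩ := exists_dual_frames (E := F) (q x₀)
  have hyw' := hq.continuous.continuousAt.eventually hyw
  let pull (f : SmoothFn F S) : SmoothFn E N := ⟨fun z => f (q z), f.contMDiff.comp hq⟩
  have hpull (f : SmoothFn F S) (z : N) : dAt z (pull f) =
      dAt (q z) f ∘L mfderiv 𝓘(ℝ, E) 𝓘(ℝ, F) q z :=
    mfderiv_comp z (f.mdifferentiableAt _) ((hq z).mdifferentiableAt (by simp))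
  let a : N → Matrix (Fin (Module.finrank ℝ F)) (Fin (Module.finrank ℝ F)) ℝ :=
    fun z i j => Ψ.br (pull (y i)) (pull (y j)) z
  have ha (z i j) : a z i j = dAt (q z) (y j) (baseMap (F := F) Ψ q z (dAt (q z) (y i))) := by
    change dAt z (pull (y j)) (Ψ.sharp z (dAt z (pull (y i)))) = _
    rw [hpull, hpull]
    rfl
  have hexp {z} (hz : ∀ v : TangentSpace 𝓘(ℝ, F) (q z), v = ∑ i, dAt (q z) (y i) v • w i (q z))
      (b : TangentSpace 𝓘(ℝ, F) (q z) →L[ℝ] ℝ) : ∑ j, b (w j (q z)) • dAt (q z) (y j) = b := by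
    ext v
    conv_rhs => rw [hz v]
    simp [mul_comm]
  have hcont : Continuous fun z => (a z).det := by
    refine Continuous.matrix_det (continuous_matrix fun i j => ?_)
    exact (Ψ.br (pull (y i)) (pull (y j))).contMDiff.continuous
  have h0 : (a x₀).det ≠ 0 := by
    intro h
    obtain ⟨c, hc0, hc⟩ := Matrix.exists_vecMul_eq_zero_iff.2 h
    have hx := hyw'.self_of_nhds
    have h1 : ∑ i, c i • dAt (q x₀) (y i) = 0 := by
      refine (bijective_baseMap_iff Ψ q x₀).1 hx₀ _ ?_
      rw [hx.2 (baseMap Ψ q x₀ _)]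
      refine Finset.sum_eq_zero fun j _ => ?_
      have h2 : dAt (q x₀) (y j) (baseMap (F := F) Ψ q x₀ (∑ i, c i • dAt (q x₀) (y i))) = 0 := by
        refine Eq.trans ?_ (congrFun hc j)
        simp only [map_sum, map_smul, Matrix.vecMul, dotProduct, ha, smul_eq_mul]
      rw [h2, zero_smul]
    refine hc0 (funext fun k => ?_)
    have h3 := congrArg (fun b => b (w k (q x₀))) h1
    simpa [sum_apply, hx.1] using h3
  filter_upwards [hyw', hcont.continuousAt.eventually_ne h0] with z hz hdet
  refine (bijective_baseMap_iff Ψ q z).2 fun b hb => ?_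
  have h1 : Matrix.vecMul (fun i => b (w i (q z))) (a z) = 0 := by
    funext j
    have h2 := congrArg (dAt (q z) (y j)) hb
    rw [← hexp hz.2 b] at h2
    simpa [map_sum, Matrix.vecMul, dotProduct, ha] using h2
  have h2 := Matrix.eq_zero_of_vecMul_eq_zero hdet h1
  rw [← hexp hz.2 b]
  exact Finset.sum_eq_zero fun i _ => by
    rw [show b (w i (q z)) = 0 from congrFun h2 i, zero_smul]

end Transverse

end SemilocalPoisson

namespace SemilocalPoisson

/-! ### Tubular neighborhoods of symplectic leaves -/

section Leaf

universe u

variable {E : Type u} [NormedAddCommGroup E] [NormedSpace ℝ E] [FiniteDimensional ℝ E]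
  {M : Type*} [TopologicalSpace M] [ChartedSpace E M] [IsManifold 𝓘(ℝ, E) ∞ M] [T2Space M]
  {F : Type*} [NormedAddCommGroup F] [NormedSpace ℝ F] [FiniteDimensional ℝ F]
  {S : Type*} [TopologicalSpace S] [ChartedSpace F S] [IsManifold 𝓘(ℝ, F) ∞ S]
  {ι : S → M}

namespace TubularNeighborhood

variable (T : TubularNeighborhood E F ι)

/-- Restriction of a tubular neighborhood to a smaller open neighborhood. -/
def restrict (W : Set M) (hW : IsOpen W) (hι : ∀ s, ι s ∈ W) : TubularNeighborhood E F ι where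
  G := T.G
  V := T.V
  f := T.f.trans (OpenPartialHomeomorph.ofSet W hW)
  contMDiffOn_f := T.contMDiffOn_f.mono fun _ h => h.1
  contMDiffOn_symm := T.contMDiffOn_symm.mono fun _ h => h.2
  zero_mem s := ⟨T.zero_mem s, by
    change T.f ⟨s, 0⟩ ∈ W
    rw [T.f_zero]
    exact hι s⟩
  f_zero := T.f_zero
  normal := T.normal
  normal_eq := T.normal_eq

/-- The projection of the tubular neighborhood, as a function on `M`. -/
def retr (x : M) : S := (T.f.symm x).proj

lemma retr_ι (s : S) : T.retr (ι s) = s := by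
  rw [retr, ← T.f_zero, T.f.left_inv (T.zero_mem s)]

lemma ι_mem (s : S) : ι s ∈ T.f.target := by
  rw [← T.f_zero]
  exact T.f.map_source (T.zero_mem s)

lemma contMDiffOn_retr : ContMDiffOn 𝓘(ℝ, E) 𝓘(ℝ, F) ∞ T.retr T.f.target :=
  (Bundle.contMDiff_proj T.V).comp_contMDiffOn T.contMDiffOn_symm

lemma mdifferentiableAt_retr {x : M} (hx : x ∈ T.f.target) :
    MDifferentiableAt 𝓘(ℝ, E) 𝓘(ℝ, F) T.retr x :=
  ((T.contMDiffOn_retr x hx).contMDiffAt (T.f.open_target.mem_nhds hx)).mdifferentiableAt (by simp)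

lemma contMDiff_proj : ContMDiff 𝓘(ℝ, E) 𝓘(ℝ, F) ∞ T.proj :=
  T.contMDiffOn_retr.comp_contMDiff contMDiff_subtype_val fun x => x.2

lemma mfderiv_retr_ι (hι : ContMDiff 𝓘(ℝ, F) 𝓘(ℝ, E) ∞ ι) (s : S) (v : F) :
    (mfderiv 𝓘(ℝ, E) 𝓘(ℝ, F) T.retr (ι s) : E →L[ℝ] F)
      ((mfderiv 𝓘(ℝ, F) 𝓘(ℝ, E) ι s : F →L[ℝ] E) v) = v := by
  have h1 := (T.mdifferentiableAt_retr (T.ι_mem s)).hasMFDerivAt.comp s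
    ((hι s).mdifferentiableAt (by simp)).hasMFDerivAt
  have h2 := (hasMFDerivAt_id (I := 𝓘(ℝ, F)) s).congr_of_eventuallyEq
    (f₁ := T.retr ∘ ι) (Filter.Eventually.of_forall T.retr_ι)
  exact congrArg (fun L : F →L[ℝ] F => L v) (hasMFDerivAt_unique h1 h2)

/-- If `a` is in the kernel, `Ψ♯(π^*a)` is both tangent to the leaf and vertical, hence zero. By
skew-symmetry `π^*a` then annihilates the range of `Ψ♯`, which is the tangent space of the leaf, so
`a = 0`. -/
lemma bijective_baseMap_ι [T2Space S] {Ψ : BivectorField 𝓘(ℝ, E) M}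
    (hι : IsEmbeddedSymplecticLeaf (J := 𝓘(ℝ, F)) Ψ ι) (s : S) :
    Function.Bijective (baseMap (F := F) Ψ T.retr (ι s)) := by
  have hs := hι.embedding.isImmersion.contMDiff
  refine (bijective_baseMap_iff Ψ T.retr (ι s)).2 fun a ha => ?_
  let L : E →L[ℝ] F := mfderiv 𝓘(ℝ, E) 𝓘(ℝ, F) T.retr (ι s)
  let D : F →L[ℝ] E := mfderiv 𝓘(ℝ, F) 𝓘(ℝ, E) ι s
  let a' : F →L[ℝ] ℝ := a
  have hLD (v : F) : L (D v) = v := T.mfderiv_retr_ι hs s v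
  let P : (E →L[ℝ] ℝ) →ₗ[ℝ] E := Ψ.sharp (ι s)
  have hPD : D.range = LinearMap.range P := hι.tangent s
  have hskew (α β : E →L[ℝ] ℝ) : β (P α) = - α (P β) := Ψ.skew (ι s) α β
  have ha' : L (P (a' ∘L L)) = 0 := ha
  obtain ⟨b, hb⟩ : P (a' ∘L L) ∈ D.range := hPD ▸ LinearMap.mem_range_self P _
  have hb' : D b = P (a' ∘L L) := hb
  have hb0 : b = 0 := by rw [← hLD b, hb', ha']
  rw [hb0, map_zero] at hb'
  have h1 (v : F) : a' v = 0 := by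
    obtain ⟨β, hβ⟩ : D v ∈ LinearMap.range P := hPD ▸ LinearMap.mem_range_self D.toLinearMap v
    have h2 := hskew (a' ∘L L) β
    rw [← hb', map_zero, hβ, ContinuousLinearMap.comp_apply, hLD] at h2
    linarith
  exact ContinuousLinearMap.ext h1

lemma vertical_eq_zero_of_mem_range {Ψ : BivectorField 𝓘(ℝ, E) M}
    (hι : IsEmbeddedSymplecticLeaf (J := 𝓘(ℝ, F)) Ψ ι) (s : S) {w : TangentSpace 𝓘(ℝ, E) (ι s)}
    (hw : w ∈ LinearMap.range (Ψ.sharp (ι s)))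
    (h : mfderiv 𝓘(ℝ, E) 𝓘(ℝ, F) T.retr (ι s) w = 0) : w = 0 := by
  rw [← hι.tangent s] at hw
  obtain ⟨v, rfl⟩ := hw
  have h1 : v = 0 := (T.mfderiv_retr_ι hι.embedding.isImmersion.contMDiff s v).symm.trans h
  rw [h1]
  exact map_zero (mfderiv 𝓘(ℝ, F) 𝓘(ℝ, E) ι s)

end TubularNeighborhood

variable [SecondCountableTopology M]

/-- Transversality holds on the leaf and is an open condition, so it is achieved by shrinking any
tube. -/
theorem IsEmbeddedSymplecticLeaf.exists_tubularNeighborhood {Ψ : BivectorField 𝓘(ℝ, E) M}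
    (hι : IsEmbeddedSymplecticLeaf (J := 𝓘(ℝ, F)) Ψ ι) :
    ∃ T : TubularNeighborhood E F ι,
      ∀ x ∈ T.f.target, Function.Bijective (baseMap (F := F) Ψ T.retr x) := by
  have : T2Space S := hι.embedding.isEmbedding.t2Space
  -- A leaf contains the point through which it is taken.
  have : Nonempty S := by
    obtain ⟨x, hx⟩ := hι.isLeaf
    obtain ⟨s, -⟩ : x ∈ Set.range ι := hx ▸ Relation.ReflTransGen.refl
    exact ⟨s⟩
  obtain ⟨T⟩ := SemilocalPoisson.exists_tubularNeighborhood hι.embedding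
  let V : Set T.nbhd := {x | Function.Bijective (baseMap (F := F) (Ψ.restrict T.nbhd) T.proj x)}
  have hV : IsOpen V := isOpen_bijective_baseMap _ T.contMDiff_proj
  have hbase (x : T.nbhd) : baseMap (F := F) (Ψ.restrict T.nbhd) T.proj x =
      baseMap (F := F) Ψ T.retr x := baseMap_restrict Ψ (T.mdifferentiableAt_retr x.2)
  refine ⟨T.restrict (Subtype.val '' V) (T.nbhd.isOpen.isOpenMap_subtype_val V hV)
    fun s => ⟨⟨ι s, T.ι_mem s⟩, ?_, rfl⟩, ?_⟩
  · change Function.Bijective (baseMap (F := F) (Ψ.restrict T.nbhd) T.proj ⟨ι s, T.ι_mem s⟩)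
    rw [hbase]
    exact T.bijective_baseMap_ι hι s
  · rintro x ⟨⟨y, hy, rfl⟩, -⟩
    have h1 : Function.Bijective (baseMap (F := F) (Ψ.restrict T.nbhd) T.proj y) := hy
    rw [hbase] at h1
    exact h1

/-- The restriction of a Poisson tensor to a tubular neighborhood. -/
def TubularNeighborhood.transverseFibration (T : TubularNeighborhood E F ι)
    {Ψ : BivectorField 𝓘(ℝ, E) M} (hΨ : Ψ.IsPoisson)
    (hT : ∀ x ∈ T.f.target, Function.Bijective (baseMap (F := F) Ψ T.retr x)) :
    TransverseFibration E T.nbhd F S where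
  Ψ := Ψ.restrict T.nbhd
  poisson := hΨ.restrict T.nbhd
  pr := T.proj
  contMDiff_pr := T.contMDiff_proj
  bijective x := by
    have h := baseMap_restrict (F := F) Ψ (T.mdifferentiableAt_retr x.2)
    exact h ▸ hT x x.2

end Leaf

end SemilocalPoisson

end

theorem claim1
    {E : Type*} [NormedAddCommGroup E] [NormedSpace ℝ E] [FiniteDimensional ℝ E]
    {M : Type*} [TopologicalSpace M] [ChartedSpace E M] [IsManifold 𝓘(ℝ, E) ∞ M]
    [T2Space M] [SecondCountableTopology M]
    {F : Type*} [NormedAddCommGroup F] [NormedSpace ℝ F] [FiniteDimensional ℝ F]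
    {S : Type*} [TopologicalSpace S] [ChartedSpace F S] [IsManifold 𝓘(ℝ, F) ∞ S]
    (Ψ : SemilocalPoisson.BivectorField 𝓘(ℝ, E) M) (hΨ : Ψ.IsPoisson)
    (ι : S → M) (hι : SemilocalPoisson.IsEmbeddedSymplecticLeaf (J := 𝓘(ℝ, F)) Ψ ι) :
    ∃ (T : SemilocalPoisson.TubularNeighborhood E F ι)
      (ΨN ΨH ΨV : SemilocalPoisson.BivectorField 𝓘(ℝ, E) T.nbhd)
      (γ : SemilocalPoisson.EhresmannConnection 𝓘(ℝ, E) 𝓘(ℝ, F) T.proj)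
      (σ : SemilocalPoisson.RawForm 𝓘(ℝ, F) T.proj 2),
      -- `ΨN` is the restriction of `Ψ` to the tubular neighborhood
      SemilocalPoisson.BivectorField.Related Subtype.val ΨN Ψ ∧
      (∀ x, ΨN.sharp x = ΨH.sharp x + ΨV.sharp x) ∧
      (∀ x, ΨH.rank x = Module.finrank ℝ F) ∧
      ΨV.IsPoisson ∧
      (∀ x : T.nbhd, (x : M) ∈ Set.range ι → ΨV.sharp x = 0) ∧
      SemilocalPoisson.IsCoupling ΨN ΨH ΨV γ σ ∧
      γ.coboundaries ΨV 1 ≤ γ.cocycles ΨV 1 ∧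
      γ.coboundaries ΨV 2 ≤ γ.cocycles ΨV 2 ∧
      ∃ ρ : γ.algA ΨV →ₗ[ℝ] γ.cohomology ΨV 2,
        γ.IsRho ΨV σ ρ ∧
        ΨV.ham ≤ (LinearMap.ker ρ).map (γ.algA ΨV).subtype ∧
        Nonempty (ΨN.H1 ≃ₗ[ℝ] (γ.cohomology ΨV 1 ×
          (↥((LinearMap.ker ρ).map (γ.algA ΨV).subtype) ⧸
            ΨV.ham.submoduleOf ((LinearMap.ker ρ).map (γ.algA ΨV).subtype)))) := by
  -- The embedding passes these properties on to `S`; they provide the partitions of unity on which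
  -- the potentials depend.
  have : T2Space S := hι.embedding.isEmbedding.t2Space
  have : SecondCountableTopology S := hι.embedding.isEmbedding.isInducing.secondCountableTopology
  have : LocallyCompactSpace S := Manifold.locallyCompact_of_finiteDimensional 𝓘(ℝ, F)
  obtain ⟨T, hT⟩ := hι.exists_tubularNeighborhood
  let C := T.transverseFibration hΨ hT
  obtain ⟨ρ, hρ⟩ := C.exists_isRho
  refine ⟨T, C.Ψ, C.ΨH, C.ΨV, C.conn, C.sigma, Ψ.related_restrict T.nbhd, C.isCoupling.decomp,
    C.rank_ΨH, C.isPoisson_ΨV, ?_, C.isCoupling, C.coboundaries_one_le, C.coboundaries_two_le,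
    ρ, hρ, C.ham_le_map_ker hρ, C.nonempty_H1_equiv hρ⟩
  -- At a point of the leaf the values of `ΨV` are vertical; they also lie in the range of `Ψ♯`,
  -- since those of `Ψ` and `ΨH` do. That range is tangent to the leaf and meets the vertical space
  -- only in zero.
  rintro ⟨x, hx⟩ ⟨s, rfl⟩
  ext α : 1
  refine T.vertical_eq_zero_of_mem_range hι s ?_ ?_
  · have h1 : C.ΨH.sharp ⟨ι s, hx⟩ α ∈ LinearMap.range (Ψ.sharp (ι s)) := by
      have h2 : C.ΨH.sharp ⟨ι s, hx⟩ α ∈ LinearMap.range (C.ΨH.sharp ⟨ι s, hx⟩) := ⟨α, rfl⟩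
      rw [C.isCoupling.horizontal, ← C.isCoupling.coupling] at h2
      obtain ⟨β, -, hβ⟩ := h2
      exact ⟨β, hβ⟩
    have h3 : Ψ.sharp (ι s) α = C.ΨH.sharp ⟨ι s, hx⟩ α + C.ΨV.sharp ⟨ι s, hx⟩ α :=
      LinearMap.congr_fun (C.isCoupling.decomp ⟨ι s, hx⟩) α
    refine (Submodule.add_mem_iff_right (LinearMap.range (Ψ.sharp (ι s))) h1).1 ?_
    exact ⟨α, h3⟩
  · have h1 := C.isCoupling.vertical ⟨ι s, hx⟩ α
    have h2 := SemilocalPoisson.mfderiv_comp_opens_val (F := F) (q := T.retr) (U := T.nbhd)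
      (x := ⟨ι s, hx⟩) (T.mdifferentiableAt_retr hx)
    exact (congrArg (fun L : E →L[ℝ] F => L (C.ΨV.sharp ⟨ι s, hx⟩ α)) h2).symm.trans h1
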